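/- **Theorem 3.1 (Upper bound for the QM energy).** Let $V:\mathbb R^3\to[0,\infty)$ be measurable and locally bounded with $V(x)\to\infty$ as $|x|\to\infty$. Let $v:(0,\infty)\to[0,\infty]$ be measurable with finite scattering length $a=\lim_{r\to\infty}\bigl(r-u(r)/u'(r)\bigr)$, where $u$ is the nontrivial solution of the zero-energy scattering equation $-u''+\tfrac12 vu=0$ on the half line with $u(0)=0$ (with $u=0$ on $[0,R]$ and the equation holding on $(R,\infty)$, where $R\ge 0$ is the smallest radius such that $v$ is locally integrable on $(R,\infty)$; thus hard cores are allowed). For an integer $N\ge1$ let $E^{\rm QM}$ be the ground state energy of $$H^{(N)}=\sum_{i=1}^N\bigl(-\nabla_i^2+V(x_i)\bigr)+\sum_{i<j}v(|x_i-x_j|)$$ on totally symmetric wave functions in $L^2(\mathbb R^{3N})$, i.e. the infimum of the quadratic form $\langle\Psi,H^{(N)}\Psi\rangle$ over symmetric $\Psi$ with $\|\Psi\|_2=1$. Let $$E^{\rm GP}(N,a)=\inf\Bigl\{\int_{\mathbb R^3}\bigl(|\nabla\Phi|^2+V|\Phi|^2+4\pi a|\Phi|^4\bigr)\;:\;\nabla\Phi\in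 L^2,\ V|\Phi|^2\in L^1,\ \Phi\in L^4\cap L^2,\ \int|\Phi|^2=N\Bigr\},$$ let $\Phi^{\rm GP}>0$ be the positive minimizer, $\rho^{\rm GP}=(\Phi^{\rm GP})^2$, and put $$\bar\rho=\frac1N\int(\rho^{\rm GP})^2,\qquad c=\frac{\bar\rho}{\|\rho^{\rm GP}\|_\infty},\qquad \frac{4\pi}{3}\bar\rho\,b^3=c .$$ 1. If $a<b$, then $$E^{\rm QM}\le\frac{\int\bigl(|\nabla\Phi^{\rm GP}|^2+V(\Phi^{\rm GP})^2\bigr)}{(1-\frac ab)^3}+4\pi a\int(\Phi^{\rm GP})^4\;\frac{1+\frac2c\,\frac ab-\frac2c\bigl(\frac ab\bigr)^2+\frac1{2c}\bigl(\frac ab\bigr)^3}{(1-\frac ab)^8}.$$ 2. In particular $E^{\rm QM}\le E^{\rm GP}(N,a)\bigl(1+O(a\bar\rho^{1/3})\bigr)$ for small $a\bar\rho^{1/3}$, in the following two senses. (i) For every $c_0>0$ there are $C,\delta>0$, depending only on $c_0$, such that for all $N\ge 1$, $V$, $v$ as above with $c\ge c_0$ and $a\bar\rho^{1/3}\le\delta$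 one has $E^{\rm QM}\le E^{\rm GP}(N,a)\bigl(1+C\,a\bar\rho^{1/3}\bigr)$. (ii) For every $V$ as above and every $A>0$ there are $C,\delta>0$, depending only on $V$ and $A$, such that the same inequality holds for all $N\ge1$ and all $v$ as above with $Na\le A$ and $a\bar\rho^{1/3}\le\delta$. -/

import Mathlib

open MeasureTheory Set Filter Topology
open scoped ENNReal ContDiff

noncomputable section

namespace BoseGas

/-- The one-particle space `ℝ³`, with the Euclidean norm and Lebesgue measure. -/
abbrev E3 : Type := EuclideanSpace ℝ (Fin 3)

/-- The configuration space `ℝ^{3N}` of `N` particles, with Lebesgue measure. -/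
abbrev Config (N : ℕ) : Type := Fin N → E3

/-- The `k`-th unit vector of `ℝ³`. -/
def dir (k : Fin 3) : E3 := EuclideanSpace.single k 1

/-- The unit vector of `ℝ^{3N}` that moves particle `p.1` in the coordinate direction `p.2`. -/
def configDir (N : ℕ) (p : Fin N × Fin 3) : Config N := Pi.single p.1 (dir p.2)

/-! ### Weak derivatives and kinetic energy -/

section Weak

variable {E : Type*} [NormedAddCommGroup E] [NormedSpace ℝ E] [MeasureSpace E]

/-- `g` is the weak (distributional) derivative of `f` in the direction `w`:
both are locally integrable and `∫ (∂_w φ) f = - ∫ φ g` for all test functions `φ`. -/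
def HasWeakDeriv (f g : E → ℂ) (w : E) : Prop :=
  LocallyIntegrable f volume ∧ LocallyIntegrable g volume ∧
    ∀ φ : E → ℝ, ContDiff ℝ ∞ φ → HasCompactSupport φ →
      ∫ x, ((fderiv ℝ φ x w : ℝ) : ℂ) * f x = - ∫ x, (φ x : ℂ) * g x

/-- `∫ |∇f|²`, the gradient being the weak gradient along the directions `e k`. Weak derivatives
are unique up to null sets, so the infimum is over a single value if the weak gradient of `f`
exists; it is `∞` if there is no weak gradient that is locally integrable. -/
def kineticEnergy {ι : Type*} [Fintype ι] (e : ι → E) (f : E → ℂ) : ℝ≥0∞ :=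
  ⨅ (D : ι → E → ℂ) (_ : ∀ k, HasWeakDeriv f (D k) (e k)), ∫⁻ x, ∑ k, ‖D k x‖ₑ ^ 2

end Weak

/-! ### The potentials -/

/-- The external potentials: measurable, locally bounded, tending to infinity at infinity,
and nonnegative. -/
structure IsTrap (V : E3 → ℝ) : Prop where
  measurable : Measurable V
  locallyBounded : ∀ R : ℝ, ∃ M : ℝ, ∀ x, ‖x‖ ≤ R → V x ≤ M
  tendsto : ∀ M : ℝ, ∃ R : ℝ, ∀ x, R ≤ ‖x‖ → M ≤ V x
  nonneg : ∀ x, 0 ≤ V x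

/-- `u`, with derivative `u'`, is a (positive) solution of the zero energy scattering equation
`-u'' + v u / 2 = 0`, `u(0) = 0`, on the half line, for a measurable interaction
`v : (0,∞) → [0,∞]`, which may have a hard core (the values of `v` on `(-∞,0]` are irrelevant).
`R` is the radius of the core: the smallest `R ≥ 0` such that `v` is locally integrable on
`(R,∞)`. If `v` is infinite near the origin, or if it is so singular at some radius that the wave
function has to vanish there, then `R > 0` and `u` vanishes on `[0,R]`; otherwise `R = 0`.
On `(R,∞)` the equation holds in integrated form. -/
structure IsScatteringSolution (v : ℝ → ℝ≥0∞) (R : ℝ) (u u' : ℝ → ℝ) : Prop where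
  core_nonneg : 0 ≤ R
  core_singular : ∀ s t : ℝ, 0 ≤ s → s < R → R < t → ∫⁻ r in Ioo s t, v r = ⊤
  locallyIntegrable : ∀ s t : ℝ, R < s → s < t → ∫⁻ r in Ioo s t, v r < ⊤
  eq_zero : ∀ r ∈ Icc 0 R, u r = 0
  continuousOn : ContinuousOn u (Ici 0)
  pos : ∀ r, R < r → 0 < u r
  hasDerivAt : ∀ r, R < r → HasDerivAt u (u' r) r
  equation : ∀ s t : ℝ, R < s → s ≤ t →
    u' t - u' s = ∫ r in s..t, (1 / 2) * (v r).toReal * u r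

/-- `a` is the (finite) scattering length of `v`: `a = lim_{r → ∞} (r - u(r)/u'(r))`. -/
def IsScatteringLength (v : ℝ → ℝ≥0∞) (a : ℝ) : Prop :=
  ∃ (R : ℝ) (u u' : ℝ → ℝ), IsScatteringSolution v R u u' ∧
    Tendsto (fun r => r - u r / u' r) atTop (𝓝 a)

/-! ### The quantum mechanical ground state energy -/

/-- The quadratic form `⟨Ψ, H Ψ⟩` of the Hamiltonian
`H = ∑ᵢ (-∇ᵢ² + V(xᵢ)) + ∑_{i<j} v(|xᵢ - xⱼ|)`, with value `∞` off the form domain. -/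
def qmForm (N : ℕ) (V : E3 → ℝ) (v : ℝ → ℝ≥0∞) (Ψ : Config N → ℂ) : ℝ≥0∞ :=
  kineticEnergy (configDir N) Ψ
    + ∫⁻ x, (∑ i, ENNReal.ofReal (V (x i))
        + ∑ i, ∑ j, if i < j then v ‖x i - x j‖ else 0) * ‖Ψ x‖ₑ ^ 2

/-- Bosonic wave functions: square integrable, normalized, and (almost everywhere) symmetric under
all permutations of the particles. -/
structure IsBosonicState (N : ℕ) (Ψ : Config N → ℂ) : Prop where
  memLp : MemLp Ψ 2 volume
  normalized : ∫⁻ x, ‖Ψ x‖ₑ ^ 2 = 1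
  symmetric : ∀ σ : Equiv.Perm (Fin N), (fun x : Config N => Ψ (x ∘ σ)) =ᵐ[volume] Ψ

/-- The bosonic ground state energy `E^QM`: the infimum of `⟨Ψ, H Ψ⟩` over the normalized
symmetric wave functions. -/
def qmEnergy (N : ℕ) (V : E3 → ℝ) (v : ℝ → ℝ≥0∞) : ℝ≥0∞ :=
  ⨅ (Ψ : Config N → ℂ) (_ : IsBosonicState N Ψ), qmForm N V v Ψ

/-! ### Gross-Pitaevskii theory -/

/-- `∫ V |Φ|²`. -/
def trapEnergy (V : E3 → ℝ) (Φ : E3 → ℂ) : ℝ≥0∞ :=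
  ∫⁻ x, ENNReal.ofReal (V x) * ‖Φ x‖ₑ ^ 2

/-- The functional `∫ (|∇Φ|² + V |Φ|² + 4π a |Φ|⁴)`. -/
def gpFunctional (V : E3 → ℝ) (a : ℝ) (Φ : E3 → ℂ) : ℝ≥0∞ :=
  kineticEnergy dir Φ + trapEnergy V Φ
    + ENNReal.ofReal (4 * Real.pi * a) * ∫⁻ x, ‖Φ x‖ₑ ^ 4

/-- The admissible functions: `∇Φ ∈ L²`, `V |Φ|² ∈ L¹`, `Φ ∈ L⁴ ∩ L²`, and `∫ |Φ|² = N`. -/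
structure InGPDomain (V : E3 → ℝ) (N : ℕ) (Φ : E3 → ℂ) : Prop where
  kinetic : kineticEnergy dir Φ < ⊤
  trap : trapEnergy V Φ < ⊤
  memL4 : MemLp Φ 4 volume
  memL2 : MemLp Φ 2 volume
  normalized : ∫⁻ x, ‖Φ x‖ₑ ^ 2 = N

/-- The Gross-Pitaevskii energy `E^GP(N,a)`. -/
def gpEnergy (V : E3 → ℝ) (N : ℕ) (a : ℝ) : ℝ≥0∞ :=
  ⨅ (Φ : E3 → ℂ) (_ : InGPDomain V N Φ), gpFunctional V a Φ

/-- `Φ` is the positive minimizer `Φ^GP` of the Gross-Pitaevskii functional under the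
condition `∫ |Φ|² = N` (as an element of `L²`, that is, up to null sets). -/
structure IsGPMinimizer (V : E3 → ℝ) (N : ℕ) (a : ℝ) (Φ : E3 → ℝ) : Prop where
  mem : InGPDomain V N (fun x => (Φ x : ℂ))
  minimal : gpFunctional V a (fun x => (Φ x : ℂ)) = gpEnergy V N a
  pos : ∀ᵐ x, 0 < Φ x

/-- `∫ (|∇Φ|² + V Φ²)`, as a real number. -/
def linearEnergy (V : E3 → ℝ) (Φ : E3 → ℝ) : ℝ :=
  (kineticEnergy dir (fun x => (Φ x : ℂ)) + trapEnergy V (fun x => (Φ x : ℂ))).toReal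

/-- The mean density `ρ̄ = (1/N) ∫ ρ²` of `ρ = Φ²`. -/
def meanDensity (N : ℕ) (Φ : E3 → ℝ) : ℝ :=
  (1 / (N : ℝ)) * ∫ x, Φ x ^ 4

/-- `‖ρ‖_∞` for `ρ = Φ²`. -/
def maxDensity (Φ : E3 → ℝ) : ℝ :=
  (eLpNorm (fun x => Φ x ^ 2) ⊤ volume).toReal

/-- `c = ρ̄ / ‖ρ‖_∞`. -/
def cParam (N : ℕ) (Φ : E3 → ℝ) : ℝ :=
  meanDensity N Φ / maxDensity Φ

/-- The length `b`, given by `(4π/3) ρ̄ b³ = c`. -/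
def bParam (N : ℕ) (Φ : E3 → ℝ) : ℝ :=
  (3 * cParam N Φ / (4 * Real.pi * meanDensity N Φ)) ^ (1 / 3 : ℝ)

end BoseGas

end

/-! The bound is variational. The trial state is the product of `Φ` over all particles, `Φ` being
the Gross-Pitaevskii minimizer, times a Jastrow factor `F`, the product of `ζ (x i - x j)` over all
pairs. The pair factor `ζ` is, up to a small shift, the zero-energy scattering solution `u(r)/r`,
normalized to be `1` at a range `B` and continued by `1` beyond.

The one-particle terms are eliminated exactly. Testing the Euler-Lagrange equation of `Φ` with `G²
Φ`, where `G` is `F` as a function of one particle, and using `∇Φ·∇(G²Φ) = |∇(GΦ)|² - |∇G|² Φ²`, one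
finds that kinetic plus trap energy of the trial state equals the chemical potential, minus `8πa`
times the expected sum of `ρ(x_k)`, plus the integral of `|∇F|²` against the product density
(`GPData.slice_le`, `GPData.trial_energy_le`). What remains are correlation terms.

Let `M = ‖ρ‖_∞` and `d = ∫ Φ⁴`, and let `I`, `Iv`, `J`, `K` bound the integrals of `|∇ζ|²`, `v ζ²`,
`1 - ζ²` and `|∇ζ|`. Deleting all pair factors of one particle increases the squared norm by at most
the factor `1/(1 - MJ)`, by a union bound (`jastrowMass_insert_le`). After the particles occurring
in a term have been deleted from `F`, their variables can be integrated out. Pair terms yield `d (I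
+ Iv/2)/(1 - MJ)²`, products of gradients at three particles yield `N (MK)²/(1 - MJ)³`, and the
density term loses at most `8πa N M² J` (`qmEnergy_le_of_pairBounds`).

The scattering equation makes `I + Iv/2` close to `4πa/(1 - a/B)`. The solution `u` is convex, so
its tangent at `r` meets the axis at a point `r - u/u'` that increases to `a`. This single fact
controls the core, the defect `1 - ζ²`, the gradient, and also the part of `v` beyond `B`, where the
factor is `1` (`IsScatteringSolution.radius_mono`, `IsScatteringSolution.integral_tail_le`,
`IsScatteringLength.exists_pairBounds`). Since `b` is the radius with `(4π/3) M b³ = 1`, the choice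
`B = β b`, with `β = 1/2` for `a/b ≤ 1/3` and `β = 1` otherwise, turns all errors into functions of
`a/b` and `c`. An elementary inequality compares them with the asserted expression
(`trial_error_le`).

For the relative error, `b ρ̄^{1/3} = (3c/4π)^{1/3}`, so that a lower bound for `c` makes `a/b` of
order `a ρ̄^{1/3}`. For a fixed trap and bounded `N a` such a lower bound holds uniformly: the
energy per particle is bounded, confinement gives `ρ̄ ≥ κ N`, and since `-ΔΦ ≤ μΦ` weakly, a mean
value inequality gives `‖ρ‖_∞ ≤ L² N` (`exists_meanDensity_ge`, `GPData.ae_le`, `exists_cParam_ge`).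
-/

namespace BoseGas

set_option linter.unusedSectionVars false

/-! ### Weak derivatives of real functions -/

section RealWeak

variable {E : Type*} [NormedAddCommGroup E] [NormedSpace ℝ E] [MeasureSpace E]

/-- Weak directional derivatives of real functions. -/
def RealWeakDeriv (f g : E → ℝ) (w : E) : Prop :=
  LocallyIntegrable f volume ∧ LocallyIntegrable g volume ∧
    ∀ φ : E → ℝ, ContDiff ℝ ∞ φ → HasCompactSupport φ →
      ∫ x, fderiv ℝ φ x w * f x = - ∫ x, φ x * g x

theorem RealWeakDeriv.hasWeakDeriv {f g : E → ℝ} {w : E} (h : RealWeakDeriv f g w) :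
    HasWeakDeriv (fun x => (f x : ℂ)) (fun x => (g x : ℂ)) w := by
  obtain ⟨hf, hg, h⟩ := h
  refine ⟨fun x => ?_, fun x => ?_, fun φ h1 h2 => ?_⟩
  · obtain ⟨s, hs, hi⟩ := hf x
    exact ⟨s, hs, hi.ofReal⟩
  · obtain ⟨s, hs, hi⟩ := hg x
    exact ⟨s, hs, hi.ofReal⟩
  · have := h φ h1 h2
    have h3 := congrArg (fun r : ℝ => (r : ℂ)) this
    simp only [Complex.ofReal_neg] at h3
    rw [← integral_complex_ofReal, ← integral_complex_ofReal] at h3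
    simpa only [Complex.ofReal_mul] using h3

theorem enorm_complex_ofReal (r : ℝ) : ‖(r : ℂ)‖ₑ = ‖r‖ₑ := by
  rw [← ofReal_norm, ← ofReal_norm, Complex.norm_real]

theorem locallyIntegrable_re {g : E → ℂ} (hg : LocallyIntegrable g volume) :
    LocallyIntegrable (fun x => (g x).re) volume := by
  intro x
  obtain ⟨s, hs, hi⟩ := hg x
  exact ⟨s, hs, hi.re⟩

variable [BorelSpace E] [FiniteDimensional ℝ E] [(volume : Measure E).IsAddHaarMeasure]

theorem integrable_mul_of_hasCompactSupport {φ : E → ℝ} (hφ : Continuous φ)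
    (hc : HasCompactSupport φ) {F : Type*} [NormedAddCommGroup F] [NormedSpace ℝ F] {f : E → F}
    (hf : LocallyIntegrable f volume) :
    Integrable (fun x => φ x • f x) volume :=
  hf.integrable_smul_left_of_hasCompactSupport hφ hc

/-- Test functions are real, so real parts may be taken in the defining identity. Since `Φ` and the
trial functions are real, all later work can be done with real weak derivatives. -/
theorem HasWeakDeriv.re {f : E → ℝ} {g : E → ℂ} {w : E}
    (h : HasWeakDeriv (fun x => (f x : ℂ)) g w) : RealWeakDeriv f (fun x => (g x).re) w := by
  obtain ⟨hf, hg, h⟩ := h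
  have hf' : LocallyIntegrable f volume := by simpa using locallyIntegrable_re hf
  refine ⟨hf', locallyIntegrable_re hg, fun φ h1 h2 => ?_⟩
  have h3 := congrArg Complex.re (h φ h1 h2)
  have hφc : Continuous φ := h1.continuous
  have i1 : Integrable (fun x => (φ x : ℂ) * g x) volume := by
    simpa using integrable_mul_of_hasCompactSupport hφc h2 hg
  have e1 : (∫ x, (φ x : ℂ) * g x).re = ∫ x, φ x * (g x).re := by
    rw [show (∫ x, (φ x : ℂ) * g x).re = ∫ x, ((φ x : ℂ) * g x).re from
      (integral_re i1).symm]
    simp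
  rw [Complex.neg_re, e1] at h3
  rw [← h3]
  simp_rw [← Complex.ofReal_mul]
  rw [integral_complex_ofReal, Complex.ofReal_re]

theorem RealWeakDeriv.unique {f g g' : E → ℝ} {w : E} (h : RealWeakDeriv f g w)
    (h' : RealWeakDeriv f g' w) : g =ᵐ[volume] g' := by
  refine ae_eq_of_integral_contDiff_smul_eq h.2.1 h'.2.1 fun φ h1 h2 => ?_
  have := (h.2.2 φ h1 h2).symm.trans (h'.2.2 φ h1 h2)
  simpa using this

theorem RealWeakDeriv.congr {f f' g g' : E → ℝ} {w : E} (h : RealWeakDeriv f g w)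
    (hf : f =ᵐ[volume] f') (hg : g =ᵐ[volume] g') : RealWeakDeriv f' g' w := by
  refine ⟨h.1.congr hf, h.2.1.congr hg, fun φ h1 h2 => ?_⟩
  have e1 : ∫ x, fderiv ℝ φ x w * f' x = ∫ x, fderiv ℝ φ x w * f x :=
    integral_congr_ae (by filter_upwards [hf] with x hx; rw [hx])
  have e2 : ∫ x, φ x * g' x = ∫ x, φ x * g x :=
    integral_congr_ae (by filter_upwards [hg] with x hx; rw [hx])
  rw [e1, e2, h.2.2 φ h1 h2]

/-- A sequence of bump functions concentrating at the origin. -/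
noncomputable def mollifier (E : Type*) [NormedAddCommGroup E] [NormedSpace ℝ E] (n : ℕ) :
    ContDiffBump (0 : E) where
  rIn := 1 / (2 * ((n : ℝ) + 1))
  rOut := 1 / ((n : ℝ) + 1)
  rIn_pos := by positivity
  rIn_lt_rOut := by
    apply one_div_lt_one_div_of_lt <;> [positivity; nlinarith [(Nat.cast_nonneg n : (0 : ℝ) ≤ n)]]

theorem tendsto_mollifier : Tendsto (fun n => (mollifier E n).rOut) atTop (𝓝 0) :=
  tendsto_one_div_add_atTop_nhds_zero_nat

/-- The bounded ratio of outer and inner radius is the hypothesis under which the mollifications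
converge almost everywhere, by Lebesgue differentiation. -/
theorem mollifier_rOut_le (n : ℕ) : (mollifier E n).rOut ≤ 2 * (mollifier E n).rIn := by
  simp only [mollifier]
  apply le_of_eq
  field_simp

theorem mollifier_rOut_le_one (n : ℕ) : (mollifier E n).rOut ≤ 1 := by
  simp only [mollifier]
  rw [div_le_one (by positivity)]
  linarith [(Nat.cast_nonneg n : (0 : ℝ) ≤ n)]

open scoped Convolution in
/-- The mollification of a function. -/
noncomputable def mollify (n : ℕ) (f : E → ℝ) : E → ℝ :=
  (mollifier E n).normed volume ⋆[ContinuousLinearMap.lsmul ℝ ℝ, volume] f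

theorem mollify_apply (n : ℕ) (f : E → ℝ) (x : E) :
    mollify n f x = ∫ t, (mollifier E n).normed volume t * f (x - t) := rfl

theorem contDiff_mollify (n : ℕ) {f : E → ℝ} (hf : LocallyIntegrable f volume) :
    ContDiff ℝ ∞ (mollify n f) :=
  (mollifier E n).hasCompactSupport_normed.contDiff_convolution_left _
    (mollifier E n).contDiff_normed hf

theorem hasCompactSupport_mollify (n : ℕ) {f : E → ℝ} (hf : HasCompactSupport f) :
    HasCompactSupport (mollify n f) :=
  (mollifier E n).hasCompactSupport_normed.convolution _ hf

theorem abs_mollify_le (n : ℕ) {f : E → ℝ} {C : ℝ} (hf : ∀ x, |f x| ≤ C) (x : E) :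
    |mollify n f x| ≤ C := by
  rw [mollify_apply]
  have h1 : ∀ t, ‖(mollifier E n).normed volume t * f (x - t)‖
      ≤ (mollifier E n).normed volume t * C := fun t => by
    rw [norm_mul, Real.norm_eq_abs, abs_of_nonneg ((mollifier E n).nonneg_normed t)]
    exact mul_le_mul_of_nonneg_left (hf _) ((mollifier E n).nonneg_normed t)
  have h2 := norm_integral_le_of_norm_le
    ((mollifier E n).integrable_normed.mul_const C) (Eventually.of_forall h1)
  rwa [integral_mul_const, (mollifier E n).integral_normed, one_mul] at h2

/-- All mollifications live in one fixed neighbourhood of the support, which supplies the integrable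
majorant for dominated convergence. -/
theorem mollify_eq_zero (n : ℕ) {f : E → ℝ} {x : E} (hf : x ∉ Metric.cthickening 1 (tsupport f)) :
    mollify n f x = 0 := by
  rw [mollify_apply]
  refine integral_eq_zero_of_ae (Eventually.of_forall fun t => ?_)
  simp only [Pi.zero_apply, mul_eq_zero, or_iff_not_imp_left]
  intro ht
  by_contra h
  apply hf
  have ht' : t ∈ Function.support ((mollifier E n).normed volume) := ht
  rw [(mollifier E n).support_normed_eq, mem_ball_zero_iff] at ht'
  refine Metric.mem_cthickening_of_dist_le x (x - t) 1 _ (subset_tsupport _ h) ?_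
  rw [dist_eq_norm, sub_sub_cancel]
  exact ht'.le.trans (mollifier_rOut_le_one n)

theorem ae_tendsto_mollify {f : E → ℝ} (hf : LocallyIntegrable f volume) :
    ∀ᵐ x, Tendsto (fun n => mollify n f x) atTop (𝓝 (f x)) :=
  ContDiffBump.ae_convolution_tendsto_right_of_locallyIntegrable (μ := volume)
    tendsto_mollifier (Eventually.of_forall mollifier_rOut_le) hf

/-- Differentiation under the integral: the difference quotients of `ψ` are bounded by the Lipschitz
constant times `‖w‖` and converge almost everywhere by Rademacher's theorem. -/
theorem fderiv_mollify (n : ℕ) {ψ : E → ℝ} {C : NNReal} (hψ : LipschitzWith C ψ) (w x : E) :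
    fderiv ℝ (mollify n ψ) x w = mollify n (fun y => lineDeriv ℝ ψ y w) x := by
  set b := (mollifier E n).normed volume with hb
  have hbc : Continuous b := (mollifier E n).continuous_normed
  have hbi : Integrable b volume := (mollifier E n).integrable_normed
  have hmeas : ∀ s : ℝ, AEStronglyMeasurable (fun t => b t * ψ (x + s • w - t)) volume := fun s =>
    (hbc.mul (hψ.continuous.comp (by fun_prop))).aestronglyMeasurable
  have key := hasDerivAt_integral_of_dominated_loc_of_lip (μ := (volume : Measure E))
    (F := fun s t => b t * ψ (x + s • w - t)) (F' := fun t => b t * lineDeriv ℝ ψ (x - t) w)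
    (x₀ := (0 : ℝ)) (bound := fun t => b t * (C * ‖w‖)) (s := univ) univ_mem
    (Eventually.of_forall hmeas)
    (by
      refine Continuous.integrable_of_hasCompactSupport
        (hbc.mul (hψ.continuous.comp (by fun_prop))) ?_
      exact (mollifier E n).hasCompactSupport_normed.mul_right)
    (by
      refine (hbc.measurable.mul ?_).aestronglyMeasurable
      exact (measurable_lineDeriv hψ.continuous).comp (measurable_const.sub measurable_id))
    (by
      refine Eventually.of_forall fun t => ?_
      refine LipschitzOnWith.of_dist_le_mul fun r _ s _ => ?_
      have h1 := hψ.dist_le_mul (x + r • w - t) (x + s • w - t)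
      have h2 : dist (x + r • w - t) (x + s • w - t) = ‖w‖ * dist r s := by
        rw [dist_eq_norm, show x + r • w - t - (x + s • w - t) = (r - s) • w by
          rw [sub_smul]; abel, norm_smul, mul_comm, dist_eq_norm]
      rw [h2] at h1
      have hbt : 0 ≤ b t := (mollifier E n).nonneg_normed t
      rw [Real.dist_eq, ← mul_sub, abs_mul, abs_of_nonneg hbt, ← Real.dist_eq,
        Real.coe_nnabs, abs_of_nonneg (by positivity)]
      calc _ ≤ b t * (C * (‖w‖ * dist r s)) := by gcongr
        _ = _ := by ring)
    (hbi.mul_const _)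
    (by
      have h1 := hψ.ae_lineDifferentiableAt (μ := volume) w
      have h2 : ∀ᵐ t, LineDifferentiableAt ℝ ψ (x - t) w :=
        (Measure.measurePreserving_sub_left volume x).quasiMeasurePreserving.ae h1
      filter_upwards [h2] with t ht
      have h3 := ht.hasLineDerivAt
      rw [HasLineDerivAt] at h3
      have h4 := h3.const_mul (b t)
      refine h4.congr_of_eventuallyEq (Eventually.of_forall fun s => ?_)
      simp only
      congr 2
      abel)
  have hd : DifferentiableAt ℝ (mollify n ψ) x :=
    ((contDiff_mollify n hψ.continuous.locallyIntegrable).differentiable (by simp)) x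
  have h5 : HasLineDerivAt ℝ (mollify n ψ) (mollify n (fun y => lineDeriv ℝ ψ y w) x) x w :=
    key.2
  rw [← hd.lineDeriv_eq_fderiv, h5.lineDeriv]

theorem abs_lineDeriv_le {ψ : E → ℝ} {C : NNReal} (hψ : LipschitzWith C ψ) (x w : E) :
    |lineDeriv ℝ ψ x w| ≤ C * ‖w‖ := by
  have := norm_lineDeriv_le_of_lipschitz ℝ hψ (x₀ := x) (v := w)
  simpa using this

theorem tsupport_lineDeriv_subset (ψ : E → ℝ) (w : E) :
    tsupport (fun y => lineDeriv ℝ ψ y w) ⊆ tsupport ψ := by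
  apply closure_minimal _ (isClosed_tsupport ψ)
  intro x hx
  by_contra h
  apply hx
  have h1 : ψ =ᶠ[𝓝 x] 0 := notMem_tsupport_iff_eventuallyEq.mp h
  show lineDeriv ℝ ψ x w = 0
  rw [h1.lineDeriv_eq]
  simp [lineDeriv]

/-- Weak derivatives may be tested with Lipschitz functions of compact support. -/
theorem RealWeakDeriv.integral_lineDeriv_mul {f g ψ : E → ℝ} {w : E} (h : RealWeakDeriv f g w)
    {C : NNReal} (hψ : LipschitzWith C ψ) (hc : HasCompactSupport ψ) :
    ∫ x, lineDeriv ℝ ψ x w * f x = - ∫ x, ψ x * g x := by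
  set K := Metric.cthickening 1 (tsupport ψ) with hK
  have hKc : IsCompact K := hc.isCompact.cthickening
  obtain ⟨A, hA⟩ := hψ.continuous.bounded_above_of_compact_support hc
  -- Applied to `ψ` and to its line derivative: the mollifications keep the bound `B`, stay
  -- supported in `K` and converge almost everywhere, so dominated convergence passes to the limit
  -- on both sides of the identity for smooth test functions.
  have gen : ∀ (χ k : E → ℝ) (B : ℝ), (∀ x, |χ x| ≤ B) → LocallyIntegrable χ volume →
      tsupport χ ⊆ tsupport ψ → LocallyIntegrable k volume →
      Tendsto (fun n => ∫ x, mollify n χ x * k x) atTop (𝓝 (∫ x, χ x * k x)) := by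
    intro χ k B hB hχ hs hk
    refine tendsto_integral_of_dominated_convergence (fun x => K.indicator (fun x => B * |k x|) x)
      (fun n => ?_) ?_ (fun n => ?_) ?_
    · exact ((contDiff_mollify n hχ).continuous.aestronglyMeasurable).mul hk.aestronglyMeasurable
    · exact IntegrableOn.integrable_indicator ((hk.integrableOn_isCompact hKc).abs.const_mul B)
        hKc.isClosed.measurableSet
    · refine Eventually.of_forall fun x => ?_
      by_cases hx : x ∈ K
      · rw [indicator_of_mem hx, norm_mul]
        exact mul_le_mul_of_nonneg_right (abs_mollify_le n hB x) (abs_nonneg _)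
      · rw [mollify_eq_zero n (fun h' => hx (Metric.cthickening_subset_of_subset 1 hs h'))]
        simp [indicator_of_notMem hx]
    · filter_upwards [ae_tendsto_mollify hχ] with x hx
      exact hx.mul_const _
  have t1 := gen ψ g A (fun x => hA x) hψ.continuous.locallyIntegrable subset_rfl h.2.1
  have t2 := gen (fun y => lineDeriv ℝ ψ y w) f (C * ‖w‖) (fun x => abs_lineDeriv_le hψ x w)
    (hψ.locallyIntegrable_lineDeriv w) (tsupport_lineDeriv_subset ψ w) h.1
  refine tendsto_nhds_unique t2 (t1.neg.congr fun n => ?_)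
  rw [← h.2.2 _ (contDiff_mollify n hψ.continuous.locallyIntegrable)
    (hasCompactSupport_mollify n hc)]
  simp_rw [fderiv_mollify n hψ]

theorem locallyIntegrable_bdd_mul {f g : E → ℝ} {B : ℝ} (hf : LocallyIntegrable f volume)
    (hg : AEStronglyMeasurable g volume) (hB : ∀ x, |g x| ≤ B) :
    LocallyIntegrable (fun x => g x * f x) volume := by
  have h1 : LocallyIntegrable (fun x => B • f x) volume := hf.smul B
  refine h1.mono (hg.mul hf.aestronglyMeasurable) (Eventually.of_forall fun x => ?_)
  rw [norm_mul, norm_smul]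
  exact mul_le_mul_of_nonneg_right ((hB x).trans (le_abs_self B)) (norm_nonneg _)

theorem lipschitzWith_mul {X : Type*} [PseudoMetricSpace X] {f g : X → ℝ} {C D : NNReal} {A B : ℝ}
    (hf : LipschitzWith C f) (hg : LipschitzWith D g)
    (hA : ∀ x, |f x| ≤ A) (hB : ∀ x, |g x| ≤ B) :
    LipschitzWith (Real.toNNReal (A * D + B * C)) (fun x => f x * g x) := by
  refine LipschitzWith.of_dist_le' fun x y => ?_
  have h1 := hf.dist_le_mul x y
  have h2 := hg.dist_le_mul x y
  rw [Real.dist_eq] at h1 h2 ⊢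
  have h3 : f x * g x - f y * g y = f x * (g x - g y) + g y * (f x - f y) := by ring
  rw [h3]
  refine (abs_add_le _ _).trans ?_
  rw [abs_mul, abs_mul]
  have := mul_le_mul (hA x) h2 (abs_nonneg _) ((abs_nonneg _).trans (hA x))
  have := mul_le_mul (hB y) h1 (abs_nonneg _) ((abs_nonneg _).trans (hB y))
  nlinarith

/-- The product rule for a weakly differentiable function and a bounded Lipschitz function. -/
theorem RealWeakDeriv.lipschitz_mul {f g G : E → ℝ} {w : E} (h : RealWeakDeriv f g w)
    {C : NNReal} (hG : LipschitzWith C G) {B : ℝ} (hB : ∀ x, |G x| ≤ B) :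
    RealWeakDeriv (fun x => G x * f x) (fun x => G x * g x + lineDeriv ℝ G x w * f x) w := by
  have hmG : Measurable (fun x => lineDeriv ℝ G x w) := measurable_lineDeriv hG.continuous
  have l1 := locallyIntegrable_bdd_mul h.1 hG.continuous.aestronglyMeasurable hB
  have l2 := locallyIntegrable_bdd_mul h.2.1 hG.continuous.aestronglyMeasurable hB
  have l3 := locallyIntegrable_bdd_mul h.1 hmG.aestronglyMeasurable
    (fun x => abs_lineDeriv_le hG x w)
  refine ⟨l1, l2.add l3, fun φ h1 h2 => ?_⟩
  obtain ⟨D, hD⟩ := h1.lipschitzWith_of_hasCompactSupport h2 (by simp)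
  obtain ⟨A, hA⟩ := h1.continuous.bounded_above_of_compact_support h2
  -- The product of a smooth test function with `G` is only Lipschitz, which is why the class of
  -- test functions had to be enlarged first.
  have key := h.integral_lineDeriv_mul (lipschitzWith_mul hD hG hA hB) h2.mul_right
  have e1 : ∀ᵐ x, lineDeriv ℝ (fun x => φ x * G x) x w * f x
      = fderiv ℝ φ x w * (G x * f x) + φ x * (lineDeriv ℝ G x w * f x) := by
    filter_upwards [hG.ae_lineDifferentiableAt (μ := volume) w] with x hx
    have d1 : HasLineDerivAt ℝ φ (fderiv ℝ φ x w) x w :=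
      ((h1.differentiable (by simp)) x).hasFDerivAt.hasLineDerivAt w
    have d2 : HasLineDerivAt ℝ (fun x => φ x * G x)
        (fderiv ℝ φ x w * G x + φ x * lineDeriv ℝ G x w) x w := by
      have := HasDerivAt.mul d1 hx.hasLineDerivAt
      simp only [zero_smul, add_zero] at this
      exact this
    rw [d2.lineDeriv]
    ring
  have hcφ : Continuous fun x => fderiv ℝ φ x w :=
    (h1.continuous_fderiv (by simp)).clm_apply continuous_const
  have i1 := integrable_mul_of_hasCompactSupport hcφ (h2.fderiv_apply ℝ w) l1
  have i2 := integrable_mul_of_hasCompactSupport h1.continuous h2 l2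
  have i3 := integrable_mul_of_hasCompactSupport h1.continuous h2 l3
  simp only [smul_eq_mul] at i1 i2 i3
  rw [integral_congr_ae e1, integral_add i1 i3] at key
  simp_rw [mul_add]
  rw [integral_add i2 i3]
  simp_rw [← mul_assoc] at key ⊢
  linarith

theorem RealWeakDeriv.sub_const_mul {f g f' g' : E → ℝ} {w : E} (h : RealWeakDeriv f g w)
    (h' : RealWeakDeriv f' g' w) (t : ℝ) :
    RealWeakDeriv (fun x => f x - t * f' x) (fun x => g x - t * g' x) w := by
  have l1 : LocallyIntegrable (fun x => t * f' x) volume := h'.1.smul t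
  have l2 : LocallyIntegrable (fun x => t * g' x) volume := h'.2.1.smul t
  refine ⟨h.1.sub l1, h.2.1.sub l2, fun φ h1 h2 => ?_⟩
  have hcφ : Continuous fun x => fderiv ℝ φ x w :=
    (h1.continuous_fderiv (by simp)).clm_apply continuous_const
  have i1 := integrable_mul_of_hasCompactSupport hcφ (h2.fderiv_apply ℝ w) h.1
  have i2 := integrable_mul_of_hasCompactSupport h1.continuous h2 h.2.1
  have i3 := integrable_mul_of_hasCompactSupport hcφ (h2.fderiv_apply ℝ w) l1
  have i4 := integrable_mul_of_hasCompactSupport h1.continuous h2 l2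
  simp only [smul_eq_mul] at i1 i2 i3 i4
  simp_rw [mul_sub]
  rw [integral_sub i1 i3, integral_sub i2 i4, h.2.2 φ h1 h2]
  have e := h'.2.2 φ h1 h2
  have e1 : ∫ x, fderiv ℝ φ x w * (t * f' x) = t * ∫ x, fderiv ℝ φ x w * f' x := by
    rw [← integral_const_mul]; congr 1; ext x; ring
  have e2 : ∫ x, φ x * (t * g' x) = t * ∫ x, φ x * g' x := by
    rw [← integral_const_mul]; congr 1; ext x; ring
  rw [e1, e2, e]
  ring

theorem RealWeakDeriv.const_mul {f g : E → ℝ} {w : E} (h : RealWeakDeriv f g w) (t : ℝ) :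
    RealWeakDeriv (fun x => t * f x) (fun x => t * g x) w := by
  refine ⟨h.1.smul t, h.2.1.smul t, fun φ h1 h2 => ?_⟩
  simp_rw [mul_left_comm _ t]
  rw [integral_const_mul, integral_const_mul, h.2.2 φ h1 h2, mul_neg]

/-! ### The kinetic energy of real functions -/

variable {ι : Type*} [Fintype ι]

/-- The real part of any competing complex gradient coincides with `D` almost everywhere, by
uniqueness, and a real part is at most the modulus. -/
theorem kineticEnergy_eq {e : ι → E} {f : E → ℝ} {D : ι → E → ℝ}
    (h : ∀ k, RealWeakDeriv f (D k) (e k)) :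
    kineticEnergy e (fun x => (f x : ℂ)) = ∫⁻ x, ∑ k, ‖D k x‖ₑ ^ 2 := by
  apply le_antisymm
  · refine (iInf₂_le (fun k x => (D k x : ℂ)) fun k => (h k).hasWeakDeriv).trans ?_
    simp [enorm_complex_ofReal]
  · refine le_iInf₂ fun D' h' => lintegral_mono_ae ?_
    have : ∀ᵐ x, ∀ k, D k x = (D' k x).re :=
      ae_all_iff.2 fun k => (h k).unique (HasWeakDeriv.re (h' k))
    filter_upwards [this] with x hx
    refine Finset.sum_le_sum fun k _ => ?_
    gcongr
    rw [hx k, ← ofReal_norm, ← ofReal_norm]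
    exact ENNReal.ofReal_le_ofReal (Complex.abs_re_le_norm _)

theorem exists_realWeakDeriv {e : ι → E} {f : E → ℝ}
    (h : kineticEnergy e (fun x => (f x : ℂ)) < ⊤) :
    ∃ D : ι → E → ℝ, ∀ k, RealWeakDeriv f (D k) (e k) := by
  obtain ⟨D, hD⟩ := iInf_lt_iff.1 h
  obtain ⟨hD, _⟩ := iInf_lt_iff.1 hD
  exact ⟨fun k x => (D k x).re, fun k => HasWeakDeriv.re (hD k)⟩

end RealWeak

/-! ### The Gross-Pitaevskii functional on real functions -/

theorem enorm_sq_eq_ofReal (r : ℝ) : ‖r‖ₑ ^ 2 = ENNReal.ofReal (r ^ 2) := by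
  rw [← ofReal_norm, ← ENNReal.ofReal_pow (norm_nonneg _), Real.norm_eq_abs, sq_abs]

theorem enorm_pow_four_eq_ofReal (r : ℝ) : ‖r‖ₑ ^ 4 = ENNReal.ofReal (r ^ 4) := by
  rw [← ofReal_norm, ← ENNReal.ofReal_pow (norm_nonneg _), Real.norm_eq_abs,
    Even.pow_abs (by decide)]

theorem integrable_of_lintegral_ofReal {α : Type*} [MeasurableSpace α] {μ : Measure α} {f : α → ℝ}
    (hf : AEStronglyMeasurable f μ) (h0 : ∀ x, 0 ≤ f x)
    (h : ∫⁻ x, ENNReal.ofReal (f x) ∂μ < ⊤) : Integrable f μ := by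
  refine ⟨hf, ?_⟩
  rw [hasFiniteIntegral_iff_ofReal (Eventually.of_forall h0)]
  exact h

theorem integrable_mul_of_sq {α : Type*} [MeasurableSpace α] {μ : Measure α} {f g : α → ℝ}
    (hf : AEStronglyMeasurable f μ) (hg : AEStronglyMeasurable g μ)
    (hf2 : Integrable (fun x => f x ^ 2) μ) (hg2 : Integrable (fun x => g x ^ 2) μ) :
    Integrable (fun x => f x * g x) μ :=
  ((memLp_two_iff_integrable_sq hf).2 hf2).integrable_mul ((memLp_two_iff_integrable_sq hg).2 hg2)

/-- `D` is the weak gradient of the real function `Φ`, and all the terms of the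
Gross-Pitaevskii functional are finite. -/
structure FormDomain (V : E3 → ℝ) (Φ : E3 → ℝ) (D : Fin 3 → E3 → ℝ) : Prop where
  weak : ∀ k, RealWeakDeriv Φ (D k) (dir k)
  intD : ∀ k, Integrable (fun x => D k x ^ 2)
  intV : Integrable (fun x => V x * Φ x ^ 2)
  int2 : Integrable (fun x => Φ x ^ 2)
  int4 : Integrable (fun x => Φ x ^ 4)

/-- `∫ (|∇Φ|² + V Φ²)`. -/
noncomputable def quadEnergy (V : E3 → ℝ) (Φ : E3 → ℝ) (D : Fin 3 → E3 → ℝ) : ℝ :=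
  (∫ x, ∑ k, D k x ^ 2) + ∫ x, V x * Φ x ^ 2

section FormDomain

variable {V : E3 → ℝ} {Φ η : E3 → ℝ} {D Dη : Fin 3 → E3 → ℝ}

theorem FormDomain.aesm (h : FormDomain V Φ D) : AEStronglyMeasurable Φ volume :=
  (h.weak 0).1.aestronglyMeasurable

theorem FormDomain.aesmD (h : FormDomain V Φ D) (k : Fin 3) : AEStronglyMeasurable (D k) volume :=
  (h.weak k).2.1.aestronglyMeasurable

theorem FormDomain.kineticEnergy_eq (h : FormDomain V Φ D) :
    kineticEnergy dir (fun x => (Φ x : ℂ)) = ENNReal.ofReal (∫ x, ∑ k, D k x ^ 2) := by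
  rw [BoseGas.kineticEnergy_eq h.weak, ofReal_integral_eq_lintegral_ofReal
    (integrable_finsetSum _ fun k _ => h.intD k)
    (Eventually.of_forall fun x => Finset.sum_nonneg fun k _ => sq_nonneg _)]
  congr 1
  ext x
  rw [ENNReal.ofReal_sum_of_nonneg fun k _ => sq_nonneg _]
  simp_rw [enorm_sq_eq_ofReal]

theorem FormDomain.trapEnergy_eq (hV : IsTrap V) (h : FormDomain V Φ D) :
    trapEnergy V (fun x => (Φ x : ℂ)) = ENNReal.ofReal (∫ x, V x * Φ x ^ 2) := by
  rw [trapEnergy, ofReal_integral_eq_lintegral_ofReal h.intV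
    (Eventually.of_forall fun x => mul_nonneg (hV.nonneg x) (sq_nonneg _))]
  congr 1
  ext x
  rw [enorm_complex_ofReal, enorm_sq_eq_ofReal, ENNReal.ofReal_mul (hV.nonneg x)]

theorem quadEnergy_nonneg (hV : IsTrap V) : 0 ≤ quadEnergy V Φ D :=
  add_nonneg (integral_nonneg fun _ => Finset.sum_nonneg fun _ _ => sq_nonneg _)
    (integral_nonneg fun x => mul_nonneg (hV.nonneg x) (sq_nonneg _))

theorem FormDomain.kinetic_add_trap (hV : IsTrap V) (h : FormDomain V Φ D) :
    kineticEnergy dir (fun x => (Φ x : ℂ)) + trapEnergy V (fun x => (Φ x : ℂ))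
      = ENNReal.ofReal (quadEnergy V Φ D) := by
  rw [h.kineticEnergy_eq, h.trapEnergy_eq hV, quadEnergy, ENNReal.ofReal_add
    (integral_nonneg fun _ => Finset.sum_nonneg fun _ _ => sq_nonneg _)
    (integral_nonneg fun x => mul_nonneg (hV.nonneg x) (sq_nonneg _))]

theorem FormDomain.gpFunctional_eq (hV : IsTrap V) {a : ℝ} (ha : 0 ≤ a) (h : FormDomain V Φ D) :
    gpFunctional V a (fun x => (Φ x : ℂ))
      = ENNReal.ofReal (quadEnergy V Φ D + 4 * Real.pi * a * ∫ x, Φ x ^ 4) := by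
  have h4 : 0 ≤ ∫ x, Φ x ^ 4 := integral_nonneg fun x => by positivity
  rw [gpFunctional, h.kinetic_add_trap hV, ENNReal.ofReal_add (quadEnergy_nonneg hV)
    (by positivity), ENNReal.ofReal_mul (p := 4 * Real.pi * a) (by positivity),
    ofReal_integral_eq_lintegral_ofReal h.int4 (Eventually.of_forall fun x => by positivity)]
  simp_rw [enorm_complex_ofReal, enorm_pow_four_eq_ofReal]

theorem FormDomain.inGPDomain (hV : IsTrap V) (h : FormDomain V Φ D) {N : ℕ}
    (hN : ∫ x, Φ x ^ 2 = N) : InGPDomain V N (fun x => (Φ x : ℂ)) where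
  kinetic := by rw [h.kineticEnergy_eq]; exact ENNReal.ofReal_lt_top
  trap := by rw [h.trapEnergy_eq hV]; exact ENNReal.ofReal_lt_top
  memL4 := by
    have : MemLp Φ 4 volume := by
      rw [← integrable_norm_rpow_iff h.aesm (by norm_num) (by norm_num)]
      refine h.int4.congr (Eventually.of_forall fun x => ?_)
      norm_num
      rw [Even.pow_abs (by decide)]
    exact this.ofReal
  memL2 := ((memLp_two_iff_integrable_sq h.aesm).2 h.int2).ofReal
  normalized := by
    simp_rw [enorm_complex_ofReal, enorm_sq_eq_ofReal]
    rw [← ofReal_integral_eq_lintegral_ofReal h.int2 (Eventually.of_forall fun x => sq_nonneg _),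
      hN, ENNReal.ofReal_natCast]

theorem FormDomain.const_mul (h : FormDomain V Φ D) (t : ℝ) :
    FormDomain V (fun x => t * Φ x) (fun k x => t * D k x) where
  weak k := (h.weak k).const_mul t
  intD k := by simpa only [mul_pow] using (h.intD k).const_mul (t ^ 2)
  intV := by
    refine (h.intV.const_mul (t ^ 2)).congr (Eventually.of_forall fun x => ?_)
    ring
  int2 := by simpa only [mul_pow] using h.int2.const_mul (t ^ 2)
  int4 := by simpa only [mul_pow] using h.int4.const_mul (t ^ 4)

theorem quadEnergy_const_mul (t : ℝ) :
    quadEnergy V (fun x => t * Φ x) (fun k x => t * D k x) = t ^ 2 * quadEnergy V Φ D := by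
  simp only [quadEnergy, mul_pow, ← Finset.mul_sum]
  simp_rw [mul_left_comm (V _)]
  rw [integral_const_mul, integral_const_mul, mul_add]

theorem FormDomain.integrable_potential (hV : IsTrap V) (h : FormDomain V Φ D)
    (h' : FormDomain V η Dη) : Integrable (fun x => V x * (Φ x * η x)) := by
  refine (h.intV.add h'.intV).mono'
    (hV.measurable.aestronglyMeasurable.mul (h.aesm.mul h'.aesm)) (Eventually.of_forall fun x => ?_)
  simp only [Pi.add_apply]
  rw [norm_mul, Real.norm_eq_abs, abs_of_nonneg (hV.nonneg x), ← mul_add, Real.norm_eq_abs]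
  refine mul_le_mul_of_nonneg_left ?_ (hV.nonneg x)
  rw [abs_le]
  constructor <;> nlinarith [sq_nonneg (Φ x + η x), sq_nonneg (Φ x - η x)]

theorem FormDomain.integrable_quartic (h : FormDomain V Φ D) (h' : FormDomain V η Dη)
    {i j : ℕ} (hij : i + j = 4) : Integrable (fun x => Φ x ^ i * η x ^ j) := by
  refine (h.int4.add h'.int4).mono'
    ((h.aesm.pow i).mul (h'.aesm.pow j)) (Eventually.of_forall fun x => ?_)
  simp only [Pi.add_apply]
  rw [norm_mul, norm_pow, norm_pow, Real.norm_eq_abs, Real.norm_eq_abs]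
  have e1 : Φ x ^ 4 = |Φ x| ^ 4 := (Even.pow_abs (by decide) _).symm
  have e2 : η x ^ 4 = |η x| ^ 4 := (Even.pow_abs (by decide) _).symm
  rw [e1, e2]
  have hp := abs_nonneg (Φ x)
  have hq := abs_nonneg (η x)
  rcases le_total |Φ x| |η x| with hle | hle
  · calc |Φ x| ^ i * |η x| ^ j ≤ |η x| ^ i * |η x| ^ j := by gcongr
      _ = |η x| ^ 4 := by rw [← pow_add, hij]
      _ ≤ _ := by linarith [pow_nonneg hp 4]
  · calc |Φ x| ^ i * |η x| ^ j ≤ |Φ x| ^ i * |Φ x| ^ j := by gcongr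
      _ = |Φ x| ^ 4 := by rw [← pow_add, hij]
      _ ≤ _ := by linarith [pow_nonneg hq 4]

theorem FormDomain.integrable_grad (h : FormDomain V Φ D) (h' : FormDomain V η Dη) (k : Fin 3) :
    Integrable (fun x => D k x * Dη k x) :=
  integrable_mul_of_sq (h.aesmD k) (h'.aesmD k) (h.intD k) (h'.intD k)

theorem FormDomain.integrable_mul (h : FormDomain V Φ D) (h' : FormDomain V η Dη) :
    Integrable (fun x => Φ x * η x) :=
  integrable_mul_of_sq h.aesm h'.aesm h.int2 h'.int2

theorem FormDomain.sub_const_mul (hV : IsTrap V) (h : FormDomain V Φ D) (h' : FormDomain V η Dη)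
    (t : ℝ) : FormDomain V (fun x => Φ x - t * η x) (fun k x => D k x - t * Dη k x) where
  weak k := (h.weak k).sub_const_mul (h'.weak k) t
  intD k := by
    refine (((h.intD k).sub ((h.integrable_grad h' k).const_mul (2 * t))).add
      ((h'.intD k).const_mul (t ^ 2))).congr (Eventually.of_forall fun x => ?_)
    simp only [Pi.add_apply, Pi.sub_apply]; ring
  intV := by
    refine ((h.intV.sub ((h.integrable_potential hV h').const_mul (2 * t))).add
      (h'.intV.const_mul (t ^ 2))).congr (Eventually.of_forall fun x => ?_)
    simp only [Pi.add_apply, Pi.sub_apply]; ring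
  int2 := by
    refine ((h.int2.sub ((h.integrable_mul h').const_mul (2 * t))).add
      (h'.int2.const_mul (t ^ 2))).congr (Eventually.of_forall fun x => ?_)
    simp only [Pi.add_apply, Pi.sub_apply]; ring
  int4 := by
    refine ((((h.int4.sub ((h.integrable_quartic h' (i := 3) (j := 1) rfl).const_mul (4 * t))).add
      ((h.integrable_quartic h' (i := 2) (j := 2) rfl).const_mul (6 * t ^ 2))).sub
      ((h.integrable_quartic h' (i := 1) (j := 3) rfl).const_mul (4 * t ^ 3))).add
      (h'.int4.const_mul (t ^ 4))).congr (Eventually.of_forall fun x => ?_)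
    simp only [Pi.add_apply, Pi.sub_apply]; ring

theorem integral_sub_two_mul_add {α : Type*} [MeasurableSpace α] {μ : Measure α} {f g k l : α → ℝ}
    {t : ℝ} (hf : Integrable f μ) (hg : Integrable g μ) (hk : Integrable k μ)
    (hl : ∀ x, l x = f x - 2 * t * g x + t ^ 2 * k x) :
    ∫ x, l x ∂μ = (∫ x, f x ∂μ) - 2 * t * (∫ x, g x ∂μ) + t ^ 2 * ∫ x, k x ∂μ := by
  simp_rw [hl]
  have i2 := hg.const_mul (2 * t)
  have i3 := hk.const_mul (t ^ 2)
  have i1 : Integrable (fun x => f x - 2 * t * g x) μ := hf.sub i2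
  rw [integral_add i1 i3, integral_sub hf i2, integral_const_mul, integral_const_mul]

/-- The Euler-Lagrange form `∫ (∇Φ·∇η + V Φ η)`. -/
noncomputable def quadForm (V : E3 → ℝ) (Φ η : E3 → ℝ) (D Dη : Fin 3 → E3 → ℝ) : ℝ :=
  (∫ x, ∑ k, D k x * Dη k x) + ∫ x, V x * (Φ x * η x)

theorem FormDomain.quadEnergy_sub (hV : IsTrap V) (h : FormDomain V Φ D) (h' : FormDomain V η Dη)
    (t : ℝ) : quadEnergy V (fun x => Φ x - t * η x) (fun k x => D k x - t * Dη k x)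
      = quadEnergy V Φ D - 2 * t * quadForm V Φ η D Dη + t ^ 2 * quadEnergy V η Dη := by
  simp only [quadEnergy, quadForm]
  rw [integral_sub_two_mul_add (t := t) (integrable_finsetSum _ fun k _ => h.intD k)
      (integrable_finsetSum _ fun k _ => h.integrable_grad h' k)
      (integrable_finsetSum _ fun k _ => h'.intD k)
      (l := fun x => ∑ k, (D k x - t * Dη k x) ^ 2) (fun x => by
        rw [Finset.mul_sum, Finset.mul_sum, ← Finset.sum_sub_distrib, ← Finset.sum_add_distrib]
        exact Finset.sum_congr rfl fun k _ => by ring),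
    integral_sub_two_mul_add (t := t) h.intV (h.integrable_potential hV h') h'.intV
      (l := fun x => V x * (Φ x - t * η x) ^ 2) (fun x => by ring)]
  ring

/-- The coefficient of `t²` may itself depend on `t`, so the same lemma serves the quadratic norm
and energy and the quartic interaction term. -/
theorem hasDerivAt_quadratic (c₀ c₁ : ℝ) {r : ℝ → ℝ} (hr : Differentiable ℝ r) :
    HasDerivAt (fun t => c₀ + c₁ * t + t ^ 2 * r t) c₁ 0 := by
  have h1 := ((hasDerivAt_id (0 : ℝ)).const_mul c₁).const_add c₀
  have h2 := (hasDerivAt_pow 2 (0 : ℝ)).mul (hr 0).hasDerivAt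
  have h3 := h1.add h2
  simp at h3
  exact h3

end FormDomain

/-- A pointwise nice version of the minimizer of the Gross-Pitaevskii functional. -/
structure GPData (V : E3 → ℝ) (N : ℕ) (a : ℝ) (Φ : E3 → ℝ) (D : Fin 3 → E3 → ℝ) : Prop
    extends FormDomain V Φ D where
  measurable : Measurable Φ
  measurableD : ∀ k, Measurable (D k)
  nonneg : ∀ x, 0 ≤ Φ x
  normalized : ∫ x, Φ x ^ 2 = N
  minimal : ∀ (Ψ : E3 → ℝ) (DΨ : Fin 3 → E3 → ℝ), FormDomain V Ψ DΨ → 0 < ∫ x, Ψ x ^ 2 →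
    (quadEnergy V Φ D + 4 * Real.pi * a * ∫ x, Φ x ^ 4) * (∫ x, Ψ x ^ 2) ^ 2
      ≤ N * (∫ x, Ψ x ^ 2) * quadEnergy V Ψ DΨ + N ^ 2 * (4 * Real.pi * a * ∫ x, Ψ x ^ 4)

/-- The chemical potential, times the number of particles. -/
noncomputable def totalMu (V : E3 → ℝ) (a : ℝ) (Φ : E3 → ℝ) (D : Fin 3 → E3 → ℝ) : ℝ :=
  quadEnergy V Φ D + 8 * Real.pi * a * ∫ x, Φ x ^ 4

/-- First variation along `Φ - t η`. Because `GPData.minimal` compares with functions of arbitrary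
positive norm, no constraint has to be maintained along the path: the difference `p` of the two
sides is a polynomial in `t`, vanishes at `0` and is nonnegative as long as the norm `n t` is
positive. The equation is `p'(0) = 0`. -/
theorem GPData.euler_lagrange {V : E3 → ℝ} {N : ℕ} {a : ℝ} {Φ η : E3 → ℝ}
    {D Dη : Fin 3 → E3 → ℝ} (hV : IsTrap V) (hN : 0 < N) (h : GPData V N a Φ D)
    (h' : FormDomain V η Dη) :
    N * (quadForm V Φ η D Dη + 8 * Real.pi * a * ∫ x, Φ x ^ 3 * η x)
      = totalMu V a Φ D * ∫ x, Φ x * η x := by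
  set q := quadEnergy V Φ D with hq
  set B := quadForm V Φ η D Dη
  set r := ∫ x, Φ x ^ 4
  set S := ∫ x, Φ x ^ 3 * η x
  set m := ∫ x, Φ x * η x
  have hf := h.toFormDomain
  let n : ℝ → ℝ := fun t => N + (-2 * m) * t + t ^ 2 * (∫ x, η x ^ 2)
  let Q : ℝ → ℝ := fun t => q + (-2 * B) * t + t ^ 2 * (quadEnergy V η Dη)
  let R : ℝ → ℝ := fun t => r + (-4 * S) * t + t ^ 2 * (6 * (∫ x, Φ x ^ 2 * η x ^ 2)
    - 4 * t * (∫ x, Φ x ^ 1 * η x ^ 3) + t ^ 2 * ∫ x, η x ^ 4)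
  have en : ∀ t, ∫ x, (Φ x - t * η x) ^ 2 = n t := fun t => by
    rw [integral_sub_two_mul_add (t := t) hf.int2 (hf.integrable_mul h') h'.int2
      (fun x => by ring), h.normalized]
    simp only [n]; ring
  have eQ : ∀ t, quadEnergy V (fun x => Φ x - t * η x) (fun k x => D k x - t * Dη k x) = Q t :=
    fun t => by rw [hf.quadEnergy_sub hV h' t]; simp only [Q]; ring
  have eR : ∀ t, ∫ x, (Φ x - t * η x) ^ 4 = R t := fun t => by
    have j1 := (hf.integrable_quartic h' (i := 3) (j := 1) rfl).const_mul (4 * t)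
    have j2 := (hf.integrable_quartic h' (i := 2) (j := 2) rfl).const_mul (6 * t ^ 2)
    have j3 := (hf.integrable_quartic h' (i := 1) (j := 3) rfl).const_mul (4 * t ^ 3)
    have j4 := h'.int4.const_mul (t ^ 4)
    have : ∀ x, (Φ x - t * η x) ^ 4 = Φ x ^ 4 - 4 * t * (Φ x ^ 3 * η x ^ 1)
        + 6 * t ^ 2 * (Φ x ^ 2 * η x ^ 2) - 4 * t ^ 3 * (Φ x ^ 1 * η x ^ 3) + t ^ 4 * η x ^ 4 :=
      fun x => by ring
    simp_rw [this]
    have k1 : Integrable (fun x => Φ x ^ 4 - 4 * t * (Φ x ^ 3 * η x ^ 1)) := hf.int4.sub j1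
    have k2 : Integrable (fun x => Φ x ^ 4 - 4 * t * (Φ x ^ 3 * η x ^ 1)
      + 6 * t ^ 2 * (Φ x ^ 2 * η x ^ 2)) := k1.add j2
    have k3 : Integrable (fun x => Φ x ^ 4 - 4 * t * (Φ x ^ 3 * η x ^ 1)
      + 6 * t ^ 2 * (Φ x ^ 2 * η x ^ 2) - 4 * t ^ 3 * (Φ x ^ 1 * η x ^ 3)) := k2.sub j3
    rw [integral_add k3 j4, integral_sub k2 j3, integral_add k1 j2, integral_sub hf.int4 j1]
    simp only [integral_const_mul, R, r, S]
    simp only [pow_one]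
    ring
  let p : ℝ → ℝ := fun t =>
    (N * n t * Q t + N ^ 2 * (4 * Real.pi * a * R t)) - (q + 4 * Real.pi * a * r) * n t ^ 2
  have hn : HasDerivAt n (-2 * m) 0 := hasDerivAt_quadratic _ _ (by fun_prop)
  have hQ : HasDerivAt Q (-2 * B) 0 := hasDerivAt_quadratic _ _ (by fun_prop)
  have hR : HasDerivAt R (-4 * S) 0 := hasDerivAt_quadratic _ _ (by fun_prop)
  have n0 : n 0 = N := by simp [n]
  have Q0 : Q 0 = q := by simp [Q]
  have R0 : R 0 = r := by simp [R]
  have hN' : (0 : ℝ) < N := by exact_mod_cast hN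
  have hp : HasDerivAt p ((N * (-2 * m) * Q 0 + N * n 0 * (-2 * B)
      + N ^ 2 * (4 * Real.pi * a * (-4 * S)))
      - (q + 4 * Real.pi * a * r) * (2 * n 0 * (-2 * m))) 0 := by
    have h1 := (((hn.const_mul (N : ℝ)).mul hQ).add
      ((hR.const_mul (4 * Real.pi * a)).const_mul ((N : ℝ) ^ 2))).sub
      ((hn.pow 2).const_mul (q + 4 * Real.pi * a * r))
    refine h1.congr_deriv ?_
    push_cast
    ring
  have hmin : IsLocalMin p 0 := by
    have hev : ∀ᶠ t in 𝓝 (0 : ℝ), 0 < n t :=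
      hn.continuousAt.eventually (lt_mem_nhds (by rw [n0]; exact hN'))
    filter_upwards [hev] with t ht
    have p0 : p 0 = 0 := by simp only [p, n0, Q0, R0]; ring
    rw [p0]
    have := h.minimal _ _ (hf.sub_const_mul hV h' t) (by rw [en t]; exact ht)
    rw [en t, eQ t, eR t] at this
    simp only [p]
    linarith
  have h0 := hmin.hasDerivAt_eq_zero hp
  rw [n0, Q0] at h0
  have h1 : (N : ℝ) * (N * (B + 8 * Real.pi * a * S)) = N * (totalMu V a Φ D * m) := by
    simp only [totalMu, ← hq]
    change _ = N * ((q + 8 * Real.pi * a * r) * m)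
    linear_combination (-1 / 2) * h0
  exact mul_left_cancel₀ hN'.ne' h1

/-- The later slicing arguments are made at every point of configuration space, so the minimizer and
its gradient are replaced by measurable versions, the minimizer by one that is nonnegative
everywhere. Minimality is rewritten in homogeneous form. -/
theorem exists_gpData {V : E3 → ℝ} {N : ℕ} {a : ℝ} {Φ : E3 → ℝ} (hV : IsTrap V) (hN : 0 < N)
    (ha : 0 ≤ a) (h : IsGPMinimizer V N a Φ) :
    ∃ (Φ' : E3 → ℝ) (D : Fin 3 → E3 → ℝ), GPData V N a Φ' D ∧ Φ' =ᵐ[volume] Φ ∧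
      linearEnergy V Φ = quadEnergy V Φ' D ∧
      gpEnergy V N a = ENNReal.ofReal (quadEnergy V Φ' D + 4 * Real.pi * a * ∫ x, Φ' x ^ 4) := by
  obtain ⟨D₀, hD₀⟩ := exists_realWeakDeriv h.mem.kinetic
  have mΦ : AEMeasurable Φ volume := (hD₀ 0).1.aestronglyMeasurable.aemeasurable
  have mD : ∀ k, AEMeasurable (D₀ k) volume := fun k =>
    (hD₀ k).2.1.aestronglyMeasurable.aemeasurable
  let Φ' : E3 → ℝ := fun x => max (mΦ.mk Φ x) 0
  let D : Fin 3 → E3 → ℝ := fun k => (mD k).mk (D₀ k)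
  have eΦ : Φ' =ᵐ[volume] Φ := by
    filter_upwards [mΦ.ae_eq_mk, h.pos] with x hx hp
    simp only [Φ', ← hx]
    exact max_eq_left hp.le
  have eΦ' : (fun x => (Φ' x : ℂ)) =ᵐ[volume] (fun x => (Φ x : ℂ)) := by
    filter_upwards [eΦ] with x hx
    rw [hx]
  have wk : ∀ k, RealWeakDeriv Φ (D k) (dir k) := fun k =>
    (hD₀ k).congr (ae_eq_refl _) (mD k).ae_eq_mk
  have wk' : ∀ k, RealWeakDeriv Φ' (D k) (dir k) := fun k =>
    (wk k).congr eΦ.symm (ae_eq_refl _)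
  have mΦ' : Measurable Φ' := mΦ.measurable_mk.max measurable_const
  have mD' : ∀ k, Measurable (D k) := fun k => (mD k).measurable_mk
  have kin := kineticEnergy_eq wk
  have trp : trapEnergy V (fun x => (Φ x : ℂ)) = trapEnergy V (fun x => (Φ' x : ℂ)) := by
    apply lintegral_congr_ae
    filter_upwards [eΦ] with x hx
    rw [hx]
  have fd : FormDomain V Φ' D := by
    refine ⟨wk', fun k => ?_, ?_, ?_, ?_⟩
    · refine integrable_of_lintegral_ofReal (by fun_prop) (fun x => sq_nonneg _) ?_
      refine lt_of_le_of_lt (lintegral_mono fun x => ?_) (kin ▸ h.mem.kinetic)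
      rw [← enorm_sq_eq_ofReal]
      exact Finset.single_le_sum (f := fun k => ‖D k x‖ₑ ^ 2) (fun _ _ => zero_le)
        (Finset.mem_univ k)
    · refine integrable_of_lintegral_ofReal (hV.measurable.mul (mΦ'.pow_const 2)).aestronglyMeasurable
        (fun x => mul_nonneg (hV.nonneg x) (sq_nonneg _)) ?_
      refine lt_of_le_of_lt (le_of_eq ?_) h.mem.trap
      rw [trp, trapEnergy]
      congr 1
      ext x
      rw [enorm_complex_ofReal, enorm_sq_eq_ofReal, ENNReal.ofReal_mul (hV.nonneg x)]
    · have := (memLp_congr_ae eΦ').2 h.mem.memL2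
      exact (memLp_two_iff_integrable_sq mΦ'.aestronglyMeasurable).1 (by simpa using this.re)
    · have h4 := (memLp_congr_ae eΦ').2 h.mem.memL4
      have h4' : MemLp Φ' 4 volume := by simpa using h4.re
      rw [← integrable_norm_rpow_iff mΦ'.aestronglyMeasurable (by norm_num) (by norm_num)] at h4'
      refine h4'.congr (Eventually.of_forall fun x => ?_)
      norm_num
      rw [Even.pow_abs (by decide)]
  have kin' : kineticEnergy dir (fun x => (Φ x : ℂ)) = kineticEnergy dir (fun x => (Φ' x : ℂ)) := by
    rw [kin, kineticEnergy_eq wk']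
  have gp : gpFunctional V a (fun x => (Φ x : ℂ)) = gpFunctional V a (fun x => (Φ' x : ℂ)) := by
    rw [gpFunctional, gpFunctional, kin', trp]
    congr 2
    apply lintegral_congr_ae
    filter_upwards [eΦ] with x hx
    rw [hx]
  have egp : gpEnergy V N a
      = ENNReal.ofReal (quadEnergy V Φ' D + 4 * Real.pi * a * ∫ x, Φ' x ^ 4) := by
    rw [← h.minimal, gp, fd.gpFunctional_eq hV ha]
  refine ⟨Φ', D, ⟨fd, mΦ', mD', fun x => le_max_right _ _, ?_, ?_⟩, eΦ, ?_, egp⟩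
  · have h1 := h.mem.normalized
    have h2 : ∫⁻ x, ‖(Φ x : ℂ)‖ₑ ^ 2 = ENNReal.ofReal (∫ x, Φ' x ^ 2) := by
      rw [ofReal_integral_eq_lintegral_ofReal fd.int2 (Eventually.of_forall fun x => sq_nonneg _)]
      apply lintegral_congr_ae
      filter_upwards [eΦ] with x hx
      rw [enorm_complex_ofReal, enorm_sq_eq_ofReal, hx]
    rw [h2] at h1
    have h3 := congrArg ENNReal.toReal h1
    rwa [ENNReal.toReal_ofReal (integral_nonneg fun x => sq_nonneg _), ENNReal.toReal_natCast] at h3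
  · intro Ψ DΨ hΨ hpos
    set n := ∫ x, Ψ x ^ 2
    -- Scaling by `l` gives `Ψ` the norm of the constraint; the quadratic energy picks up `l² = N/n`
    -- and the quartic one `l⁴`. Multiplication by `n²` clears the denominators.
    set l := Real.sqrt (N / n)
    have hl : l ^ 2 = N / n := Real.sq_sqrt (by positivity)
    have h1 : InGPDomain V N (fun x => ((l * Ψ x : ℝ) : ℂ)) := by
      refine (hΨ.const_mul l).inGPDomain hV ?_
      simp_rw [mul_pow]
      rw [integral_const_mul, hl]
      field_simp
      rfl
    have h2 : gpEnergy V N a ≤ gpFunctional V a (fun x => ((l * Ψ x : ℝ) : ℂ)) := iInf₂_le _ h1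
    have h4 : 0 ≤ ∫ x, Ψ x ^ 4 := integral_nonneg fun x => by positivity
    rw [egp, (hΨ.const_mul l).gpFunctional_eq hV ha, quadEnergy_const_mul,
      ENNReal.ofReal_le_ofReal_iff (by
        have := quadEnergy_nonneg hV (Φ := Ψ) (D := DΨ)
        have : 0 ≤ ∫ x, (l * Ψ x) ^ 4 := integral_nonneg fun x => by positivity
        positivity)] at h2
    simp_rw [mul_pow] at h2
    rw [integral_const_mul, show l ^ 4 = (l ^ 2) ^ 2 by ring, hl] at h2
    have h5 := mul_le_mul_of_nonneg_right h2 (sq_nonneg n)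
    refine h5.trans (le_of_eq ?_)
    field_simp
  · rw [linearEnergy, kin', trp, fd.kinetic_add_trap hV,
      ENNReal.toReal_ofReal (quadEnergy_nonneg hV)]

/-! ### The Euler-Lagrange equation on slices -/

theorem dir_norm (k : Fin 3) : ‖dir k‖ = 1 := by simp [dir]

theorem FormDomain.lipschitz_mul {V : E3 → ℝ} {Φ G : E3 → ℝ} {D : Fin 3 → E3 → ℝ} (hV : IsTrap V)
    (h : FormDomain V Φ D) {C : NNReal} (hG : LipschitzWith C G) (hB : ∀ x, |G x| ≤ 1) :
    FormDomain V (fun x => G x * Φ x)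
      (fun k x => G x * D k x + lineDeriv ℝ G x (dir k) * Φ x) where
  weak k := (h.weak k).lipschitz_mul hG hB
  intD k := by
    have hm : Measurable (fun x => lineDeriv ℝ G x (dir k)) := measurable_lineDeriv hG.continuous
    refine (((h.intD k).const_mul 2).add (h.int2.const_mul (2 * C ^ 2))).mono'
      (((hG.continuous.aestronglyMeasurable.mul (h.aesmD k)).add
        (hm.aestronglyMeasurable.mul h.aesm)).pow 2) (Eventually.of_forall fun x => ?_)
    simp only [Pi.add_apply]
    have h1 := abs_lineDeriv_le hG x (dir k)
    rw [dir_norm, mul_one] at h1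
    have h2 := sq_le_sq' (by linarith [abs_le.1 h1]) (abs_le.1 h1).2
    have h3 := sq_le_sq' (by linarith [abs_le.1 (hB x)]) (abs_le.1 (hB x)).2
    rw [Real.norm_eq_abs, abs_of_nonneg (sq_nonneg _)]
    have h4 := mul_le_mul_of_nonneg_right h2 (sq_nonneg (Φ x))
    have h5 := mul_le_mul_of_nonneg_right h3 (sq_nonneg (D k x))
    nlinarith [sq_nonneg (G x * D k x - lineDeriv ℝ G x (dir k) * Φ x)]
  intV := by
    refine h.intV.mono' (hV.measurable.aestronglyMeasurable.mul
      ((hG.continuous.aestronglyMeasurable.mul h.aesm).pow 2)) (Eventually.of_forall fun x => ?_)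
    have h3 := sq_le_sq' (by linarith [abs_le.1 (hB x)]) (abs_le.1 (hB x)).2
    rw [Real.norm_eq_abs, abs_of_nonneg (mul_nonneg (hV.nonneg x) (sq_nonneg _))]
    refine mul_le_mul_of_nonneg_left ?_ (hV.nonneg x)
    nlinarith [sq_nonneg (Φ x)]
  int2 := by
    refine h.int2.mono' ((hG.continuous.aestronglyMeasurable.mul h.aesm).pow 2)
      (Eventually.of_forall fun x => ?_)
    have h3 := sq_le_sq' (by linarith [abs_le.1 (hB x)]) (abs_le.1 (hB x)).2
    rw [Real.norm_eq_abs, abs_of_nonneg (sq_nonneg _)]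
    nlinarith [sq_nonneg (Φ x)]
  int4 := by
    refine h.int4.mono' ((hG.continuous.aestronglyMeasurable.mul h.aesm).pow 4)
      (Eventually.of_forall fun x => ?_)
    rw [norm_pow, norm_mul, mul_pow, show Φ x ^ 4 = ‖Φ x‖ ^ 4 by
      rw [Real.norm_eq_abs, Even.pow_abs (by decide)]]
    exact mul_le_of_le_one_left (by positivity) (pow_le_one₀ (norm_nonneg _) (hB x))

/-- The Euler-Lagrange equation tested with `G² Φ`, together with `∇Φ·∇(G²Φ) = |∇(GΦ)|² - |∇G|² Φ²`.
It is an identity, of which only one direction is used; all negative terms are moved across so that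
it can be read with values in `ℝ≥0∞`. -/
theorem GPData.slice_le {V : E3 → ℝ} {N : ℕ} {a : ℝ} {Φ G : E3 → ℝ}
    {D : Fin 3 → E3 → ℝ} (hV : IsTrap V) (hN : 0 < N) (ha : 0 ≤ a) (h : GPData V N a Φ D)
    {C : NNReal} (hG : LipschitzWith C G) (hB : ∀ x, |G x| ≤ 1) :
    ∫⁻ x, (∑ k, ENNReal.ofReal ((G x * D k x + lineDeriv ℝ G x (dir k) * Φ x) ^ 2)
        + ENNReal.ofReal (V x * (G x * Φ x) ^ 2)
        + ENNReal.ofReal (8 * Real.pi * a * Φ x ^ 2 * (G x * Φ x) ^ 2))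
      ≤ ∫⁻ x, (ENNReal.ofReal (totalMu V a Φ D / N * (G x * Φ x) ^ 2)
        + ENNReal.ofReal (∑ k, lineDeriv ℝ G x (dir k) ^ 2) * ENNReal.ofReal (Φ x ^ 2)) := by
  have f0 := h.toFormDomain
  have f1 := f0.lipschitz_mul hV hG hB
  have f2 := f1.lipschitz_mul hV hG hB
  have el := h.euler_lagrange hV hN f2
  have hμ : 0 ≤ totalMu V a Φ D := by
    have := quadEnergy_nonneg hV (Φ := Φ) (D := D)
    have : 0 ≤ ∫ x, Φ x ^ 4 := integral_nonneg fun x => by positivity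
    unfold totalMu
    positivity
  have hm : ∀ k, Measurable (fun x => lineDeriv ℝ G x (dir k)) := fun k =>
    measurable_lineDeriv hG.continuous
  have hGm : Measurable G := hG.continuous.measurable
  have hΦm := h.measurable
  have hDm := h.measurableD
  have hVm := hV.measurable
  have hgi : ∀ k, Integrable (fun x => (lineDeriv ℝ G x (dir k) * Φ x) ^ 2) := fun k => by
    refine (f0.int2.const_mul ((C : ℝ) ^ 2)).mono' (((hm k).mul hΦm).pow_const 2).aestronglyMeasurable
      (Eventually.of_forall fun x => ?_)
    have h1 := abs_lineDeriv_le hG x (dir k)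
    rw [dir_norm, mul_one] at h1
    have h2 := sq_le_sq' (by linarith [abs_le.1 h1]) (abs_le.1 h1).2
    rw [Real.norm_eq_abs, abs_of_nonneg (sq_nonneg _), mul_pow]
    exact mul_le_mul_of_nonneg_right h2 (sq_nonneg _)
  have hgs : Integrable (fun x => ∑ k, (lineDeriv ℝ G x (dir k) * Φ x) ^ 2) :=
    integrable_finsetSum _ fun k _ => hgi k
  have hds : Integrable (fun x => ∑ k, (G x * D k x + lineDeriv ℝ G x (dir k) * Φ x) ^ 2) :=
    integrable_finsetSum _ fun k _ => f1.intD k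
  have h4i : Integrable (fun x => Φ x ^ 2 * (G x * Φ x) ^ 2) :=
    f0.integrable_quartic f1 rfl
  have e1 : quadForm V Φ (fun x => G x * (G x * Φ x)) D
      (fun k x => G x * (G x * D k x + lineDeriv ℝ G x (dir k) * Φ x)
        + lineDeriv ℝ G x (dir k) * (G x * Φ x))
      = (∫ x, ∑ k, (G x * D k x + lineDeriv ℝ G x (dir k) * Φ x) ^ 2)
        - (∫ x, ∑ k, (lineDeriv ℝ G x (dir k) * Φ x) ^ 2) + ∫ x, V x * (G x * Φ x) ^ 2 := by
    rw [quadForm, ← integral_sub hds hgs]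
    congr 1
    · congr 1
      ext x
      rw [← Finset.sum_sub_distrib]
      exact Finset.sum_congr rfl fun k _ => by ring
    · congr 1
      ext x
      ring
  -- The quartic term of the equation becomes the density `Φ²` integrated against the square of `G
  -- Φ`.
  have e2 : ∫ x, Φ x ^ 3 * (G x * (G x * Φ x)) = ∫ x, Φ x ^ 2 * (G x * Φ x) ^ 2 := by
    congr 1; ext x; ring
  have e3 : ∫ x, Φ x * (G x * (G x * Φ x)) = ∫ x, (G x * Φ x) ^ 2 := by
    congr 1; ext x; ring
  rw [e1, e2, e3] at el
  have hN' : (0 : ℝ) < N := by exact_mod_cast hN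
  have l1 : ∫⁻ x, ENNReal.ofReal (V x * (G x * Φ x) ^ 2)
      = ENNReal.ofReal (∫ x, V x * (G x * Φ x) ^ 2) :=
    (ofReal_integral_eq_lintegral_ofReal f1.intV
      (Eventually.of_forall fun x => mul_nonneg (hV.nonneg x) (sq_nonneg _))).symm
  have l2 : ∫⁻ x, ∑ k, ENNReal.ofReal ((G x * D k x + lineDeriv ℝ G x (dir k) * Φ x) ^ 2)
      = ENNReal.ofReal (∫ x, ∑ k, (G x * D k x + lineDeriv ℝ G x (dir k) * Φ x) ^ 2) := by
    rw [ofReal_integral_eq_lintegral_ofReal hds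
      (Eventually.of_forall fun x => Finset.sum_nonneg fun _ _ => sq_nonneg _)]
    congr 1
    ext x
    rw [ENNReal.ofReal_sum_of_nonneg fun _ _ => sq_nonneg _]
  have l3 : ∫⁻ x, ENNReal.ofReal (8 * Real.pi * a * Φ x ^ 2 * (G x * Φ x) ^ 2)
      = ENNReal.ofReal (8 * Real.pi * a * ∫ x, Φ x ^ 2 * (G x * Φ x) ^ 2) := by
    rw [← integral_const_mul, ofReal_integral_eq_lintegral_ofReal (h4i.const_mul _)
      (Eventually.of_forall fun x => by positivity)]
    congr 1
    ext x
    rw [mul_assoc (8 * Real.pi * a)]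
  have l4 : ∫⁻ x, ENNReal.ofReal (totalMu V a Φ D / N * (G x * Φ x) ^ 2)
      = ENNReal.ofReal (totalMu V a Φ D / N * ∫ x, (G x * Φ x) ^ 2) := by
    rw [← integral_const_mul, ofReal_integral_eq_lintegral_ofReal (f1.int2.const_mul _)
      (Eventually.of_forall fun x => by positivity)]
  have l5 : ∫⁻ x, ENNReal.ofReal (∑ k, lineDeriv ℝ G x (dir k) ^ 2) * ENNReal.ofReal (Φ x ^ 2)
      = ENNReal.ofReal (∫ x, ∑ k, (lineDeriv ℝ G x (dir k) * Φ x) ^ 2) := by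
    rw [ofReal_integral_eq_lintegral_ofReal hgs
      (Eventually.of_forall fun x => Finset.sum_nonneg fun _ _ => sq_nonneg _)]
    congr 1
    ext x
    rw [← ENNReal.ofReal_mul (Finset.sum_nonneg fun _ _ => sq_nonneg _), Finset.sum_mul]
    simp_rw [mul_pow]
  rw [lintegral_add_right _ (by fun_prop), lintegral_add_right _ (by fun_prop),
    lintegral_add_left (by fun_prop), l1, l2, l3, l4, l5]
  have p1 : 0 ≤ ∫ x, V x * (G x * Φ x) ^ 2 :=
    integral_nonneg fun x => mul_nonneg (hV.nonneg x) (sq_nonneg _)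
  have p2 : 0 ≤ ∫ x, ∑ k, (G x * D k x + lineDeriv ℝ G x (dir k) * Φ x) ^ 2 :=
    integral_nonneg fun x => Finset.sum_nonneg fun _ _ => sq_nonneg _
  have p3 : 0 ≤ ∫ x, Φ x ^ 2 * (G x * Φ x) ^ 2 := integral_nonneg fun x => by positivity
  have p4 : 0 ≤ ∫ x, (G x * Φ x) ^ 2 := integral_nonneg fun x => by positivity
  have p5 : 0 ≤ ∫ x, ∑ k, (lineDeriv ℝ G x (dir k) * Φ x) ^ 2 :=
    integral_nonneg fun x => Finset.sum_nonneg fun _ _ => sq_nonneg _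
  rw [← ENNReal.ofReal_add p2 p1, ← ENNReal.ofReal_add (by positivity) (by positivity),
    ← ENNReal.ofReal_add (by positivity) p5]
  apply ENNReal.ofReal_le_ofReal
  have : totalMu V a Φ D / N * ∫ x, (G x * Φ x) ^ 2 =
      (totalMu V a Φ D * ∫ x, (G x * Φ x) ^ 2) / N := by ring
  rw [this, ← el, mul_div_cancel_left₀ _ hN'.ne']
  linarith

/-! ### Product functions on configuration space -/

/-- The tensor product of one-particle functions. -/
def tensor {N : ℕ} (f : Fin N → E3 → ℝ) (x : Config N) : ℝ := ∏ i, f i (x i)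

theorem measurable_tensor {N : ℕ} {f : Fin N → E3 → ℝ} (hf : ∀ i, Measurable (f i)) :
    Measurable (tensor f) :=
  Finset.measurable_prod _ fun i _ => (hf i).comp (measurable_pi_apply i)

theorem integrable_tensor_sq {N : ℕ} {f : Fin N → E3 → ℝ}
    (h2 : ∀ i, Integrable (fun x => f i x ^ 2)) : Integrable (fun x => tensor f x ^ 2) := by
  have := Integrable.fintype_prod (μ := fun _ : Fin N => (volume : Measure E3)) h2
  refine this.congr (Eventually.of_forall fun x => ?_)
  simp only [tensor, Finset.prod_pow]

theorem locallyIntegrable_tensor {N : ℕ} {f : Fin N → E3 → ℝ} (hf : ∀ i, Measurable (f i))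
    (h2 : ∀ i, Integrable (fun x => f i x ^ 2)) : LocallyIntegrable (tensor f) volume :=
  ((memLp_two_iff_integrable_sq (measurable_tensor hf).aestronglyMeasurable).2
    (integrable_tensor_sq h2)).locallyIntegrable (by norm_num)

theorem tensor_update {N : ℕ} (f : Fin N → E3 → ℝ) (k : Fin N) (g : E3 → ℝ) (x : Config N)
    (y : E3) : tensor (Function.update f k g) (Function.update x k y)
      = g y * ∏ i ∈ Finset.univ.erase k, f i (x i) := by
  rw [tensor, ← Finset.mul_prod_erase _ _ (Finset.mem_univ k)]
  simp only [Function.update_self]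
  congr 1
  refine Finset.prod_congr rfl fun i hi => ?_
  have := Finset.ne_of_mem_erase hi
  simp [this]

theorem tensor_update_right {N : ℕ} (f : Fin N → E3 → ℝ) (k : Fin N) (x : Config N)
    (y : E3) : tensor f (Function.update x k y)
      = f k y * ∏ i ∈ Finset.univ.erase k, f i (x i) := by
  have := tensor_update f k (f k) x y
  rwa [Function.update_eq_self] at this

theorem integral_eq_slices {n : ℕ} (k : Fin (n + 1)) {H : Config (n + 1) → ℝ}
    (hH : Integrable H) :
    ∫ x, H x = ∫ z : Config n, ∫ y : E3, H (Function.update (k.insertNth 0 z) k y) := by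
  have e := volume_preserving_piFinSuccAbove (fun _ : Fin (n + 1) => E3) k
  have h1 := e.symm.integral_comp (MeasurableEquiv.measurableEmbedding _) H
  have hi : Integrable (fun p : E3 × Config n => H (Function.update (k.insertNth 0 p.2) k p.1)) := by
    have := e.symm.integrable_comp_of_integrable hH
    refine this.congr (Eventually.of_forall fun p => ?_)
    simp only [Fin.update_insertNth]
    rfl
  rw [← integral_prod_symm _ hi, ← h1]
  congr 1
  ext p
  rw [Fin.update_insertNth]
  rfl

/-- Fubini in the variable of particle `k`: on each slice the remaining factors are a constant and
the test function restricts to a test function on `E3`, so the one-particle identity applies. -/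
theorem realWeakDeriv_tensor {N : ℕ} {Φ g : E3 → ℝ} {w : E3} (h : RealWeakDeriv Φ g w)
    (mΦ : Measurable Φ) (mg : Measurable g) (iΦ : Integrable (fun x => Φ x ^ 2))
    (ig : Integrable (fun x => g x ^ 2)) (k : Fin N) :
    RealWeakDeriv (tensor fun _ : Fin N => Φ) (tensor (Function.update (fun _ => Φ) k g))
      (Pi.single k w : Config N) := by
  obtain _ | n := N
  · exact k.elim0
  have mu : ∀ i, Measurable (Function.update (fun _ : Fin (n + 1) => Φ) k g i) := fun i => by
    by_cases hi : i = k
    · subst hi; simpa using mg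
    · simpa [hi] using mΦ
  have iu : ∀ i, Integrable (fun x => Function.update (fun _ : Fin (n + 1) => Φ) k g i x ^ 2) :=
    fun i => by
    by_cases hi : i = k
    · subst hi; simpa using ig
    · simpa [hi] using iΦ
  have l1 := locallyIntegrable_tensor (fun _ : Fin (n + 1) => mΦ) (fun _ => iΦ)
  have l2 := locallyIntegrable_tensor mu iu
  refine ⟨l1, l2, fun φ h1 h2 => ?_⟩
  have hcφ : Continuous fun x => fderiv ℝ φ x (Pi.single k w) :=
    (h1.continuous_fderiv (by simp)).clm_apply continuous_const
  have i1 := integrable_mul_of_hasCompactSupport hcφ (h2.fderiv_apply ℝ _) l1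
  have i2 := integrable_mul_of_hasCompactSupport h1.continuous h2 l2
  simp only [smul_eq_mul] at i1 i2
  rw [integral_eq_slices k i1, integral_eq_slices k i2, ← integral_neg]
  congr 1
  ext z
  set x₀ : Config (n + 1) := k.insertNth 0 z
  have hup : ContDiff ℝ ∞ (fun y : E3 => φ (Function.update x₀ k y)) :=
    h1.comp (contDiff_update ∞ x₀ k)
  have hcs : HasCompactSupport (fun y : E3 => φ (Function.update x₀ k y)) := by
    refine HasCompactSupport.intro (h2.isCompact.image (continuous_apply k)) fun y hy => ?_
    by_contra hne
    exact hy ⟨Function.update x₀ k y, subset_tsupport _ hne, by simp⟩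
  have hfd : ∀ y, fderiv ℝ (fun y : E3 => φ (Function.update x₀ k y)) y w
      = fderiv ℝ φ (Function.update x₀ k y) (Pi.single k w) := fun y => by
    have d1 := ((h1.differentiable (by simp)) (Function.update x₀ k y)).hasFDerivAt
    have d2 := d1.comp y (hasFDerivAt_update x₀ y)
    have d3 : HasFDerivAt (fun y : E3 => φ (Function.update x₀ k y)) _ y := d2
    rw [d3.fderiv]
    simp only [ContinuousLinearMap.comp_apply]
    congr 1
    ext i : 1
    rw [ContinuousLinearMap.pi_apply]
    by_cases hi : i = k
    · subst hi; simp
    · rw [Pi.single_eq_of_ne hi, Pi.single_eq_of_ne hi]; rfl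
  have key := h.2.2 _ hup hcs
  simp_rw [hfd] at key
  simp_rw [tensor_update, tensor_update_right, ← mul_assoc]
  rw [integral_mul_const, integral_mul_const, key, neg_mul]

/-! ### Slicing integrals over configuration space -/

/-- The device by which every many-body estimate below is reduced to an integral in a single
particle variable. -/
theorem lintegral_le_of_slices {N : ℕ} {μ : Fin N → Measure E3} [∀ i, SigmaFinite (μ i)]
    (k : Fin N) {f g : Config N → ℝ≥0∞}
    (hf : Measurable f) (hg : Measurable g)
    (h : ∀ x, ∫⁻ y, f (Function.update x k y) ∂μ k ≤ ∫⁻ y, g (Function.update x k y) ∂μ k) :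
    ∫⁻ x, f x ∂Measure.pi μ ≤ ∫⁻ x, g x ∂Measure.pi μ := by
  refine lintegral_le_of_lmarginal_le {k} hf hg ?_
  rw [lmarginal_singleton, lmarginal_singleton]
  exact h

/-! ### The energy of a trial function -/

section Trial

variable {N : ℕ} {V : E3 → ℝ} {v : ℝ → ℝ≥0∞} {a : ℝ} {Φ : E3 → ℝ} {D : Fin 3 → E3 → ℝ}
  {F : Config N → ℝ}

/-- The weak partial derivatives of `F ∏ᵢ Φ(xᵢ)`. -/
noncomputable def trialDeriv (Φ : E3 → ℝ) (D : Fin 3 → E3 → ℝ) (F : Config N → ℝ)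
    (p : Fin N × Fin 3) (x : Config N) : ℝ :=
  F x * tensor (Function.update (fun _ => Φ) p.1 (D p.2)) x
    + lineDeriv ℝ F x (configDir N p) * tensor (fun _ => Φ) x

theorem GPData.realWeakDeriv_trial (h : GPData V N a Φ D) {C : NNReal} (hF : LipschitzWith C F)
    (hB : ∀ x, |F x| ≤ 1) (p : Fin N × Fin 3) :
    RealWeakDeriv (fun x => F x * tensor (fun _ => Φ) x) (trialDeriv Φ D F p) (configDir N p) :=
  (realWeakDeriv_tensor (h.weak p.2) h.measurable (h.measurableD p.2) h.int2 (h.intD p.2)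
    p.1).lipschitz_mul hF hB

/-- The interaction energy density. -/
noncomputable def pairPotential (v : ℝ → ℝ≥0∞) (x : Config N) : ℝ≥0∞ :=
  ∑ i, ∑ j, if i < j then v ‖x i - x j‖ else 0

theorem measurable_pairPotential (hv : Measurable v) :
    Measurable (pairPotential v : Config N → ℝ≥0∞) := by
  refine Finset.measurable_sum _ fun i _ => Finset.measurable_sum _ fun j _ => ?_
  split_ifs
  · exact hv.comp ((measurable_pi_apply i).sub (measurable_pi_apply j)).norm
  · exact measurable_const

/-- The variational principle for `F ∏ Φ`, multiplied through by the squared norm so that no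
division in `ℝ≥0∞` is needed. -/
theorem GPData.qmEnergy_mul_le (h : GPData V N a Φ D) {C : NNReal} (hF : LipschitzWith C F)
    (hB : ∀ x, |F x| ≤ 1) (hsymm : ∀ (σ : Equiv.Perm (Fin N)) x, F (x ∘ σ) = F x)
    (hZ : ∫⁻ x, ENNReal.ofReal ((F x * tensor (fun _ => Φ) x) ^ 2) ≠ 0) :
    qmEnergy N V v * ∫⁻ x, ENNReal.ofReal ((F x * tensor (fun _ => Φ) x) ^ 2)
      ≤ (∫⁻ x, ∑ p, ENNReal.ofReal (trialDeriv Φ D F p x ^ 2))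
        + ∫⁻ x, (∑ i, ENNReal.ofReal (V (x i)) + pairPotential v x)
          * ENNReal.ofReal ((F x * tensor (fun _ => Φ) x) ^ 2) := by
  set P : Config N → ℝ := fun x => F x * tensor (fun _ => Φ) x with hP
  have mP : Measurable P := hF.continuous.measurable.mul (measurable_tensor fun _ => h.measurable)
  have iP : Integrable (fun x => P x ^ 2) := by
    refine (integrable_tensor_sq fun _ : Fin N => h.int2).mono' (mP.pow_const 2).aestronglyMeasurable
      (Eventually.of_forall fun x => ?_)
    have h3 := sq_le_sq' (by linarith [abs_le.1 (hB x)]) (abs_le.1 (hB x)).2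
    rw [Real.norm_eq_abs, abs_of_nonneg (sq_nonneg _), hP, mul_pow]
    nlinarith [sq_nonneg (tensor (fun _ : Fin N => Φ) x)]
  set z := ∫ x, P x ^ 2 with hz
  have eZ : ∫⁻ x, ENNReal.ofReal (P x ^ 2) = ENNReal.ofReal z :=
    (ofReal_integral_eq_lintegral_ofReal iP (Eventually.of_forall fun x => sq_nonneg _)).symm
  rw [eZ] at hZ ⊢
  have zpos : 0 < z := by simpa using hZ
  set c := (Real.sqrt z)⁻¹ with hc
  have hc2 : c ^ 2 = z⁻¹ := by rw [hc, inv_pow, Real.sq_sqrt zpos.le]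
  have hcz : ENNReal.ofReal (c ^ 2) * ENNReal.ofReal z = 1 := by
    rw [← ENNReal.ofReal_mul (sq_nonneg _), hc2, inv_mul_cancel₀ zpos.ne', ENNReal.ofReal_one]
  have sq_scale : ∀ r : ℝ, ‖c * r‖ₑ ^ 2 = ENNReal.ofReal (c ^ 2) * ENNReal.ofReal (r ^ 2) :=
    fun r => by rw [enorm_sq_eq_ofReal, mul_pow, ENNReal.ofReal_mul (sq_nonneg _)]
  have bos : IsBosonicState N (fun x => ((c * P x : ℝ) : ℂ)) := by
    refine ⟨?_, ?_, fun σ => Eventually.of_forall fun x => ?_⟩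
    · exact (((memLp_two_iff_integrable_sq mP.aestronglyMeasurable).2 iP).const_mul c).ofReal
    · simp_rw [enorm_complex_ofReal, sq_scale]
      rw [lintegral_const_mul _ (by fun_prop), eZ, hcz]
    · have e1 : tensor (fun _ : Fin N => Φ) (x ∘ σ) = tensor (fun _ => Φ) x := by
        simp only [tensor, Function.comp]
        exact Equiv.prod_comp σ (fun i => Φ (x i))
      simp only [hP, hsymm, e1]
  have mT : ∀ p, Measurable (trialDeriv Φ D F p) := fun p => by
    refine (hF.continuous.measurable.mul (measurable_tensor fun i => ?_)).add
      ((measurable_lineDeriv hF.continuous).mul (measurable_tensor fun _ => h.measurable))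
    by_cases hi : i = p.1
    · subst hi; simpa using h.measurableD _
    · simpa [hi] using h.measurable
  have kin : kineticEnergy (configDir N) (fun x => ((c * P x : ℝ) : ℂ))
      = ENNReal.ofReal (c ^ 2) * ∫⁻ x, ∑ p, ENNReal.ofReal (trialDeriv Φ D F p x ^ 2) := by
    rw [kineticEnergy_eq fun p => (h.realWeakDeriv_trial hF hB p).const_mul c,
      ← lintegral_const_mul _ (by fun_prop)]
    simp_rw [sq_scale, Finset.mul_sum]
  have pot : ∫⁻ x, (∑ i, ENNReal.ofReal (V (x i))
        + ∑ i, ∑ j, if i < j then v ‖x i - x j‖ else 0) * ‖((c * P x : ℝ) : ℂ)‖ₑ ^ 2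
      = ENNReal.ofReal (c ^ 2) * ∫⁻ x, (∑ i, ENNReal.ofReal (V (x i)) + pairPotential v x)
          * ENNReal.ofReal (P x ^ 2) := by
    rw [← lintegral_const_mul' _ _ ENNReal.ofReal_ne_top]
    congr 1
    ext x
    rw [enorm_complex_ofReal, sq_scale, pairPotential]
    ring
  have hle : qmEnergy N V v ≤ qmForm N V v (fun x => ((c * P x : ℝ) : ℂ)) := iInf₂_le _ bos
  rw [qmForm, kin, pot, ← mul_add] at hle
  refine (mul_le_mul_left hle (ENNReal.ofReal z)).trans (le_of_eq ?_)
  rw [mul_right_comm, hcz, one_mul]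

/-- The bound on the energy of a trial function in which the Gross-Pitaevskii equation has been
used to eliminate the one-particle terms. The derivatives of `F` enter through upper bounds `B`. -/
theorem GPData.trial_energy_le (hV : IsTrap V) (hN : 0 < N) (ha : 0 ≤ a) (h : GPData V N a Φ D)
    (hv : Measurable v) {C : NNReal} (hF : LipschitzWith C F) (hB : ∀ x, |F x| ≤ 1)
    {B : Fin N → Config N → ℝ≥0∞} (mB : ∀ k, Measurable (B k))
    (hFB : ∀ k x, ∀ᵐ y, ENNReal.ofReal
      (∑ m, lineDeriv ℝ F (Function.update x k y) (configDir N (k, m)) ^ 2)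
        ≤ B k (Function.update x k y)) :
    ((∫⁻ x, ∑ p, ENNReal.ofReal (trialDeriv Φ D F p x ^ 2))
        + ∫⁻ x, (∑ i, ENNReal.ofReal (V (x i)) + pairPotential v x)
          * ENNReal.ofReal ((F x * tensor (fun _ => Φ) x) ^ 2))
      + ∑ k, ∫⁻ x, ENNReal.ofReal (8 * Real.pi * a * Φ (x k) ^ 2
          * (F x * tensor (fun _ => Φ) x) ^ 2)
      ≤ ENNReal.ofReal (totalMu V a Φ D) * (∫⁻ x, ENNReal.ofReal ((F x * tensor (fun _ => Φ) x) ^ 2))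
        + ∑ k, (∫⁻ x, B k x * ENNReal.ofReal (tensor (fun _ => Φ) x ^ 2))
        + ∫⁻ x, pairPotential v x * ENNReal.ofReal ((F x * tensor (fun _ => Φ) x) ^ 2) := by
  set T : Config N → ℝ := tensor (fun _ => Φ) with hT
  have mΦ := h.measurable
  have mV := hV.measurable
  have mF : Measurable F := hF.continuous.measurable
  have mT : Measurable T := measurable_tensor fun _ => h.measurable
  have mtd : ∀ p, Measurable (trialDeriv Φ D F p) := fun p => by
    refine (mF.mul (measurable_tensor fun i => ?_)).add
      ((measurable_lineDeriv hF.continuous).mul (measurable_tensor fun _ => h.measurable))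
    by_cases hi : i = p.1
    · subst hi; simpa using h.measurableD _
    · simpa [hi] using h.measurable
  have mpp : Measurable (pairPotential v : Config N → ℝ≥0∞) := measurable_pairPotential hv
  have mΦk : ∀ k : Fin N, Measurable fun x : Config N => Φ (x k) := fun k =>
    mΦ.comp (measurable_pi_apply k)
  have mVk : ∀ k : Fin N, Measurable fun x : Config N => V (x k) := fun k =>
    mV.comp (measurable_pi_apply k)
  have step : ∀ k : Fin N,
      ∫⁻ x, (∑ m, ENNReal.ofReal (trialDeriv Φ D F (k, m) x ^ 2)
        + ENNReal.ofReal (V (x k) * (F x * T x) ^ 2)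
        + ENNReal.ofReal (8 * Real.pi * a * Φ (x k) ^ 2 * (F x * T x) ^ 2))
      ≤ ∫⁻ x, (ENNReal.ofReal (totalMu V a Φ D / N * (F x * T x) ^ 2)
        + B k x * ENNReal.ofReal (T x ^ 2)) := by
    intro k
    refine lintegral_le_of_slices (μ := fun _ => volume) k (by fun_prop)
      (((by fun_prop : Measurable _)).add ((mB k).mul (by fun_prop))) fun x => ?_
    -- On a slice the trial function is `c · G · Φ` with `c` independent of the integration
    -- variable; hence the claim is `GPData.slice_le` for `G`, multiplied by `c²`.
    set c := ∏ i ∈ Finset.univ.erase k, Φ (x i) with hc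
    set G : E3 → ℝ := fun y => F (Function.update x k y) with hG
    have hGl : LipschitzWith C G := by
      refine LipschitzWith.of_dist_le_mul fun y y' => ?_
      refine (hF.dist_le_mul _ _).trans (le_of_eq ?_)
      congr 1
      rw [dist_eq_norm, dist_eq_norm, ← Function.update_sub, sub_self, ← Pi.single,
        Pi.norm_single]
    have hGd : ∀ y m, lineDeriv ℝ F (Function.update x k y) (configDir N (k, m))
        = lineDeriv ℝ G y (dir m) := fun y m => by
      rw [lineDeriv, lineDeriv]
      congr 1
      ext t
      simp only [hG]
      congr 1
      ext i : 1
      by_cases hi : i = k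
      · subst hi; simp [configDir]
      · simp [configDir, hi]
    have eT : ∀ y, T (Function.update x k y) = Φ y * c := fun y => tensor_update_right _ k x y
    have eD : ∀ y m, trialDeriv Φ D F (k, m) (Function.update x k y)
        = (G y * D m y + lineDeriv ℝ G y (dir m) * Φ y) * c := fun y m => by
      rw [trialDeriv, tensor_update, hGd, ← hT, eT]
      ring
    have key := h.slice_le hV hN ha hGl (fun y => hB _)
    have hμ : 0 ≤ totalMu V a Φ D / N := by
      have := quadEnergy_nonneg hV (Φ := Φ) (D := D)
      have : 0 ≤ ∫ x, Φ x ^ 4 := integral_nonneg fun x => by positivity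
      unfold totalMu
      positivity
    have key' := mul_le_mul_left key (ENNReal.ofReal (c ^ 2))
    rw [← lintegral_mul_const' _ _ ENNReal.ofReal_ne_top,
      ← lintegral_mul_const' _ _ ENNReal.ofReal_ne_top] at key'
    refine le_trans (le_of_eq ?_) (key'.trans ?_)
    · congr 1
      ext y
      simp only [Function.update_self, eT, eD]
      rw [add_mul, add_mul, Finset.sum_mul, ← ENNReal.ofReal_mul (mul_nonneg (hV.nonneg y)
        (sq_nonneg _)), ← ENNReal.ofReal_mul (by positivity)]
      simp_rw [mul_pow _ c]
      congr 1
      · congr 1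
        · exact Finset.sum_congr rfl fun m _ => ENNReal.ofReal_mul (sq_nonneg _)
        · congr 1
          simp only [hG]; ring
      · congr 1
        simp only [hG]; ring
    · refine lintegral_mono_ae ?_
      filter_upwards [hFB k x] with y hy
      simp_rw [hGd] at hy
      simp only [eT]
      rw [add_mul, ← ENNReal.ofReal_mul (by positivity), mul_assoc (ENNReal.ofReal (∑ k, _)),
        ← ENNReal.ofReal_mul (sq_nonneg _), ← mul_pow]
      refine add_le_add (le_of_eq ?_) (mul_le_mul_left hy _)
      congr 1
      simp only [hG]; ring
  have total := Finset.sum_le_sum fun k (_ : k ∈ Finset.univ) => step k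
  have eL : (∫⁻ x, ∑ p, ENNReal.ofReal (trialDeriv Φ D F p x ^ 2))
        + ∫⁻ x, (∑ i, ENNReal.ofReal (V (x i)) + pairPotential v x)
          * ENNReal.ofReal ((F x * T x) ^ 2)
      = (∑ k, ∫⁻ x, (∑ m, ENNReal.ofReal (trialDeriv Φ D F (k, m) x ^ 2)
        + ENNReal.ofReal (V (x k) * (F x * T x) ^ 2)))
        + ∫⁻ x, pairPotential v x * ENNReal.ofReal ((F x * T x) ^ 2) := by
    rw [← lintegral_finsetSum _ (fun k _ => by fun_prop)]
    simp_rw [Finset.sum_add_distrib, add_mul]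
    rw [lintegral_add_left (by fun_prop), lintegral_add_left (by fun_prop), ← add_assoc]
    congr 2
    · congr 1
      ext x
      rw [Fintype.sum_prod_type]
    · congr 1
      ext x
      rw [Finset.sum_mul]
      exact Finset.sum_congr rfl fun k _ => (ENNReal.ofReal_mul (hV.nonneg _)).symm
  have eS : (∑ k, ∫⁻ x, (∑ m, ENNReal.ofReal (trialDeriv Φ D F (k, m) x ^ 2)
        + ENNReal.ofReal (V (x k) * (F x * T x) ^ 2)
        + ENNReal.ofReal (8 * Real.pi * a * Φ (x k) ^ 2 * (F x * T x) ^ 2)))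
      = (∑ k, ∫⁻ x, (∑ m, ENNReal.ofReal (trialDeriv Φ D F (k, m) x ^ 2)
        + ENNReal.ofReal (V (x k) * (F x * T x) ^ 2)))
        + ∑ k, ∫⁻ x, ENNReal.ofReal (8 * Real.pi * a * Φ (x k) ^ 2 * (F x * T x) ^ 2) := by
    rw [← Finset.sum_add_distrib]
    exact Finset.sum_congr rfl fun k _ => lintegral_add_left (by fun_prop) _
  have eR : (∑ k : Fin N, ∫⁻ x, (ENNReal.ofReal (totalMu V a Φ D / N * (F x * T x) ^ 2)
        + B k x * ENNReal.ofReal (T x ^ 2)))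
      = ENNReal.ofReal (totalMu V a Φ D) * (∫⁻ x, ENNReal.ofReal ((F x * T x) ^ 2))
        + ∑ k, (∫⁻ x, B k x * ENNReal.ofReal (T x ^ 2)) := by
    simp_rw [lintegral_add_left (f := fun x => ENNReal.ofReal (totalMu V a Φ D / N * (F x * T x) ^ 2))
      (by fun_prop), Finset.sum_add_distrib]
    congr 1
    have hμ : 0 ≤ totalMu V a Φ D := by
      have := quadEnergy_nonneg hV (Φ := Φ) (D := D)
      have : 0 ≤ ∫ x, Φ x ^ 4 := integral_nonneg fun x => by positivity
      unfold totalMu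
      positivity
    simp_rw [ENNReal.ofReal_mul (div_nonneg hμ (Nat.cast_nonneg N))]
    rw [lintegral_const_mul _ (by fun_prop), Finset.sum_const, Finset.card_univ, Fintype.card_fin,
      nsmul_eq_mul, ← mul_assoc]
    congr 1
    have hN' : (0 : ℝ) < N := by exact_mod_cast hN
    -- Each of the `N` particles contributes `totalMu / N` times the squared norm.
    rw [← ENNReal.ofReal_natCast, ← ENNReal.ofReal_mul hN'.le, mul_div_cancel₀ _ hN'.ne']
  rw [eS, eR] at total
  rw [eL, add_right_comm]
  exact add_le_add total le_rfl

end Trial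

/-! ### Jastrow functions -/

/-- The pair factors of Jastrow functions. -/
structure IsPairFactor (ζ : E3 → ℝ) : Prop where
  nonneg : ∀ y, 0 ≤ ζ y
  le_one : ∀ y, ζ y ≤ 1
  even : ∀ y, ζ (-y) = ζ y
  lipschitz : ∃ C, LipschitzWith C ζ

section Jastrow

variable {N : ℕ} {ζ : E3 → ℝ}

/-- The product of the pair factors of all pairs of particles that avoid `A`. -/
def jastrow (ζ : E3 → ℝ) (A : Finset (Fin N)) (x : Config N) : ℝ :=
  ∏ i, ∏ j, if i < j ∧ i ∉ A ∧ j ∉ A then ζ (x i - x j) else 1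

/-- The particles other than `k` that are not in `A`. -/
def others (A : Finset (Fin N)) (k : Fin N) : Finset (Fin N) :=
  Finset.univ.filter fun j => j ≠ k ∧ j ∉ A

theorem card_others_le (A : Finset (Fin N)) (k : Fin N) : (others A k).card ≤ N := by
  simpa using Finset.card_le_univ (others A k)

/-- Isolates the dependence on `x k`: the first factor on the right no longer involves it. Evenness
of `ζ` allows the pairs with `k` as larger index to be written as `ζ (x k - x j)` too. -/
theorem jastrow_eq_mul (hζ : IsPairFactor ζ) {A : Finset (Fin N)} {k : Fin N} (hk : k ∉ A)
    (x : Config N) :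
    jastrow ζ A x = jastrow ζ (insert k A) x * ∏ j ∈ others A k, ζ (x k - x j) := by
  have e1 : ∀ i j, (if i < j ∧ i ∉ A ∧ j ∉ A then ζ (x i - x j) else 1)
      = (if i < j ∧ i ∉ insert k A ∧ j ∉ insert k A then ζ (x i - x j) else 1)
        * ((if i = k then (if k < j ∧ j ∉ A then ζ (x k - x j) else 1) else 1)
        * (if j = k then (if i < k ∧ i ∉ A then ζ (x k - x i) else 1) else 1)) := by
    intro i j
    have ev : ζ (x i - x k) = ζ (x k - x i) := by rw [← hζ.even, neg_sub]
    by_cases hi : i = k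
    · subst hi
      by_cases hj : j = i
      · subst hj; simp
      · simp [hj, hk]
    · by_cases hj : j = k
      · subst hj
        simp [hi, hk, ev]
      · simp [hi, hj]
  simp only [jastrow]
  simp_rw [e1, Finset.prod_mul_distrib]
  congr 1
  have e2 : ∏ i, ∏ j, (if i = k then (if k < j ∧ j ∉ A then ζ (x k - x j) else 1) else 1)
      = ∏ j, (if k < j ∧ j ∉ A then ζ (x k - x j) else 1) := by
    rw [Finset.prod_eq_single k]
    · simp
    · intro b _ hb; simp [hb]
    · simp
  have e3 : ∏ i, ∏ j, (if j = k then (if i < k ∧ i ∉ A then ζ (x k - x i) else 1) else 1)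
      = ∏ i, (if i < k ∧ i ∉ A then ζ (x k - x i) else 1) := by
    refine Finset.prod_congr rfl fun i _ => ?_
    simp
  rw [e2, e3, ← Finset.prod_mul_distrib, others, Finset.prod_filter]
  refine Finset.prod_congr rfl fun j _ => ?_
  rcases lt_trichotomy j k with h | h | h
  · simp [h, h.ne, h.not_gt]
  · subst h; simp
  · simp [h, h.ne', h.not_gt]

theorem jastrow_nonneg (hζ : IsPairFactor ζ) (A : Finset (Fin N)) (x : Config N) :
    0 ≤ jastrow ζ A x := by
  refine Finset.prod_nonneg fun i _ => Finset.prod_nonneg fun j _ => ?_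
  split_ifs
  · exact hζ.nonneg _
  · exact zero_le_one

theorem jastrow_le_one (hζ : IsPairFactor ζ) (A : Finset (Fin N)) (x : Config N) :
    jastrow ζ A x ≤ 1 := by
  refine Finset.prod_le_one (fun i _ => Finset.prod_nonneg fun j _ => ?_) fun i _ =>
    Finset.prod_le_one (fun j _ => ?_) fun j _ => ?_
  · split_ifs
    · exact hζ.nonneg _
    · exact zero_le_one
  · split_ifs
    · exact hζ.nonneg _
    · exact zero_le_one
  · split_ifs
    · exact hζ.le_one _
    · exact le_rfl

theorem jastrow_abs_le_one (hζ : IsPairFactor ζ) (A : Finset (Fin N)) (x : Config N) :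
    |jastrow ζ A x| ≤ 1 := by
  rw [abs_of_nonneg (jastrow_nonneg hζ A x)]; exact jastrow_le_one hζ A x

theorem prod_others_nonneg (hζ : IsPairFactor ζ) (S : Finset (Fin N)) (x : Config N) (y : E3) :
    0 ≤ ∏ j ∈ S, ζ (y - x j) := Finset.prod_nonneg fun _ _ => hζ.nonneg _

theorem prod_others_le_one (hζ : IsPairFactor ζ) (S : Finset (Fin N)) (x : Config N) (y : E3) :
    ∏ j ∈ S, ζ (y - x j) ≤ 1 :=
  Finset.prod_le_one (fun _ _ => hζ.nonneg _) fun _ _ => hζ.le_one _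

theorem jastrow_le_insert (hζ : IsPairFactor ζ) (A : Finset (Fin N)) (k : Fin N)
    (x : Config N) : jastrow ζ A x ≤ jastrow ζ (insert k A) x := by
  by_cases hk : k ∈ A
  · rw [Finset.insert_eq_of_mem hk]
  · rw [jastrow_eq_mul hζ hk]
    exact mul_le_of_le_one_right (jastrow_nonneg hζ _ x) (prod_others_le_one hζ _ x _)

theorem jastrow_sq_le_insert (hζ : IsPairFactor ζ) (A : Finset (Fin N)) (k : Fin N)
    (x : Config N) : jastrow ζ A x ^ 2 ≤ jastrow ζ (insert k A) x ^ 2 :=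
  pow_le_pow_left₀ (jastrow_nonneg hζ A x) (jastrow_le_insert hζ A k x) 2

/-- Among the factors that involve `i` or `j`, only their mutual one is kept, the others being at
most `1`. It has to be kept because it tames the singularity of `v` in the interaction term. -/
theorem jastrow_le_insert_mul (hζ : IsPairFactor ζ) {i j : Fin N} (hij : i ≠ j) (x : Config N) :
    jastrow ζ ∅ x ≤ jastrow ζ {j, i} x * ζ (x i - x j) := by
  have hj : j ∈ others ∅ i := by simp [others, hij.symm]
  rw [jastrow_eq_mul hζ (Finset.notMem_empty i), ← Finset.mul_prod_erase _ _ hj]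
  have h1 : jastrow ζ (insert i ∅) x ≤ jastrow ζ {j, i} x := jastrow_le_insert hζ _ j x
  have h2 := prod_others_le_one hζ ((others ∅ i).erase j) x (x i)
  calc _ ≤ jastrow ζ (insert i ∅) x * (ζ (x i - x j) * 1) :=
        mul_le_mul_of_nonneg_left (mul_le_mul_of_nonneg_left h2 (hζ.nonneg _))
          (jastrow_nonneg hζ _ x)
    _ ≤ _ := by
        rw [mul_one]
        exact mul_le_mul_of_nonneg_right h1 (hζ.nonneg _)

theorem jastrow_update {A : Finset (Fin N)} {k : Fin N} (hk : k ∈ A) (x : Config N) (y : E3) :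
    jastrow ζ A (Function.update x k y) = jastrow ζ A x := by
  refine Finset.prod_congr rfl fun i _ => Finset.prod_congr rfl fun j _ => ?_
  split_ifs with h
  · have hi : i ≠ k := fun e => h.2.1 (e ▸ hk)
    have hj : j ≠ k := fun e => h.2.2 (e ▸ hk)
    simp [hi, hj]
  · rfl

theorem jastrow_univ (x : Config N) : jastrow ζ Finset.univ x = 1 := by
  simp [jastrow]

/-- The square is a product over all ordered pairs, in which the order of the labels no longer
appears; nonnegativity allows the square root to be taken. -/
theorem jastrow_symm (hζ : IsPairFactor ζ) (σ : Equiv.Perm (Fin N)) (x : Config N) :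
    jastrow ζ ∅ (x ∘ σ) = jastrow ζ ∅ x := by
  have hsq : ∀ x : Config N, jastrow ζ ∅ x ^ 2
      = ∏ i, ∏ j, if i ≠ j then ζ (x i - x j) else 1 := by
    intro x
    have e1 : jastrow ζ ∅ x = ∏ i, ∏ j, if j < i then ζ (x i - x j) else 1 := by
      rw [jastrow, Finset.prod_comm]
      refine Finset.prod_congr rfl fun i _ => Finset.prod_congr rfl fun j _ => ?_
      rw [← hζ.even, neg_sub]
      simp
    have e2 : jastrow ζ ∅ x = ∏ i, ∏ j, if i < j then ζ (x i - x j) else 1 := by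
      simp [jastrow]
    rw [sq]
    nth_rewrite 1 [e1]
    rw [e2]
    simp_rw [← Finset.prod_mul_distrib]
    refine Finset.prod_congr rfl fun i _ => Finset.prod_congr rfl fun j _ => ?_
    rcases lt_trichotomy i j with h | h | h
    · simp [h, h.ne, h.not_gt]
    · subst h; simp
    · simp [h, h.ne', h.not_gt]
  have h1 : jastrow ζ ∅ (x ∘ σ) ^ 2 = jastrow ζ ∅ x ^ 2 := by
    rw [hsq, hsq, ← Equiv.prod_comp σ (fun i => ∏ j, if i ≠ j then ζ (x i - x j) else 1)]
    refine Finset.prod_congr rfl fun i _ => ?_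
    rw [← Equiv.prod_comp σ (fun j => if σ i ≠ j then ζ (x (σ i) - x j) else 1)]
    refine Finset.prod_congr rfl fun j _ => ?_
    simp
  exact (pow_left_inj₀ (jastrow_nonneg hζ _ _) (jastrow_nonneg hζ _ _) two_ne_zero).1 h1

theorem exists_lipschitz_prod {X κ : Type*} [PseudoMetricSpace X] (s : Finset κ) (f : κ → X → ℝ)
    (h : ∀ i ∈ s, (∃ C, LipschitzWith C (f i)) ∧ ∀ x, |f i x| ≤ 1) :
    ∃ C, LipschitzWith C (fun x => ∏ i ∈ s, f i x) := by
  classical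
  induction s using Finset.induction_on with
  | empty => exact ⟨0, by simp⟩
  | insert i s hi ih =>
    obtain ⟨C, hC⟩ := ih fun j hj => h j (Finset.mem_insert_of_mem hj)
    obtain ⟨⟨C', hC'⟩, hb⟩ := h i (Finset.mem_insert_self i s)
    have hb' : ∀ x, |∏ j ∈ s, f j x| ≤ 1 := fun x => by
      rw [Finset.abs_prod]
      exact Finset.prod_le_one (fun _ _ => abs_nonneg _)
        fun j hj => (h j (Finset.mem_insert_of_mem hj)).2 x
    simp_rw [Finset.prod_insert hi]
    exact ⟨_, lipschitzWith_mul hC' hC hb hb'⟩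

theorem exists_lipschitz_jastrow (hζ : IsPairFactor ζ) (A : Finset (Fin N)) :
    ∃ C, LipschitzWith C (jastrow ζ A) := by
  have habs : ∀ y, |ζ y| ≤ 1 := fun y => by
    rw [abs_of_nonneg (hζ.nonneg y)]; exact hζ.le_one y
  have h1 : ∀ i j : Fin N, (∃ C, LipschitzWith C fun x : Config N =>
      if i < j ∧ i ∉ A ∧ j ∉ A then ζ (x i - x j) else 1) ∧
      ∀ x : Config N, |if i < j ∧ i ∉ A ∧ j ∉ A then ζ (x i - x j) else 1| ≤ 1 := by
    intro i j
    split_ifs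
    · obtain ⟨C, hC⟩ := hζ.lipschitz
      exact ⟨⟨_, hC.comp ((LipschitzWith.eval i).sub (LipschitzWith.eval j))⟩, fun x => habs _⟩
    · exact ⟨⟨0, LipschitzWith.const _⟩, fun x => by simp⟩
  refine exists_lipschitz_prod _ _ fun i _ => ⟨exists_lipschitz_prod _ _ fun j _ => h1 i j, ?_⟩
  intro x
  rw [Finset.abs_prod]
  exact Finset.prod_le_one (fun _ _ => abs_nonneg _) fun j _ => (h1 i j).2 x

theorem measurable_jastrow (hζ : IsPairFactor ζ) (A : Finset (Fin N)) :
    Measurable (jastrow ζ A) := by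
  obtain ⟨C, hC⟩ := exists_lipschitz_jastrow hζ A
  exact hC.continuous.measurable

theorem IsPairFactor.measurable (hζ : IsPairFactor ζ) : Measurable ζ := by
  obtain ⟨C, hC⟩ := hζ.lipschitz
  exact hC.continuous.measurable

/-- The union bound. It reduces the cost of deleting a particle from the Jastrow factor to the
one-body integral of `1 - ζ²`. -/
theorem one_le_prod_add_sum {κ : Type*} (s : Finset κ) (f : κ → ℝ) (h0 : ∀ i, 0 ≤ f i)
    (h1 : ∀ i, f i ≤ 1) : 1 ≤ ∏ i ∈ s, f i + ∑ i ∈ s, (1 - f i) := by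
  classical
  induction s using Finset.induction_on with
  | empty => simp
  | insert i s hi ih =>
    rw [Finset.prod_insert hi, Finset.sum_insert hi]
    have hp : ∏ j ∈ s, f j ≤ 1 := Finset.prod_le_one (fun _ _ => h0 _) fun _ _ => h1 _
    nlinarith [h0 i, h1 i, mul_nonneg (sub_nonneg.2 (h1 i)) (sub_nonneg.2 hp)]

theorem jastrow_insert_sq_le (hζ : IsPairFactor ζ) {A : Finset (Fin N)} {k : Fin N} (hk : k ∉ A)
    (x : Config N) : jastrow ζ (insert k A) x ^ 2 ≤ jastrow ζ A x ^ 2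
      + ∑ j ∈ others A k, jastrow ζ (insert k A) x ^ 2 * (1 - ζ (x k - x j) ^ 2) := by
  rw [jastrow_eq_mul hζ hk, mul_pow, ← Finset.mul_sum, ← Finset.prod_pow, ← mul_add]
  refine le_mul_of_one_le_right (sq_nonneg _) (one_le_prod_add_sum _ _ (fun _ => sq_nonneg _) ?_)
  intro j
  exact pow_le_one₀ (hζ.nonneg _) (hζ.le_one _)

/-- Evaluate `L` at the vector `w` that represents it: `‖w‖² = L w ≤ ‖L‖ ‖w‖`. -/
theorem sum_sq_apply_dir_le (L : E3 →L[ℝ] ℝ) : ∑ m, L (dir m) ^ 2 ≤ ‖L‖ ^ 2 := by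
  set w : E3 := ∑ m, L (dir m) • dir m with hw
  have h1 : L w = ∑ m, L (dir m) ^ 2 := by
    rw [hw, map_sum]
    exact Finset.sum_congr rfl fun m _ => by rw [map_smul, smul_eq_mul, sq]
  have h2 : ‖w‖ ^ 2 = ∑ m, L (dir m) ^ 2 := by
    rw [EuclideanSpace.norm_sq_eq]
    refine Finset.sum_congr rfl fun m _ => ?_
    have : w m = L (dir m) := by
      simp [hw, dir, Fin.sum_univ_three]
      fin_cases m <;> simp
    rw [this, Real.norm_eq_abs, sq_abs]
  rw [← h2]
  have h3 : ‖w‖ ^ 2 ≤ ‖L‖ * ‖w‖ := by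
    rw [h2, ← h1]
    exact (le_abs_self _).trans (L.le_opNorm w)
  refine pow_le_pow_left₀ (norm_nonneg _) ?_ 2
  by_contra hlt
  push Not at hlt
  nlinarith [norm_nonneg w, norm_nonneg L]

theorem lineDeriv_configDir (F : Config N → ℝ) (x : Config N) (k : Fin N) (y : E3) (m : Fin 3) :
    lineDeriv ℝ F (Function.update x k y) (configDir N (k, m))
      = lineDeriv ℝ (fun y => F (Function.update x k y)) y (dir m) := by
  rw [lineDeriv, lineDeriv]
  congr 1
  ext t
  congr 1
  ext i : 1
  by_cases hi : i = k
  · subst hi; simp [configDir]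
  · simp [configDir, hi]

/-- The size of the gradient of `ζ`. -/
noncomputable def gradNorm (ζ : E3 → ℝ) (y : E3) : ℝ := ‖fderiv ℝ ζ y‖

theorem measurable_gradNorm (ζ : E3 → ℝ) : Measurable (gradNorm ζ) :=
  (measurable_fderiv ℝ ζ).norm

theorem gradNorm_neg (hζ : IsPairFactor ζ) (y : E3) : gradNorm ζ (-y) = gradNorm ζ y := by
  have h1 : (fun y => ζ (-y)) = ζ := funext hζ.even
  have h2 := (ContinuousLinearEquiv.neg ℝ (M := E3)).comp_right_fderiv (f := ζ) (x := y)
  have h3 : ζ ∘ (ContinuousLinearEquiv.neg ℝ : E3 ≃L[ℝ] E3) = ζ := h1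
  rw [h3] at h2
  have h4 : fderiv ℝ ζ y = -fderiv ℝ ζ (-y) := by
    rw [h2]
    ext w
    simp
  rw [gradNorm, gradNorm, h4, norm_neg]

/-- Upper bound for the squared gradient of the Jastrow function in the variable `k`. -/
noncomputable def gradBound (ζ : E3 → ℝ) (k : Fin N) (x : Config N) : ℝ≥0∞ :=
  (∑ j ∈ others ∅ k, ENNReal.ofReal (jastrow ζ {j, k} x ^ 2)
      * ENNReal.ofReal (gradNorm ζ (x k - x j) ^ 2))
    + ∑ j ∈ others ∅ k, ∑ i ∈ (others ∅ k).erase j, ENNReal.ofReal (jastrow ζ {i, j, k} x ^ 2)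
      * ENNReal.ofReal (gradNorm ζ (x j - x k)) * ENNReal.ofReal (gradNorm ζ (x i - x k))

theorem sq_sum_eq {κ : Type*} [DecidableEq κ] (s : Finset κ) (f : κ → ℝ) :
    (∑ j ∈ s, f j) ^ 2 = ∑ j ∈ s, f j ^ 2 + ∑ j ∈ s, ∑ i ∈ s.erase j, f j * f i := by
  rw [sq, Finset.sum_mul_sum, ← Finset.sum_add_distrib]
  refine Finset.sum_congr rfl fun j hj => ?_
  rw [← Finset.add_sum_erase s _ hj, sq]

/-- By Rademacher's theorem the product rule holds almost everywhere on the slice. In the resulting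
sum over `j` the undifferentiated factors at `k` are bounded by `1`, and the square of the sum is
split into diagonal and mixed terms. In each term the prefactor is then enlarged by deleting the
particles whose positions occur in the gradients, so that these positions can be integrated out. -/
theorem gradBound_spec (hζ : IsPairFactor ζ) (k : Fin N) (x : Config N) :
    ∀ᵐ y, ENNReal.ofReal
      (∑ m, lineDeriv ℝ (jastrow ζ ∅) (Function.update x k y) (configDir N (k, m)) ^ 2)
        ≤ gradBound ζ k (Function.update x k y) := by
  obtain ⟨C, hC⟩ := hζ.lipschitz
  have had : ∀ᵐ y : E3, ∀ j, DifferentiableAt ℝ ζ (y - x j) := ae_all_iff.2 fun j =>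
    (measurePreserving_sub_right volume (x j)).quasiMeasurePreserving.ae hC.ae_differentiableAt
  filter_upwards [had] with y hy
  set S := others ∅ k with hS
  set c := jastrow ζ {k} x with hc
  have c0 : 0 ≤ c := jastrow_nonneg hζ _ x
  have eF : (fun y => jastrow ζ ∅ (Function.update x k y))
      = fun y => c * ∏ j ∈ S, ζ (y - x j) := by
    ext y
    rw [jastrow_eq_mul hζ (Finset.notMem_empty k)]
    congr 1
    · exact jastrow_update (by simp) x y
    · refine Finset.prod_congr rfl fun j hj => ?_
      have : j ≠ k := by simpa [hS, others] using hj
      simp [this]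
  have hd : ∀ j ∈ S, HasFDerivAt (fun y => ζ (y - x j)) (fderiv ℝ ζ (y - x j)) y := fun j _ => by
    have h2 : HasFDerivAt (fun y : E3 => y - x j) (ContinuousLinearMap.id ℝ E3) y :=
      (hasFDerivAt_id y).sub_const _
    have h1 := (hy j).hasFDerivAt.comp y h2
    rw [ContinuousLinearMap.comp_id] at h1
    exact h1
  have hd2 := (HasFDerivAt.finsetProd hd).const_mul c
  set L := c • ∑ j ∈ S, (∏ i ∈ S.erase j, ζ (y - x i)) • fderiv ℝ ζ (y - x j) with hL
  have hL1 : ∀ m, lineDeriv ℝ (jastrow ζ ∅) (Function.update x k y) (configDir N (k, m))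
      = L (dir m) := fun m => by
    rw [lineDeriv_configDir, eF]
    exact (hd2.hasLineDerivAt (dir m)).lineDeriv
  simp_rw [hL1]
  have hn : ‖L‖ ≤ ∑ j ∈ S, c * gradNorm ζ (y - x j) := by
    rw [hL, norm_smul, Real.norm_eq_abs, abs_of_nonneg c0, ← Finset.mul_sum]
    refine mul_le_mul_of_nonneg_left ((norm_sum_le _ _).trans (Finset.sum_le_sum fun j _ => ?_)) c0
    rw [norm_smul, Real.norm_eq_abs, abs_of_nonneg (prod_others_nonneg hζ _ x y)]
    exact mul_le_of_le_one_left (norm_nonneg _) (prod_others_le_one hζ _ x y)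
  have hg : ∀ y, 0 ≤ gradNorm ζ y := fun y => norm_nonneg _
  have h1 : ∑ m, L (dir m) ^ 2 ≤ ∑ j ∈ S, (c * gradNorm ζ (y - x j)) ^ 2
      + ∑ j ∈ S, ∑ i ∈ S.erase j, (c * gradNorm ζ (y - x j)) * (c * gradNorm ζ (y - x i)) := by
    rw [← sq_sum_eq]
    exact (sum_sq_apply_dir_le L).trans (pow_le_pow_left₀ (norm_nonneg _) hn 2)
  refine (ENNReal.ofReal_le_ofReal h1).trans ?_
  have hSk : ∀ j ∈ S, j ≠ k := fun j hj => by simpa [hS, others] using hj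
  rw [ENNReal.ofReal_add (by positivity) (Finset.sum_nonneg fun j _ => Finset.sum_nonneg
    fun i _ => mul_nonneg (mul_nonneg c0 (hg _)) (mul_nonneg c0 (hg _)))]
  rw [gradBound]
  refine add_le_add ?_ ?_
  · rw [ENNReal.ofReal_sum_of_nonneg fun _ _ => sq_nonneg _]
    refine Finset.sum_le_sum fun j hj => ?_
    rw [jastrow_update (by simp), Function.update_self, Function.update_of_ne (hSk j hj), mul_pow,
      ENNReal.ofReal_mul (sq_nonneg _)]
    gcongr
    exact jastrow_le_insert hζ {k} j x
  · rw [ENNReal.ofReal_sum_of_nonneg fun _ _ => Finset.sum_nonneg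
      fun i _ => mul_nonneg (mul_nonneg c0 (hg _)) (mul_nonneg c0 (hg _))]
    refine Finset.sum_le_sum fun j hj => ?_
    rw [ENNReal.ofReal_sum_of_nonneg fun i _ =>
      mul_nonneg (mul_nonneg c0 (hg _)) (mul_nonneg c0 (hg _))]
    refine Finset.sum_le_sum fun i hi => ?_
    rw [jastrow_update (by simp), Function.update_self, Function.update_of_ne (hSk j hj),
      Function.update_of_ne (hSk i (Finset.mem_of_mem_erase hi)), ← gradNorm_neg hζ (x j - y),
      ← gradNorm_neg hζ (x i - y), neg_sub, neg_sub, ← ENNReal.ofReal_mul (sq_nonneg _),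
      ← ENNReal.ofReal_mul (mul_nonneg (sq_nonneg _) (hg _))]
    apply ENNReal.ofReal_le_ofReal
    have hcc : c ^ 2 ≤ jastrow ζ {i, j, k} x ^ 2 :=
      (jastrow_sq_le_insert hζ {k} j x).trans (jastrow_sq_le_insert hζ {j, k} i x)
    have := mul_le_mul_of_nonneg_right hcc (mul_nonneg (hg (y - x j)) (hg (y - x i)))
    linarith

theorem measurable_gradBound (hζ : IsPairFactor ζ) (k : Fin N) : Measurable (gradBound ζ k) := by
  have h1 : ∀ A : Finset (Fin N), Measurable (jastrow ζ A) := measurable_jastrow hζ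
  have h2 : ∀ i j : Fin N, Measurable fun x : Config N => gradNorm ζ (x i - x j) := fun i j =>
    (measurable_gradNorm ζ).comp ((measurable_pi_apply i).sub (measurable_pi_apply j))
  unfold gradBound
  fun_prop

end Jastrow

/-! ### Integrals against the product of the densities -/

/-- The measure `Φ² dx`. -/
noncomputable def rhoMeasure (Φ : E3 → ℝ) : Measure E3 :=
  volume.withDensity fun y => ENNReal.ofReal (Φ y ^ 2)

/-- The product of the measures `Φ² dx`. -/
noncomputable def configMeasure (N : ℕ) (Φ : E3 → ℝ) : Measure (Config N) :=
  Measure.pi fun _ => rhoMeasure Φ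

section Density

variable {N : ℕ} {V : E3 → ℝ} {v : ℝ → ℝ≥0∞} {a : ℝ} {Φ : E3 → ℝ} {D : Fin 3 → E3 → ℝ}

theorem lintegral_rhoMeasure (mΦ : Measurable Φ) {b : E3 → ℝ≥0∞} (hb : Measurable b) :
    ∫⁻ y, b y ∂rhoMeasure Φ = ∫⁻ y, ENNReal.ofReal (Φ y ^ 2) * b y :=
  lintegral_withDensity_eq_lintegral_mul _ (by fun_prop) hb

theorem GPData.rhoMeasure_univ (h : GPData V N a Φ D) : rhoMeasure Φ univ = N := by
  rw [rhoMeasure, withDensity_apply _ MeasurableSet.univ, Measure.restrict_univ,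
    ← ofReal_integral_eq_lintegral_ofReal h.int2 (Eventually.of_forall fun _ => sq_nonneg _),
    h.normalized, ENNReal.ofReal_natCast]

theorem GPData.isFiniteMeasure (h : GPData V N a Φ D) : IsFiniteMeasure (rhoMeasure Φ) :=
  ⟨by rw [h.rhoMeasure_univ]; exact ENNReal.natCast_lt_top N⟩

theorem GPData.configMeasure_eq (h : GPData V N a Φ D) : configMeasure N Φ
    = volume.withDensity fun x : Config N => ENNReal.ofReal (tensor (fun _ => Φ) x ^ 2) := by
  have := h.isFiniteMeasure
  refine Measure.pi_eq fun s hs => ?_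
  rw [withDensity_apply _ (MeasurableSet.univ_pi hs), volume_pi, Measure.restrict_pi_pi]
  have i2 : ∀ i, Integrable (fun x => Φ x ^ 2) (volume.restrict (s i)) := fun i =>
    h.int2.integrableOn
  have e1 : ∀ x : Config N, tensor (fun _ => Φ) x ^ 2 = ∏ i, Φ (x i) ^ 2 := fun x => by
    rw [tensor, Finset.prod_pow]
  simp_rw [e1]
  rw [← ofReal_integral_eq_lintegral_ofReal (Integrable.fintype_prod i2)
    (Eventually.of_forall fun x => Finset.prod_nonneg fun _ _ => sq_nonneg _),
    integral_fintype_prod_eq_prod (fun _ : Fin N => fun y => Φ y ^ 2),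
    ENNReal.ofReal_prod_of_nonneg fun i _ => integral_nonneg fun _ => sq_nonneg _]
  refine Finset.prod_congr rfl fun i _ => ?_
  rw [ofReal_integral_eq_lintegral_ofReal (i2 i) (Eventually.of_forall fun _ => sq_nonneg _),
    rhoMeasure, withDensity_apply _ (hs i)]

theorem GPData.lintegral_config (h : GPData V N a Φ D) {H : Config N → ℝ≥0∞} (hH : Measurable H) :
    ∫⁻ x, H x * ENNReal.ofReal (tensor (fun _ => Φ) x ^ 2) = ∫⁻ x, H x ∂configMeasure N Φ := by
  have mT : Measurable fun x : Config N => ENNReal.ofReal (tensor (fun _ => Φ) x ^ 2) :=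
    ((measurable_tensor fun _ => h.measurable).pow_const 2).ennreal_ofReal
  rw [h.configMeasure_eq, lintegral_withDensity_eq_lintegral_mul _ mT hH]
  congr 1
  ext x
  rw [Pi.mul_apply, mul_comm]

theorem GPData.slices (h : GPData V N a Φ D) (k : Fin N) {f g : Config N → ℝ≥0∞}
    (hf : Measurable f) (hg : Measurable g)
    (hfg : ∀ x, ∫⁻ y, f (Function.update x k y) ∂rhoMeasure Φ
      ≤ ∫⁻ y, g (Function.update x k y) ∂rhoMeasure Φ) :
    ∫⁻ x, f x ∂configMeasure N Φ ≤ ∫⁻ x, g x ∂configMeasure N Φ := by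
  have := h.isFiniteMeasure
  exact lintegral_le_of_slices (μ := fun _ => rhoMeasure Φ) k hf hg hfg

/-- Integrating out one variable. -/
theorem GPData.integrate_one (h : GPData V N a Φ D) (k : Fin N) {A B : Config N → ℝ≥0∞}
    (hA : Measurable A) (hB : Measurable B) (hAk : ∀ x y, A (Function.update x k y) = A x)
    {C : ℝ≥0∞} (hBC : ∀ x, ∫⁻ y, B (Function.update x k y) ∂rhoMeasure Φ ≤ C) :
    N * ∫⁻ x, A x * B x ∂configMeasure N Φ ≤ C * ∫⁻ x, A x ∂configMeasure N Φ := by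
  have hAB : Measurable fun x => A x * B x := hA.mul hB
  rw [← lintegral_const_mul _ hAB, ← lintegral_const_mul _ hA]
  -- On a slice `A` is constant, and integrating it over `x k` produces the total mass `N` of
  -- `rhoMeasure`; this is the source of the factors `N` on the left.
  refine h.slices k (hAB.const_mul _) (hA.const_mul _) fun x => ?_
  simp_rw [hAk]
  have hBu : Measurable fun y => B (Function.update x k y) := hB.comp (measurable_update x)
  rw [lintegral_const_mul _ (hBu.const_mul _), lintegral_const_mul _ hBu, lintegral_const,
    h.rhoMeasure_univ]
  calc (N : ℝ≥0∞) * (A x * ∫⁻ y, B (Function.update x k y) ∂rhoMeasure Φ)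
      ≤ N * (A x * C) := by gcongr; exact hBC x
    _ = C * A x * N := by ring

theorem GPData.integrate_one_ge (h : GPData V N a Φ D) (k : Fin N) {A B : Config N → ℝ≥0∞}
    (hA : Measurable A) (hB : Measurable B) (hAk : ∀ x y, A (Function.update x k y) = A x)
    {C : ℝ≥0∞} (hBC : ∀ x, C ≤ ∫⁻ y, B (Function.update x k y) ∂rhoMeasure Φ) :
    C * ∫⁻ x, A x ∂configMeasure N Φ ≤ N * ∫⁻ x, A x * B x ∂configMeasure N Φ := by
  have hAB : Measurable fun x => A x * B x := hA.mul hB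
  rw [← lintegral_const_mul _ hAB, ← lintegral_const_mul _ hA]
  refine h.slices k (hA.const_mul _) (hAB.const_mul _) fun x => ?_
  simp_rw [hAk]
  have hBu : Measurable fun y => B (Function.update x k y) := hB.comp (measurable_update x)
  rw [lintegral_const_mul _ (hBu.const_mul _), lintegral_const_mul _ hBu, lintegral_const,
    h.rhoMeasure_univ]
  calc C * A x * N = (N : ℝ≥0∞) * (A x * C) := by ring
    _ ≤ N * (A x * ∫⁻ y, B (Function.update x k y) ∂rhoMeasure Φ) := by gcongr; exact hBC x

theorem measurable_pair {b : E3 → ℝ≥0∞} (hb : Measurable b) (i j : Fin N) :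
    Measurable fun x : Config N => b (x i - x j) :=
  hb.comp ((measurable_pi_apply i).sub (measurable_pi_apply j))

/-- Integrating out a function of the distance to another particle. -/
theorem GPData.integrate_pair (h : GPData V N a Φ D) {k j : Fin N} (hjk : j ≠ k)
    {A : Config N → ℝ≥0∞} (hA : Measurable A) (hAk : ∀ x y, A (Function.update x k y) = A x)
    {b : E3 → ℝ≥0∞} (hb : Measurable b) {C : ℝ≥0∞}
    (hbC : ∀ z, ∫⁻ y, b (y - z) ∂rhoMeasure Φ ≤ C) :
    N * ∫⁻ x, A x * b (x k - x j) ∂configMeasure N Φ ≤ C * ∫⁻ x, A x ∂configMeasure N Φ := by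
  refine h.integrate_one k hA (measurable_pair hb k j) hAk fun x => ?_
  simp only [Function.update_self, Function.update_of_ne hjk]
  exact hbC _

/-- Integrating out a function of the distance of two particles. -/
theorem GPData.integrate_two (h : GPData V N a Φ D) {k j : Fin N} (hjk : j ≠ k)
    {A : Config N → ℝ≥0∞} (hA : Measurable A) (hAk : ∀ x y, A (Function.update x k y) = A x)
    (hAj : ∀ x y, A (Function.update x j y) = A x)
    {b : E3 → ℝ≥0∞} (hb : Measurable b) {C : ℝ≥0∞}
    (hbC : ∫⁻ z, ∫⁻ y, b (y - z) ∂rhoMeasure Φ ∂rhoMeasure Φ ≤ C) :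
    (N : ℝ≥0∞) ^ 2 * ∫⁻ x, A x * b (x k - x j) ∂configMeasure N Φ
      ≤ C * ∫⁻ x, A x ∂configMeasure N Φ := by
  have := h.isFiniteMeasure
  have mh : Measurable fun z => ∫⁻ y, b (y - z) ∂rhoMeasure Φ :=
    Measurable.lintegral_prod_right' (f := fun p : E3 × E3 => b (p.2 - p.1))
      (hb.comp (measurable_snd.sub measurable_fst))
  have mb := measurable_pair (N := N) hb k j
  have mhj : Measurable fun x : Config N => ∫⁻ y, b (y - x j) ∂rhoMeasure Φ :=
    mh.comp (measurable_pi_apply j)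
  have s1 : N * ∫⁻ x, A x * b (x k - x j) ∂configMeasure N Φ
      ≤ ∫⁻ x, A x * (∫⁻ y, b (y - x j) ∂rhoMeasure Φ) ∂configMeasure N Φ := by
    have hAb : Measurable fun x => A x * b (x k - x j) := hA.mul mb
    rw [← lintegral_const_mul _ hAb]
    refine h.slices k (hAb.const_mul _) (hA.mul mhj) fun x => ?_
    simp_rw [hAk]
    simp only [Function.update_self, Function.update_of_ne hjk]
    have hbu : Measurable fun y => b (y - x j) := hb.comp (measurable_id.sub measurable_const)
    rw [lintegral_const_mul _ (hbu.const_mul _), lintegral_const_mul _ hbu, lintegral_const,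
      h.rhoMeasure_univ, mul_comm]
  have s2 : N * ∫⁻ x, A x * (∫⁻ y, b (y - x j) ∂rhoMeasure Φ) ∂configMeasure N Φ
      ≤ C * ∫⁻ x, A x ∂configMeasure N Φ := by
    refine h.integrate_one j hA mhj hAj fun x => ?_
    simpa only [Function.update_self] using hbC
  calc (N : ℝ≥0∞) ^ 2 * ∫⁻ x, A x * b (x k - x j) ∂configMeasure N Φ
      = N * (N * ∫⁻ x, A x * b (x k - x j) ∂configMeasure N Φ) := by ring
    _ ≤ _ := (mul_le_mul_right s1 _).trans s2

theorem lintegral_pair_le {M : ℝ} (mΦ : Measurable Φ) (hM : ∀ᵐ y, Φ y ^ 2 ≤ M)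
    {b : E3 → ℝ≥0∞} (hb : Measurable b) (z : E3) :
    ∫⁻ y, b (y - z) ∂rhoMeasure Φ ≤ ENNReal.ofReal M * ∫⁻ y, b y := by
  have hbu : Measurable fun y => b (y - z) := hb.comp (measurable_id.sub measurable_const)
  rw [lintegral_rhoMeasure mΦ hbu, ← lintegral_sub_right_eq_self b z, ← lintegral_const_mul _ hbu]
  refine lintegral_mono_ae ?_
  filter_upwards [hM] with y hy
  gcongr

/-- Young's inequality `ρ(z) ρ(y) ≤ (ρ(z)² + ρ(y)²)/2` followed by translation invariance. Here the
leading term acquires `∫ Φ⁴` in place of the cruder `N ‖ρ‖_∞`. -/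
theorem GPData.lintegral_pair_pair_le (h : GPData V N a Φ D) {b : E3 → ℝ≥0∞} (hb : Measurable b) :
    ∫⁻ z, ∫⁻ y, b (y - z) ∂rhoMeasure Φ ∂rhoMeasure Φ
      ≤ ENNReal.ofReal (∫ x, Φ x ^ 4) * ∫⁻ y, b y := by
  have := h.isFiniteMeasure
  have mΦ := h.measurable
  have mbp : Measurable fun p : E3 × E3 => b (p.2 - p.1) :=
    hb.comp (measurable_snd.sub measurable_fst)
  have hbu : ∀ z, Measurable fun y => b (y - z) := fun z =>
    hb.comp (measurable_id.sub measurable_const)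
  have mh : Measurable fun z => ∫⁻ y, b (y - z) ∂rhoMeasure Φ :=
    Measurable.lintegral_prod_right' mbp
  rw [lintegral_rhoMeasure mΦ mh]
  have e1 : ∀ z, ENNReal.ofReal (Φ z ^ 2) * ∫⁻ y, b (y - z) ∂rhoMeasure Φ
      = ∫⁻ y, ENNReal.ofReal (Φ z ^ 2 * Φ y ^ 2) * b (y - z) := fun z => by
    rw [lintegral_rhoMeasure mΦ (hbu z), ← lintegral_const_mul _ (by fun_prop)]
    congr 1
    ext y
    rw [ENNReal.ofReal_mul (sq_nonneg _), mul_assoc]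
  simp_rw [e1]
  have e2 : ∀ z y, ENNReal.ofReal (Φ z ^ 2 * Φ y ^ 2) * b (y - z)
      ≤ ENNReal.ofReal (Φ z ^ 4 / 2) * b (y - z) + ENNReal.ofReal (Φ y ^ 4 / 2) * b (y - z) := by
    intro z y
    rw [← add_mul, ← ENNReal.ofReal_add (by positivity) (by positivity)]
    gcongr
    nlinarith [sq_nonneg (Φ z ^ 2 - Φ y ^ 2)]
  have half : ∫⁻ z, ENNReal.ofReal (Φ z ^ 4 / 2) = ENNReal.ofReal ((∫ x, Φ x ^ 4) / 2) := by
    rw [← integral_div, ofReal_integral_eq_lintegral_ofReal (h.int4.div_const _)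
      (Eventually.of_forall fun _ => by positivity)]
  have t1 : ∫⁻ z, ∫⁻ y, ENNReal.ofReal (Φ z ^ 4 / 2) * b (y - z)
      = ENNReal.ofReal ((∫ x, Φ x ^ 4) / 2) * ∫⁻ y, b y := by
    simp_rw [lintegral_const_mul _ (hbu _), lintegral_sub_right_eq_self b]
    rw [lintegral_mul_const _ (by fun_prop), half]
  have t2 : ∫⁻ z, ∫⁻ y, ENNReal.ofReal (Φ y ^ 4 / 2) * b (y - z)
      = ENNReal.ofReal ((∫ x, Φ x ^ 4) / 2) * ∫⁻ y, b y := by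
    rw [lintegral_lintegral_swap (by
      exact (Measurable.mul (by fun_prop) mbp).aemeasurable)]
    have hbu' : ∀ y, Measurable fun z => b (y - z) := fun y =>
      hb.comp (measurable_const.sub measurable_id)
    simp_rw [lintegral_const_mul _ (hbu' _), lintegral_sub_left_eq_self b]
    rw [lintegral_mul_const _ (by fun_prop), half]
  have h4 : 0 ≤ ∫ x, Φ x ^ 4 := integral_nonneg fun _ => by positivity
  calc _ ≤ ∫⁻ z, ∫⁻ y, (ENNReal.ofReal (Φ z ^ 4 / 2) * b (y - z)
          + ENNReal.ofReal (Φ y ^ 4 / 2) * b (y - z)) :=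
        lintegral_mono fun z => lintegral_mono fun y => e2 z y
    _ = (∫⁻ z, ∫⁻ y, ENNReal.ofReal (Φ z ^ 4 / 2) * b (y - z))
          + ∫⁻ z, ∫⁻ y, ENNReal.ofReal (Φ y ^ 4 / 2) * b (y - z) := by
        rw [← lintegral_add_left]
        · congr 1
          ext z
          rw [lintegral_add_left (by fun_prop)]
        · exact Measurable.lintegral_prod_right' (f := fun p : E3 × E3 =>
            ENNReal.ofReal (Φ p.1 ^ 4 / 2) * b (p.2 - p.1)) (Measurable.mul (by fun_prop) mbp)
    _ = _ := by
        rw [t1, t2, ← add_mul, ← ENNReal.ofReal_add (by positivity) (by positivity), add_halves]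

end Density

/-! ### The energy of Jastrow trial functions -/

/-- The integrals of the pair factor that enter the energy of the Jastrow trial function. -/
structure PairBounds (v : ℝ → ℝ≥0∞) (ζ : E3 → ℝ) (I Iv J K : ℝ) : Prop
    extends IsPairFactor ζ where
  I_nonneg : 0 ≤ I
  Iv_nonneg : 0 ≤ Iv
  J_nonneg : 0 ≤ J
  K_nonneg : 0 ≤ K
  grad_sq : ∫⁻ y, ENNReal.ofReal (gradNorm ζ y ^ 2) ≤ ENNReal.ofReal I
  potential : ∫⁻ y, v ‖y‖ * ENNReal.ofReal (ζ y ^ 2) ≤ ENNReal.ofReal Iv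
  defect : ∫⁻ y, ENNReal.ofReal (1 - ζ y ^ 2) ≤ ENNReal.ofReal J
  grad : ∫⁻ y, ENNReal.ofReal (gradNorm ζ y) ≤ ENNReal.ofReal K

section Energy

variable {N : ℕ} {V : E3 → ℝ} {v : ℝ → ℝ≥0∞} {a : ℝ} {Φ : E3 → ℝ} {D : Fin 3 → E3 → ℝ}
  {ζ : E3 → ℝ} {I Iv J K M : ℝ}

/-- The squared norm of the Jastrow function without the particles in `A`. -/
noncomputable def jastrowMass (Φ ζ : E3 → ℝ) (A : Finset (Fin N)) : ℝ≥0∞ :=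
  ∫⁻ x, ENNReal.ofReal (jastrow ζ A x ^ 2) ∂configMeasure N Φ

theorem measurable_jastrow_sq (hζ : IsPairFactor ζ) (A : Finset (Fin N)) :
    Measurable fun x => ENNReal.ofReal (jastrow ζ A x ^ 2) :=
  ((measurable_jastrow hζ A).pow_const 2).ennreal_ofReal

theorem configMeasure_univ (h : GPData V N a Φ D) : configMeasure N Φ univ = (N : ℝ≥0∞) ^ N := by
  have := h.isFiniteMeasure
  rw [configMeasure, Measure.pi_univ]
  simp [h.rhoMeasure_univ]

theorem jastrowMass_lt_top (h : GPData V N a Φ D) (hζ : IsPairFactor ζ) (A : Finset (Fin N)) :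
    jastrowMass Φ ζ A < ⊤ := by
  have h1 : jastrowMass Φ ζ A ≤ ∫⁻ x, 1 ∂configMeasure N Φ := by
    refine lintegral_mono fun x => ?_
    rw [← ENNReal.ofReal_one]
    exact ENNReal.ofReal_le_ofReal (pow_le_one₀ (jastrow_nonneg hζ A x) (jastrow_le_one hζ A x))
  refine h1.trans_lt ?_
  rw [lintegral_one, configMeasure_univ h]
  exact ENNReal.pow_lt_top (ENNReal.natCast_lt_top N)

/-- The union bound leaves a sum over the at most `N` other particles of `1 - ζ²` times a factor
free of `x k`. Integrating out `x k` makes each summand at most `M J / N` times the mass without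
`k`. -/
theorem jastrowMass_insert_le (h : GPData V N a Φ D) (hM : ∀ᵐ y, Φ y ^ 2 ≤ M) (hM0 : 0 ≤ M)
    (hζ : PairBounds v ζ I Iv J K) {A : Finset (Fin N)} {k : Fin N} (hk : k ∉ A) :
    (1 - M * J) * (jastrowMass Φ ζ (insert k A)).toReal ≤ (jastrowMass Φ ζ A).toReal := by
  have hp := hζ.toIsPairFactor
  have mJ := fun A => measurable_jastrow_sq (N := N) hp A
  set b : E3 → ℝ≥0∞ := fun y => ENNReal.ofReal (1 - ζ y ^ 2) with hb
  have mb : Measurable b := ((measurable_const.sub (hp.measurable.pow_const 2))).ennreal_ofReal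
  have n0 : (N : ℝ≥0∞) ≠ 0 := by
    have := k.pos
    exact_mod_cast this.ne'
  have pt : ∀ x, ENNReal.ofReal (jastrow ζ (insert k A) x ^ 2) ≤ ENNReal.ofReal (jastrow ζ A x ^ 2)
      + ∑ j ∈ others A k, ENNReal.ofReal (jastrow ζ (insert k A) x ^ 2) * b (x k - x j) := by
    intro x
    have h1 : ∀ j, 0 ≤ 1 - ζ (x k - x j) ^ 2 := fun j =>
      sub_nonneg.2 (pow_le_one₀ (hp.nonneg _) (hp.le_one _))
    refine (ENNReal.ofReal_le_ofReal (jastrow_insert_sq_le hp hk x)).trans (le_of_eq ?_)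
    rw [ENNReal.ofReal_add (sq_nonneg _) (Finset.sum_nonneg fun j _ =>
      mul_nonneg (sq_nonneg _) (h1 j)), ENNReal.ofReal_sum_of_nonneg fun j _ =>
      mul_nonneg (sq_nonneg _) (h1 j)]
    simp_rw [hb, ENNReal.ofReal_mul (sq_nonneg (jastrow ζ (insert k A) x))]
  have pair : ∀ j ∈ others A k, N * ∫⁻ x, ENNReal.ofReal (jastrow ζ (insert k A) x ^ 2)
      * b (x k - x j) ∂configMeasure N Φ
      ≤ ENNReal.ofReal (M * J) * jastrowMass Φ ζ (insert k A) := by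
    intro j hj
    have hjk : j ≠ k := by
      simp only [others, Finset.mem_filter] at hj
      exact hj.2.1
    refine h.integrate_pair hjk (mJ _) (fun x y => by rw [jastrow_update (by simp)]) mb fun z => ?_
    refine (lintegral_pair_le h.measurable hM mb z).trans ?_
    rw [ENNReal.ofReal_mul hM0]
    gcongr
    exact hζ.defect
  have tot : (N : ℝ≥0∞) * jastrowMass Φ ζ (insert k A) ≤ N * (jastrowMass Φ ζ A
      + ENNReal.ofReal (M * J) * jastrowMass Φ ζ (insert k A)) := by
    have h1 : jastrowMass Φ ζ (insert k A) ≤ jastrowMass Φ ζ A + ∑ j ∈ others A k,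
        ∫⁻ x, ENNReal.ofReal (jastrow ζ (insert k A) x ^ 2) * b (x k - x j) ∂configMeasure N Φ := by
      refine (lintegral_mono pt).trans (le_of_eq ?_)
      rw [lintegral_add_left (mJ _), lintegral_finsetSum]
      · rfl
      · exact fun j _ => (mJ _).mul (measurable_pair mb k j)
    refine (mul_le_mul_right h1 _).trans ?_
    rw [mul_add, mul_add, Finset.mul_sum]
    gcongr
    refine (Finset.sum_le_sum pair).trans ?_
    rw [Finset.sum_const, nsmul_eq_mul]
    gcongr
    exact card_others_le A k
  have tot' := (ENNReal.mul_le_mul_iff_right n0 (ENNReal.natCast_ne_top N)).1 tot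
  have f1 := (jastrowMass_lt_top h hp A).ne
  have f2 := (jastrowMass_lt_top h hp (insert k A)).ne
  have t3 := ENNReal.toReal_mono (ENNReal.add_ne_top.2
    ⟨f1, ENNReal.mul_ne_top ENNReal.ofReal_ne_top f2⟩) tot'
  rw [ENNReal.toReal_add f1 (ENNReal.mul_ne_top ENNReal.ofReal_ne_top f2), ENNReal.toReal_mul,
    ENNReal.toReal_ofReal (mul_nonneg hM0 hζ.J_nonneg)] at t3
  linarith

theorem jastrowMass_le (h : GPData V N a Φ D) (hM : ∀ᵐ y, Φ y ^ 2 ≤ M) (hM0 : 0 ≤ M)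
    (hζ : PairBounds v ζ I Iv J K) (hθ : M * J < 1) (A : Finset (Fin N)) :
    (1 - M * J) ^ A.card * (jastrowMass Φ ζ A).toReal ≤ (jastrowMass Φ ζ (∅ : Finset (Fin N))).toReal := by
  induction A using Finset.induction_on with
  | empty => simp
  | insert k A hk ih =>
    rw [Finset.card_insert_of_notMem hk, pow_succ, mul_assoc]
    exact (mul_le_mul_of_nonneg_left (jastrowMass_insert_le h hM hM0 hζ hk)
      (pow_nonneg (by linarith) _)).trans ih

/-- Deleting all particles leaves the constant function `1`, whose mass is `N ^ N`. -/
theorem jastrowMass_pos (h : GPData V N a Φ D) (hN : 0 < N) (hM : ∀ᵐ y, Φ y ^ 2 ≤ M) (hM0 : 0 ≤ M)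
    (hζ : PairBounds v ζ I Iv J K) (hθ : M * J < 1) :
    0 < (jastrowMass Φ ζ (∅ : Finset (Fin N))).toReal := by
  refine lt_of_lt_of_le ?_ (jastrowMass_le h hM hM0 hζ hθ Finset.univ)
  have e1 : jastrowMass Φ ζ (Finset.univ : Finset (Fin N)) = (N : ℝ≥0∞) ^ N := by
    rw [jastrowMass]
    simp_rw [jastrow_univ]
    simp [configMeasure_univ h]
  rw [e1, ENNReal.toReal_pow, ENNReal.toReal_natCast]
  have : (0 : ℝ) < N := by exact_mod_cast hN
  have : 0 < 1 - M * J := by linarith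
  positivity

/-- If a set of `n` particles can be removed, its mass is bounded. -/
theorem jastrowMass_le_ofReal (h : GPData V N a Φ D) (hM : ∀ᵐ y, Φ y ^ 2 ≤ M) (hM0 : 0 ≤ M)
    (hζ : PairBounds v ζ I Iv J K) (hθ : M * J < 1) {A : Finset (Fin N)} {n : ℕ}
    (hn : A.card = n) : jastrowMass Φ ζ A ≤ ENNReal.ofReal
      ((jastrowMass Φ ζ (∅ : Finset (Fin N))).toReal / (1 - M * J) ^ n) := by
  have := jastrowMass_le h hM hM0 hζ hθ A
  rw [hn] at this
  have hpos : 0 < (1 - M * J) ^ n := pow_pos (by linarith) _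
  rw [← ENNReal.ofReal_toReal (jastrowMass_lt_top h hζ.toIsPairFactor A).ne]
  apply ENNReal.ofReal_le_ofReal
  rw [le_div_iff₀ hpos]
  linarith

theorem le_ofReal_div_of_mul_le {n : ℕ} (hN : 0 < N) {X : ℝ≥0∞} {r : ℝ}
    (hX : (N : ℝ≥0∞) ^ n * X ≤ ENNReal.ofReal r) : X ≤ ENNReal.ofReal (r / (N : ℝ) ^ n) := by
  have hN' : (0 : ℝ) < (N : ℝ) ^ n := by positivity
  rw [ENNReal.ofReal_div_of_pos hN', ENNReal.ofReal_pow (Nat.cast_nonneg _), ENNReal.ofReal_natCast,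
    ENNReal.le_div_iff_mul_le (Or.inl (by simp [hN.ne'])) (Or.inl (by simp)), mul_comm]
  exact hX

/-- There are at most `N²` diagonal terms, each of order `d I / N²`, and at most `N³` mixed ones,
each of order `(M K)² / N²`. The exponents of `1 - M J` are the numbers of particles deleted in the
respective terms. -/
theorem lintegral_gradBound_le (h : GPData V N a Φ D) (hN : 0 < N) (hM : ∀ᵐ y, Φ y ^ 2 ≤ M)
    (hM0 : 0 ≤ M) (hζ : PairBounds v ζ I Iv J K) (hθ : M * J < 1) :
    ∑ k, ∫⁻ x, gradBound ζ k x ∂configMeasure N Φ ≤ ENNReal.ofReal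
      ((jastrowMass Φ ζ (∅ : Finset (Fin N))).toReal * ((∫ x, Φ x ^ 4) * I / (1 - M * J) ^ 2
        + N * (M * K) ^ 2 / (1 - M * J) ^ 3)) := by
  set W := (jastrowMass Φ ζ (∅ : Finset (Fin N))).toReal with hW
  set d := ∫ x, Φ x ^ 4 with hd
  have d0 : 0 ≤ d := integral_nonneg fun _ => by positivity
  have W0 : 0 ≤ W := ENNReal.toReal_nonneg
  have θ0 : 0 < 1 - M * J := by linarith
  have I0 := hζ.I_nonneg
  have K0 := hζ.K_nonneg
  have hN' : (0 : ℝ) < N := by exact_mod_cast hN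
  have hp := hζ.toIsPairFactor
  have mJ := fun A => measurable_jastrow_sq (N := N) hp A
  have mg2 : Measurable fun y => ENNReal.ofReal (gradNorm ζ y ^ 2) :=
    ((measurable_gradNorm ζ).pow_const 2).ennreal_ofReal
  have mg : Measurable fun y => ENNReal.ofReal (gradNorm ζ y) :=
    (measurable_gradNorm ζ).ennreal_ofReal
  have two : ∀ k, ∀ j ∈ others ∅ k, ∫⁻ x, ENNReal.ofReal (jastrow ζ {j, k} x ^ 2)
      * ENNReal.ofReal (gradNorm ζ (x k - x j) ^ 2) ∂configMeasure N Φ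
      ≤ ENNReal.ofReal (d * I * (W / (1 - M * J) ^ 2) / (N : ℝ) ^ 2) := by
    intro k j hj
    have hjk : j ≠ k := by simpa [others] using hj
    apply le_ofReal_div_of_mul_le hN
    refine (h.integrate_two hjk (mJ {j, k}) (fun x y => by rw [jastrow_update (by simp)])
      (fun x y => by rw [jastrow_update (by simp)]) mg2 (h.lintegral_pair_pair_le mg2)).trans ?_
    rw [ENNReal.ofReal_mul (by positivity), ENNReal.ofReal_mul d0]
    gcongr
    · exact hζ.grad_sq
    · exact jastrowMass_le_ofReal h hM hM0 hζ hθ (Finset.card_pair hjk)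
  have hK : ∀ z, ∫⁻ y, ENNReal.ofReal (gradNorm ζ (y - z)) ∂rhoMeasure Φ
      ≤ ENNReal.ofReal (M * K) := fun z => by
    refine (lintegral_pair_le h.measurable hM mg z).trans ?_
    rw [ENNReal.ofReal_mul hM0]
    gcongr
    exact hζ.grad
  have three : ∀ k, ∀ j ∈ others ∅ k, ∀ i ∈ (others ∅ k).erase j,
      ∫⁻ x, ENNReal.ofReal (jastrow ζ {i, j, k} x ^ 2) * ENNReal.ofReal (gradNorm ζ (x j - x k))
        * ENNReal.ofReal (gradNorm ζ (x i - x k)) ∂configMeasure N Φ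
      ≤ ENNReal.ofReal ((M * K) ^ 2 * (W / (1 - M * J) ^ 3) / (N : ℝ) ^ 2) := by
    intro k j hj i hi
    have hjk : j ≠ k := by simpa [others] using hj
    have hij : i ≠ j := Finset.ne_of_mem_erase hi
    have hik : i ≠ k := by simpa [others] using Finset.mem_of_mem_erase hi
    apply le_ofReal_div_of_mul_le hN
    -- The variable `x i` is integrated first with `x k` fixed; the rest of the integrand involves
    -- neither the `i`-th variable nor a Jastrow factor of `j` or `k`, so `x j` can be treated in
    -- the same way afterwards.
    have s1 := h.integrate_pair hik.symm ((mJ {i, j, k}).mul (measurable_pair mg j k))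
      (fun x y => by
        simp only [Pi.mul_apply]
        rw [jastrow_update (by simp), Function.update_of_ne hij.symm,
          Function.update_of_ne hik.symm]) mg hK
    have s2 := h.integrate_pair hjk.symm (mJ {i, j, k})
      (fun x y => by rw [jastrow_update (by simp)]) mg hK
    have s3 : jastrowMass Φ ζ {i, j, k} ≤ ENNReal.ofReal (W / (1 - M * J) ^ 3) :=
      jastrowMass_le_ofReal h hM hM0 hζ hθ (by
        rw [Finset.card_insert_of_notMem (by simp [hij, hik]), Finset.card_pair hjk])
    simp only [Pi.mul_apply] at s1
    rw [ENNReal.ofReal_mul (by positivity), ENNReal.ofReal_pow (by positivity), sq, sq, mul_assoc]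
    calc _ ≤ (N : ℝ≥0∞) * (ENNReal.ofReal (M * K) * ∫⁻ x, ENNReal.ofReal (jastrow ζ {i, j, k} x ^ 2)
            * ENNReal.ofReal (gradNorm ζ (x j - x k)) ∂configMeasure N Φ) :=
          mul_le_mul_right s1 _
      _ = ENNReal.ofReal (M * K) * (N * ∫⁻ x, ENNReal.ofReal (jastrow ζ {i, j, k} x ^ 2)
            * ENNReal.ofReal (gradNorm ζ (x j - x k)) ∂configMeasure N Φ) := by ring
      _ ≤ ENNReal.ofReal (M * K) * (ENNReal.ofReal (M * K) * jastrowMass Φ ζ {i, j, k}) :=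
          mul_le_mul_right s2 _
      _ ≤ _ := by
          rw [← mul_assoc]
          gcongr
  set c2 := d * I * (W / (1 - M * J) ^ 2) / (N : ℝ) ^ 2 with hc2
  set c3 := (M * K) ^ 2 * (W / (1 - M * J) ^ 3) / (N : ℝ) ^ 2 with hc3
  have c20 : 0 ≤ c2 := by positivity
  have c30 : 0 ≤ c3 := by positivity
  have hsum : ∀ (s : Finset (Fin N)) (f : Fin N → ℝ≥0∞) (r : ℝ), 0 ≤ r → s.card ≤ N →
      (∀ i ∈ s, f i ≤ ENNReal.ofReal r) → ∑ i ∈ s, f i ≤ ENNReal.ofReal (N * r) := by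
    intro s f r hr hs hf
    refine (Finset.sum_le_sum hf).trans ?_
    rw [Finset.sum_const, nsmul_eq_mul, ENNReal.ofReal_mul hN'.le, ENNReal.ofReal_natCast]
    gcongr
  have each : ∀ k, ∫⁻ x, gradBound ζ k x ∂configMeasure N Φ
      ≤ ENNReal.ofReal (N * c2 + N * (N * c3)) := by
    intro k
    have m2 : ∀ j : Fin N, Measurable fun x : Config N => ENNReal.ofReal (jastrow ζ {j, k} x ^ 2)
        * ENNReal.ofReal (gradNorm ζ (x k - x j) ^ 2) := fun j =>
      (mJ _).mul (measurable_pair mg2 k j)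
    have m3 : ∀ i j : Fin N, Measurable fun x : Config N =>
        ENNReal.ofReal (jastrow ζ {i, j, k} x ^ 2) * ENNReal.ofReal (gradNorm ζ (x j - x k))
        * ENNReal.ofReal (gradNorm ζ (x i - x k)) := fun i j =>
      ((mJ _).mul (measurable_pair mg j k)).mul (measurable_pair mg i k)
    unfold gradBound
    rw [lintegral_add_left (Finset.measurable_fun_sum _ fun j _ => m2 j),
      lintegral_finsetSum _ (fun j _ => m2 j),
      lintegral_finsetSum _ (fun j _ => Finset.measurable_fun_sum _ fun i _ => m3 i j),
      ENNReal.ofReal_add (by positivity) (by positivity)]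
    refine add_le_add (hsum _ _ _ c20 (card_others_le _ _) (two k))
      (hsum _ _ _ (by positivity) (card_others_le _ _) fun j hj => ?_)
    rw [lintegral_finsetSum _ (fun i _ => m3 i j)]
    exact hsum _ _ _ c30 ((Finset.card_erase_le).trans (card_others_le _ _)) (three k j hj)
  refine (hsum Finset.univ _ _ (by positivity) (by simp) fun k _ => each k).trans (le_of_eq ?_)
  congr 1
  rw [hc2, hc3]
  field_simp

/-- Same mechanism as for the diagonal gradient terms. The interaction is summed over `i < j` only,
which produces `Iv / 2`. -/
theorem lintegral_pairPotential_le (h : GPData V N a Φ D) (hN : 0 < N) (hM : ∀ᵐ y, Φ y ^ 2 ≤ M)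
    (hM0 : 0 ≤ M) (hv : Measurable v) (hζ : PairBounds v ζ I Iv J K) (hθ : M * J < 1) :
    ∫⁻ x, pairPotential v x * ENNReal.ofReal (jastrow ζ ∅ x ^ 2) ∂configMeasure N Φ
      ≤ ENNReal.ofReal ((jastrowMass Φ ζ (∅ : Finset (Fin N))).toReal *
        ((∫ x, Φ x ^ 4) * (Iv / 2) / (1 - M * J) ^ 2)) := by
  set W := (jastrowMass Φ ζ (∅ : Finset (Fin N))).toReal with hW
  set d := ∫ x, Φ x ^ 4 with hd
  have d0 : 0 ≤ d := integral_nonneg fun _ => by positivity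
  have W0 : 0 ≤ W := ENNReal.toReal_nonneg
  have θ0 : 0 < 1 - M * J := by linarith
  have I0 := hζ.Iv_nonneg
  have hN' : (0 : ℝ) < N := by exact_mod_cast hN
  have hp := hζ.toIsPairFactor
  have mJ := fun A => measurable_jastrow_sq (N := N) hp A
  set b : E3 → ℝ≥0∞ := fun y => v ‖y‖ * ENNReal.ofReal (ζ y ^ 2) with hb
  have mb : Measurable b :=
    (hv.comp measurable_norm).mul (hp.measurable.pow_const 2).ennreal_ofReal
  set c := d * Iv * (W / (1 - M * J) ^ 2) / (N : ℝ) ^ 2 with hc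
  have c0 : 0 ≤ c := by positivity
  have two : ∀ i j, i ≠ j → ∫⁻ x, ENNReal.ofReal (jastrow ζ {j, i} x ^ 2) * b (x i - x j)
      ∂configMeasure N Φ ≤ ENNReal.ofReal c := by
    intro i j hij
    apply le_ofReal_div_of_mul_le hN
    refine (h.integrate_two hij.symm (mJ {j, i}) (fun x y => by rw [jastrow_update (by simp)])
      (fun x y => by rw [jastrow_update (by simp)]) mb (h.lintegral_pair_pair_le mb)).trans ?_
    rw [ENNReal.ofReal_mul (by positivity), ENNReal.ofReal_mul d0]
    gcongr
    · exact hζ.potential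
    · exact jastrowMass_le_ofReal h hM hM0 hζ hθ (Finset.card_pair hij.symm)
  have pt : ∀ x : Config N, pairPotential v x * ENNReal.ofReal (jastrow ζ ∅ x ^ 2)
      ≤ ∑ i, ∑ j, if i < j then ENNReal.ofReal (jastrow ζ {j, i} x ^ 2) * b (x i - x j) else 0 := by
    intro x
    rw [pairPotential, Finset.sum_mul]
    refine Finset.sum_le_sum fun i _ => ?_
    rw [Finset.sum_mul]
    refine Finset.sum_le_sum fun j _ => ?_
    split_ifs with hij
    · have h1 := pow_le_pow_left₀ (jastrow_nonneg hp ∅ x) (jastrow_le_insert_mul hp hij.ne x) 2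
      rw [mul_pow] at h1
      calc v ‖x i - x j‖ * ENNReal.ofReal (jastrow ζ ∅ x ^ 2)
          ≤ v ‖x i - x j‖ * ENNReal.ofReal (jastrow ζ {j, i} x ^ 2 * ζ (x i - x j) ^ 2) := by
            gcongr
        _ = _ := by
            rw [ENNReal.ofReal_mul (sq_nonneg _), hb]
            ring
    · simp
  have mterm : ∀ i j : Fin N, Measurable fun x : Config N =>
      if i < j then ENNReal.ofReal (jastrow ζ {j, i} x ^ 2) * b (x i - x j) else 0 := by
    intro i j
    split_ifs
    · exact (mJ _).mul (measurable_pair mb i j)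
    · exact measurable_const
  have tot : ∫⁻ x, pairPotential v x * ENNReal.ofReal (jastrow ζ ∅ x ^ 2) ∂configMeasure N Φ
      ≤ ∑ i : Fin N, ∑ j : Fin N, ENNReal.ofReal (if i < j then c else 0) := by
    refine (lintegral_mono pt).trans ?_
    rw [lintegral_finsetSum _ fun i _ => Finset.measurable_fun_sum _ fun j _ => mterm i j]
    refine Finset.sum_le_sum fun i _ => ?_
    rw [lintegral_finsetSum _ fun j _ => mterm i j]
    refine Finset.sum_le_sum fun j _ => ?_
    split_ifs with hij
    · exact two i j hij.ne
    · simp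
  refine tot.trans ?_
  have nn : ∀ i j : Fin N, 0 ≤ if i < j then c else 0 := fun i j => by split_ifs <;> simp [c0]
  have e1 : ∑ i : Fin N, ∑ j : Fin N, ENNReal.ofReal (if i < j then c else 0)
      = ENNReal.ofReal (∑ i : Fin N, ∑ j : Fin N, if i < j then c else 0) := by
    rw [ENNReal.ofReal_sum_of_nonneg fun i _ => Finset.sum_nonneg fun j _ => nn i j]
    refine Finset.sum_congr rfl fun i _ => ?_
    rw [ENNReal.ofReal_sum_of_nonneg fun j _ => nn i j]
  rw [e1]
  apply ENNReal.ofReal_le_ofReal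
  set S := ∑ i : Fin N, ∑ j : Fin N, if i < j then c else 0 with hS
  -- Adding the transposed sum covers each off-diagonal pair once, so that `2 S` is at most the full
  -- double sum.
  have hcount : S + S ≤ (N : ℝ) ^ 2 * c := by
    have h2 : S = ∑ i : Fin N, ∑ j : Fin N, if j < i then c else 0 := by
      rw [hS, Finset.sum_comm]
    have h3 : S + S = ∑ i : Fin N, ∑ j : Fin N,
        ((if i < j then c else 0) + if j < i then c else 0) := by
      simp_rw [Finset.sum_add_distrib]
      rw [← h2]
    rw [h3]
    have h4 : ∑ i : Fin N, ∑ j : Fin N, c = (N : ℝ) ^ 2 * c := by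
      simp [sq, mul_assoc]
    rw [← h4]
    refine Finset.sum_le_sum fun i _ => Finset.sum_le_sum fun j _ => ?_
    rcases lt_trichotomy i j with h | h | h
    · simp [h, h.not_gt]
    · subst h; simp [c0]
    · simp [h, h.not_gt]
  have h5 : (N : ℝ) ^ 2 * c = W * (d * Iv / (1 - M * J) ^ 2) := by
    rw [hc]
    field_simp
  have h6 : W * (d * (Iv / 2) / (1 - M * J) ^ 2) = W * (d * Iv / (1 - M * J) ^ 2) / 2 := by ring
  rw [h6, ← h5]
  linarith

/-- The density enters the energy with a negative sign and therefore needs a lower bound. Without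
the pair factors of `k` the integral would be `d / N` times the mass without `k`; the union bound,
now weighted with `Φ (x k) ^ 2 ≤ M`, controls the loss by `M · M J`. -/
theorem lintegral_density_ge (h : GPData V N a Φ D) (hN : 0 < N) (hM : ∀ᵐ y, Φ y ^ 2 ≤ M)
    (hM0 : 0 ≤ M) (hζ : PairBounds v ζ I Iv J K) (k : Fin N) :
    ((∫ x, Φ x ^ 4) - N * (M * (M * J))) / N * (jastrowMass Φ ζ (∅ : Finset (Fin N))).toReal
      ≤ (∫⁻ x, ENNReal.ofReal (Φ (x k) ^ 2) * ENNReal.ofReal (jastrow ζ ∅ x ^ 2)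
        ∂configMeasure N Φ).toReal := by
  set W := (jastrowMass Φ ζ (∅ : Finset (Fin N))).toReal with hW
  set d := ∫ x, Φ x ^ 4 with hd
  have d0 : 0 ≤ d := integral_nonneg fun _ => by positivity
  have hp := hζ.toIsPairFactor
  have mΦ := h.measurable
  have mJ := fun A => measurable_jastrow_sq (N := N) hp A
  have hN' : (0 : ℝ) < N := by exact_mod_cast hN
  have hk : k ∉ (∅ : Finset (Fin N)) := Finset.notMem_empty k
  set A : Config N → ℝ≥0∞ := fun x => ENNReal.ofReal (jastrow ζ (insert k ∅) x ^ 2) with hA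
  have mA : Measurable A := mJ _
  have Ak : ∀ x y, A (Function.update x k y) = A x := fun x y => by
    simp only [hA]; rw [jastrow_update (by simp)]
  set w : Config N → ℝ≥0∞ := fun x => ENNReal.ofReal (Φ (x k) ^ 2) with hw
  have mw : Measurable w := ((mΦ.comp (measurable_pi_apply k)).pow_const 2).ennreal_ofReal
  set b : E3 → ℝ≥0∞ := fun y => ENNReal.ofReal (1 - ζ y ^ 2) with hb
  have mb : Measurable b := ((measurable_const.sub (hp.measurable.pow_const 2))).ennreal_ofReal
  set R := ∫⁻ x, w x * ENNReal.ofReal (jastrow ζ ∅ x ^ 2) ∂configMeasure N Φ with hR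
  have pt : ∀ x, A x * w x ≤ w x * ENNReal.ofReal (jastrow ζ ∅ x ^ 2)
      + ∑ j ∈ others ∅ k, A x * (w x * b (x k - x j)) := by
    intro x
    have h1 : ∀ j, 0 ≤ 1 - ζ (x k - x j) ^ 2 := fun j =>
      sub_nonneg.2 (pow_le_one₀ (hp.nonneg _) (hp.le_one _))
    have h2 := ENNReal.ofReal_le_ofReal (jastrow_insert_sq_le hp hk x)
    rw [ENNReal.ofReal_add (sq_nonneg _) (Finset.sum_nonneg fun j _ =>
      mul_nonneg (sq_nonneg _) (h1 j)), ENNReal.ofReal_sum_of_nonneg fun j _ =>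
      mul_nonneg (sq_nonneg _) (h1 j)] at h2
    simp_rw [ENNReal.ofReal_mul (sq_nonneg (jastrow ζ (insert k ∅) x))] at h2
    have h3 := mul_le_mul_right h2 (w x)
    rw [mul_comm (A x)]
    refine h3.trans (le_of_eq ?_)
    rw [mul_add, Finset.mul_sum]
    congr 1
    refine Finset.sum_congr rfl fun j _ => ?_
    simp only [hA, hb]
    ring
  have low : ENNReal.ofReal d * jastrowMass Φ ζ (insert k ∅)
      ≤ N * ∫⁻ x, A x * w x ∂configMeasure N Φ := by
    refine h.integrate_one_ge k mA mw Ak fun x => ?_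
    simp only [hw, Function.update_self]
    rw [lintegral_rhoMeasure mΦ (by fun_prop), hd, ofReal_integral_eq_lintegral_ofReal h.int4
      (Eventually.of_forall fun _ => by positivity)]
    refine lintegral_mono fun y => ?_
    rw [← ENNReal.ofReal_mul (sq_nonneg _)]
    apply ENNReal.ofReal_le_ofReal
    apply le_of_eq
    ring
  have up : ∀ j ∈ others ∅ k, N * ∫⁻ x, A x * (w x * b (x k - x j)) ∂configMeasure N Φ
      ≤ ENNReal.ofReal (M * (M * J)) * jastrowMass Φ ζ (insert k ∅) := by
    intro j hj
    have hjk : j ≠ k := by simpa [others] using hj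
    refine h.integrate_one k mA (mw.mul (measurable_pair mb k j)) Ak fun x => ?_
    simp only [hw, Pi.mul_apply, Function.update_self, Function.update_of_ne hjk]
    have mbj : Measurable fun y => b (y - x j) := mb.comp (measurable_id.sub measurable_const)
    have ac : rhoMeasure Φ ≪ volume := withDensity_absolutelyContinuous _ _
    calc ∫⁻ y, ENNReal.ofReal (Φ y ^ 2) * b (y - x j) ∂rhoMeasure Φ
        ≤ ∫⁻ y, ENNReal.ofReal M * b (y - x j) ∂rhoMeasure Φ := by
          refine lintegral_mono_ae (ac.ae_le ?_)
          filter_upwards [hM] with y hy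
          gcongr
      _ = ENNReal.ofReal M * ∫⁻ y, b (y - x j) ∂rhoMeasure Φ := lintegral_const_mul _ mbj
      _ ≤ ENNReal.ofReal M * (ENNReal.ofReal M * ENNReal.ofReal J) := by
          gcongr
          refine (lintegral_pair_le mΦ hM mb _).trans ?_
          gcongr
          exact hζ.defect
      _ = _ := by rw [← ENNReal.ofReal_mul hM0, ← ENNReal.ofReal_mul hM0]
  have tot : ENNReal.ofReal d * jastrowMass Φ ζ (insert k ∅)
      ≤ N * R + N * (ENNReal.ofReal (M * (M * J)) * jastrowMass Φ ζ (insert k ∅)) := by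
    refine low.trans ?_
    have h1 : ∫⁻ x, A x * w x ∂configMeasure N Φ ≤ R + ∑ j ∈ others ∅ k,
        ∫⁻ x, A x * (w x * b (x k - x j)) ∂configMeasure N Φ := by
      have mwJ : Measurable fun x => w x * ENNReal.ofReal (jastrow ζ ∅ x ^ 2) := mw.mul (mJ _)
      refine (lintegral_mono pt).trans (le_of_eq ?_)
      rw [lintegral_add_left mwJ, lintegral_finsetSum]
      exact fun j _ => mA.mul (mw.mul (measurable_pair mb k j))
    refine (mul_le_mul_right h1 _).trans ?_
    rw [mul_add, Finset.mul_sum]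
    gcongr
    refine (Finset.sum_le_sum up).trans ?_
    rw [Finset.sum_const, nsmul_eq_mul]
    gcongr
    exact card_others_le ∅ k
  have fz := (jastrowMass_lt_top h hp (insert k (∅ : Finset (Fin N)))).ne
  have fR : R ≠ ⊤ := by
    have h1 : R ≤ ∫⁻ x, 1 * w x ∂configMeasure N Φ := by
      refine lintegral_mono fun x => ?_
      rw [mul_comm]
      gcongr
      rw [← ENNReal.ofReal_one]
      exact ENNReal.ofReal_le_ofReal (pow_le_one₀ (jastrow_nonneg hp _ x) (jastrow_le_one hp _ x))
    have h2 : N * ∫⁻ x, 1 * w x ∂configMeasure N Φ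
        ≤ ENNReal.ofReal d * ∫⁻ x, 1 ∂configMeasure N Φ := by
      refine h.integrate_one k measurable_const mw (fun _ _ => rfl) fun x => ?_
      simp only [hw, Function.update_self]
      rw [lintegral_rhoMeasure mΦ (by fun_prop), hd, ofReal_integral_eq_lintegral_ofReal h.int4
        (Eventually.of_forall fun _ => by positivity)]
      refine lintegral_mono fun y => ?_
      rw [← ENNReal.ofReal_mul (sq_nonneg _)]
      apply ENNReal.ofReal_le_ofReal
      apply le_of_eq
      ring
    intro hR
    rw [hR, top_le_iff] at h1
    rw [h1, ENNReal.mul_top (by exact_mod_cast hN.ne'), top_le_iff, lintegral_one,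
      configMeasure_univ h] at h2
    exact ENNReal.mul_ne_top ENNReal.ofReal_ne_top
      (ENNReal.pow_ne_top (ENNReal.natCast_ne_top N)) h2
  have t3 := ENNReal.toReal_mono (ENNReal.add_ne_top.2
    ⟨ENNReal.mul_ne_top (ENNReal.natCast_ne_top N) fR, ENNReal.mul_ne_top (ENNReal.natCast_ne_top N)
      (ENNReal.mul_ne_top ENNReal.ofReal_ne_top fz)⟩) tot
  rw [ENNReal.toReal_add (ENNReal.mul_ne_top (ENNReal.natCast_ne_top N) fR)
    (ENNReal.mul_ne_top (ENNReal.natCast_ne_top N) (ENNReal.mul_ne_top ENNReal.ofReal_ne_top fz)),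
    ENNReal.toReal_mul, ENNReal.toReal_mul, ENNReal.toReal_mul, ENNReal.toReal_mul,
    ENNReal.toReal_ofReal d0, ENNReal.toReal_natCast, ENNReal.toReal_ofReal
      (mul_nonneg hM0 (mul_nonneg hM0 hζ.J_nonneg))] at t3
  have mono : W ≤ (jastrowMass Φ ζ (insert k (∅ : Finset (Fin N)))).toReal := by
    refine ENNReal.toReal_mono fz (lintegral_mono fun x => ?_)
    exact ENNReal.ofReal_le_ofReal (jastrow_sq_le_insert hp ∅ k x)
  have W0 : 0 ≤ W := ENNReal.toReal_nonneg
  have R0 : 0 ≤ R.toReal := ENNReal.toReal_nonneg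
  rw [div_mul_eq_mul_div, div_le_iff₀ hN']
  -- For a nonnegative coefficient the mass without `k` may be replaced by the smaller `W`; for a
  -- negative one the left side is not positive.
  rcases le_total 0 (d - N * (M * (M * J))) with hs | hs
  · have := mul_le_mul_of_nonneg_left mono hs
    nlinarith
  · have := mul_nonneg R0 hN'.le
    nlinarith

end Energy

/-! ### The energy bound for a general pair factor -/

theorem totalMu_nonneg {V : E3 → ℝ} {a : ℝ} {Φ : E3 → ℝ} {D : Fin 3 → E3 → ℝ} (hV : IsTrap V)
    (ha : 0 ≤ a) : 0 ≤ totalMu V a Φ D := by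
  have := quadEnergy_nonneg hV (Φ := Φ) (D := D)
  have : 0 ≤ ∫ x, Φ x ^ 4 := integral_nonneg fun x => by positivity
  unfold totalMu
  positivity

/-- The upper bound for the ground state energy in terms of the integrals of the pair factor. -/
theorem qmEnergy_le_of_pairBounds {N : ℕ} {V : E3 → ℝ} {v : ℝ → ℝ≥0∞} {a : ℝ} {Φ : E3 → ℝ}
    {D : Fin 3 → E3 → ℝ} {ζ : E3 → ℝ} {I Iv J K M : ℝ} (hV : IsTrap V) (hN : 0 < N) (ha : 0 ≤ a)
    (h : GPData V N a Φ D) (hv : Measurable v) (hM : ∀ᵐ y, Φ y ^ 2 ≤ M) (hM0 : 0 ≤ M)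
    (hζ : PairBounds v ζ I Iv J K) (hθ : M * J < 1) :
    qmEnergy N V v ≤ ENNReal.ofReal (totalMu V a Φ D
      - 8 * Real.pi * a * ((∫ x, Φ x ^ 4) - N * (M * (M * J)))
      + (∫ x, Φ x ^ 4) * (I + Iv / 2) / (1 - M * J) ^ 2
      + N * (M * K) ^ 2 / (1 - M * J) ^ 3) := by
  have hp := hζ.toIsPairFactor
  obtain ⟨C, hC⟩ := exists_lipschitz_jastrow hp (∅ : Finset (Fin N))
  have mJ := measurable_jastrow_sq (N := N) hp ∅
  have mΦ := h.measurable
  have hB := jastrow_abs_le_one (N := N) hp ∅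
  have hN' : (0 : ℝ) < N := by exact_mod_cast hN
  set W := (jastrowMass Φ ζ (∅ : Finset (Fin N))).toReal with hW
  set d := ∫ x, Φ x ^ 4 with hd
  have d0 : 0 ≤ d := integral_nonneg fun _ => by positivity
  have Wpos : 0 < W := jastrowMass_pos h hN hM hM0 hζ hθ
  have eW : jastrowMass Φ ζ (∅ : Finset (Fin N)) = ENNReal.ofReal W :=
    (ENNReal.ofReal_toReal (jastrowMass_lt_top h hp _).ne).symm
  have sq_mul : ∀ x : Config N, ENNReal.ofReal ((jastrow ζ ∅ x * tensor (fun _ => Φ) x) ^ 2)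
      = ENNReal.ofReal (jastrow ζ ∅ x ^ 2) * ENNReal.ofReal (tensor (fun _ => Φ) x ^ 2) := fun x => by
    rw [mul_pow, ENNReal.ofReal_mul (sq_nonneg _)]
  have eZ : ∫⁻ x : Config N, ENNReal.ofReal ((jastrow ζ ∅ x * tensor (fun _ => Φ) x) ^ 2)
      = ENNReal.ofReal W := by
    simp_rw [sq_mul]
    rw [h.lintegral_config mJ]
    exact eW
  have key1 := h.qmEnergy_mul_le (V := V) (v := v) hC hB (jastrow_symm hp) (by
    rw [eZ]; simpa using Wpos)
  have key2 := h.trial_energy_le hV hN ha hv hC hB (measurable_gradBound hp) (gradBound_spec hp)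
  rw [eZ] at key1 key2
  have mw : ∀ k : Fin N, Measurable fun x : Config N => ENNReal.ofReal (Φ (x k) ^ 2) := fun k =>
    ((mΦ.comp (measurable_pi_apply k)).pow_const 2).ennreal_ofReal
  have mpp : Measurable (pairPotential v : Config N → ℝ≥0∞) := measurable_pairPotential hv
  have e1 : ∀ k : Fin N, ∫⁻ x, ENNReal.ofReal (8 * Real.pi * a * Φ (x k) ^ 2
          * (jastrow ζ ∅ x * tensor (fun _ => Φ) x) ^ 2)
      = ENNReal.ofReal (8 * Real.pi * a) * ∫⁻ x, ENNReal.ofReal (Φ (x k) ^ 2)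
        * ENNReal.ofReal (jastrow ζ ∅ x ^ 2) ∂configMeasure N Φ := by
    intro k
    have mk : Measurable fun x : Config N => ENNReal.ofReal (Φ (x k) ^ 2)
        * ENNReal.ofReal (jastrow ζ ∅ x ^ 2) := (mw k).mul mJ
    rw [← h.lintegral_config mk, ← lintegral_const_mul' _ _ ENNReal.ofReal_ne_top]
    congr 1
    ext x
    rw [ENNReal.ofReal_mul (by positivity), ENNReal.ofReal_mul (by positivity), sq_mul]
    ring
  have e2 : ∀ k : Fin N, ∫⁻ x, gradBound ζ k x * ENNReal.ofReal (tensor (fun _ => Φ) x ^ 2)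
      = ∫⁻ x, gradBound ζ k x ∂configMeasure N Φ := fun k =>
    h.lintegral_config (measurable_gradBound hp k)
  have e3 : ∫⁻ x : Config N, pairPotential v x
        * ENNReal.ofReal ((jastrow ζ ∅ x * tensor (fun _ => Φ) x) ^ 2)
      = ∫⁻ x, pairPotential v x * ENNReal.ofReal (jastrow ζ ∅ x ^ 2) ∂configMeasure N Φ := by
    have mk : Measurable fun x : Config N => pairPotential v x
        * ENNReal.ofReal (jastrow ζ ∅ x ^ 2) := mpp.mul mJ
    rw [← h.lintegral_config mk]
    simp_rw [sq_mul, mul_assoc]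
  simp_rw [e1, e2] at key2
  rw [e3] at key2
  have low : ENNReal.ofReal (8 * Real.pi * a * ((d - N * (M * (M * J))) * W))
      ≤ ∑ k : Fin N, ENNReal.ofReal (8 * Real.pi * a) * ∫⁻ x, ENNReal.ofReal (Φ (x k) ^ 2)
        * ENNReal.ofReal (jastrow ζ ∅ x ^ 2) ∂configMeasure N Φ := by
    have h1 : ∀ k : Fin N, ENNReal.ofReal ((d - N * (M * (M * J))) / N * W)
        ≤ ∫⁻ x, ENNReal.ofReal (Φ (x k) ^ 2)
          * ENNReal.ofReal (jastrow ζ ∅ x ^ 2) ∂configMeasure N Φ := fun k =>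
      ENNReal.ofReal_le_of_le_toReal (lintegral_density_ge h hN hM hM0 hζ k)
    calc _ = ∑ k : Fin N, ENNReal.ofReal (8 * Real.pi * a)
          * ENNReal.ofReal ((d - N * (M * (M * J))) / N * W) := by
          rw [Finset.sum_const, Finset.card_univ, Fintype.card_fin, nsmul_eq_mul,
            ← ENNReal.ofReal_mul (by positivity), ← ENNReal.ofReal_natCast,
            ← ENNReal.ofReal_mul hN'.le]
          congr 1
          field_simp
      _ ≤ _ := Finset.sum_le_sum fun k _ => mul_le_mul_right (h1 k) _
  have up1 := lintegral_gradBound_le h hN hM hM0 hζ hθ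
  have up2 := lintegral_pairPotential_le h hN hM hM0 hv hζ hθ
  set X := W * (d * I / (1 - M * J) ^ 2 + N * (M * K) ^ 2 / (1 - M * J) ^ 3) with hX
  set Y := W * (d * (Iv / 2) / (1 - M * J) ^ 2) with hY
  have θ0 : 0 < 1 - M * J := by linarith
  have X0 : 0 ≤ X := by have := hζ.I_nonneg; positivity
  have Y0 : 0 ≤ Y := by have := hζ.Iv_nonneg; positivity
  have μ0 := totalMu_nonneg (Φ := Φ) (D := D) hV ha
  have key3 : qmEnergy N V v * ENNReal.ofReal W
      + ENNReal.ofReal (8 * Real.pi * a * ((d - N * (M * (M * J))) * W))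
      ≤ ENNReal.ofReal (totalMu V a Φ D * W + X + Y) := by
    refine (add_le_add key1 low).trans (key2.trans ?_)
    rw [ENNReal.ofReal_add (by positivity) Y0, ENNReal.ofReal_add (by positivity) X0,
      ENNReal.ofReal_mul μ0]
    exact add_le_add (add_le_add le_rfl up1) up2
  -- The density term goes to the right side. Subtraction under `ENNReal.ofReal` requires the
  -- subtrahend to be nonnegative; if it is not, dropping it on the left is already enough.
  have key4 : qmEnergy N V v * ENNReal.ofReal W ≤ ENNReal.ofReal (totalMu V a Φ D * W + X + Y
      - 8 * Real.pi * a * ((d - N * (M * (M * J))) * W)) := by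
    rcases le_total 0 (8 * Real.pi * a * ((d - N * (M * (M * J))) * W)) with hs | hs
    · rw [ENNReal.ofReal_sub _ hs]
      exact ENNReal.le_sub_of_add_le_right ENNReal.ofReal_ne_top key3
    · refine (le_add_right le_rfl).trans (key3.trans (ENNReal.ofReal_le_ofReal ?_))
      linarith
  have e5 : totalMu V a Φ D * W + X + Y - 8 * Real.pi * a * ((d - N * (M * (M * J))) * W)
      = (totalMu V a Φ D - 8 * Real.pi * a * (d - N * (M * (M * J)))
      + d * (I + Iv / 2) / (1 - M * J) ^ 2 + N * (M * K) ^ 2 / (1 - M * J) ^ 3) * W := by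
    rw [hX, hY]; ring
  rw [e5, ENNReal.ofReal_mul' Wpos.le] at key4
  exact (ENNReal.mul_le_mul_iff_left (by simpa using Wpos) ENNReal.ofReal_ne_top).1 key4

/-! ### Polar coordinates -/

theorem lintegral_fun_norm {g : ℝ → ℝ≥0∞} (hg : Measurable g) :
    ∫⁻ x : E3, g ‖x‖ = ENNReal.ofReal (4 * Real.pi)
      * ∫⁻ r in Ioi (0 : ℝ), ENNReal.ofReal (r ^ 2) * g r := by
  have hdim : Module.finrank ℝ E3 = 3 := by simp
  have mp := (volume : Measure E3).measurePreserving_homeomorphUnitSphereProd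
  have hg' : Measurable fun r : Ioi (0 : ℝ) => g r := hg.comp measurable_subtype_coe
  calc ∫⁻ x : E3, g ‖x‖
      = ∫⁻ x in ({0}ᶜ : Set E3), g ‖x‖ := by rw [restrict_compl_singleton]
    _ = ∫⁻ x : ({(0)}ᶜ : Set E3), g ‖x.1‖ ∂(volume.comap Subtype.val) :=
        (lintegral_subtype_comap (measurableSet_singleton _).compl fun x : E3 => g ‖x‖).symm
    _ = ∫⁻ p, g p.2 ∂((volume : Measure E3).toSphere.prod
          (.volumeIoiPow (Module.finrank ℝ E3 - 1))) := by
        simpa using mp.lintegral_comp_emb (Homeomorph.measurableEmbedding _)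
          (fun p => g p.2)
    _ = (volume : Measure E3).toSphere univ
          * ∫⁻ r, g r ∂(.volumeIoiPow (Module.finrank ℝ E3 - 1) : Measure (Ioi (0 : ℝ))) := by
        have hm : Measurable fun p : Metric.sphere (0 : E3) 1 × Ioi (0 : ℝ) => g p.2 :=
          hg'.comp measurable_snd
        rw [lintegral_prod _ hm.aemeasurable]
        simp [mul_comm]
    _ = _ := by
        -- The area of the unit sphere is the dimension `3` times the volume `4π/3` of the unit
        -- ball.
        rw [Measure.toSphere_apply_univ, hdim, EuclideanSpace.volume_ball_fin_three]
        congr 1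
        · rw [← ENNReal.ofReal_natCast, ← ENNReal.ofReal_pow (by norm_num),
            ← ENNReal.ofReal_mul (by norm_num), ← ENNReal.ofReal_mul (by norm_num)]
          congr 1
          push_cast
          ring
        · rw [Measure.volumeIoiPow, lintegral_withDensity_eq_lintegral_mul _ (by fun_prop) hg',
            ← lintegral_subtype_comap measurableSet_Ioi]
          rfl

/-! ### The scattering solution -/

section Scattering

variable {v : ℝ → ℝ≥0∞} {R a : ℝ} {u u' : ℝ → ℝ}

theorem IsScatteringSolution.intervalIntegrable (h : IsScatteringSolution v R u u')
    (hv : Measurable v) {p q : ℝ} (hp : R < p) (hpq : p ≤ q) {g : ℝ → ℝ}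
    (hg : ContinuousOn g (Icc p q)) :
    IntervalIntegrable (fun r => (v r).toReal * g r) volume p q := by
  rcases hpq.eq_or_lt with rfl | hpq'
  · simp
  have h1 : IntegrableOn (fun r => (v r).toReal) (Ioo p q) volume :=
    integrable_toReal_of_lintegral_ne_top hv.aemeasurable (h.locallyIntegrable p q hp hpq').ne
  have h2 : IntervalIntegrable (fun r => (v r).toReal) volume p q :=
    (intervalIntegrable_iff_integrableOn_Ioo_of_le hpq).2 h1
  exact h2.mul_continuousOn (by rwa [uIcc_of_le hpq])

theorem IsScatteringSolution.continuousOn_u (h : IsScatteringSolution v R u u') {p q : ℝ}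
    (hp : R < p) : ContinuousOn u (Icc p q) := fun r hr =>
  (h.hasDerivAt r (hp.trans_le hr.1)).continuousAt.continuousWithinAt

theorem IsScatteringSolution.integrable_source (h : IsScatteringSolution v R u u')
    (hv : Measurable v) {p q : ℝ} (hp : R < p) (hpq : p ≤ q) :
    IntervalIntegrable (fun r => (1 / 2) * (v r).toReal * u r) volume p q := by
  have := (h.intervalIntegrable hv hp hpq (h.continuousOn_u hp)).const_mul (1 / 2)
  simpa only [mul_assoc] using this

/-- Convexity of `u` outside the core, from `u'' = v u / 2 ≥ 0`. All pointwise bounds on `u` below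
derive from it. -/
theorem IsScatteringSolution.monotone (h : IsScatteringSolution v R u u') {s t : ℝ} (hs : R < s)
    (hst : s ≤ t) : u' s ≤ u' t := by
  have h1 := h.equation s t hs hst
  have h2 : 0 ≤ ∫ r in s..t, (1 / 2) * (v r).toReal * u r := by
    refine intervalIntegral.integral_nonneg hst fun r hr => ?_
    have := (h.pos r (hs.trans_le hr.1)).le
    have : 0 ≤ (v r).toReal := ENNReal.toReal_nonneg
    positivity
  linarith

theorem IsScatteringSolution.continuousOn_deriv (h : IsScatteringSolution v R u u')
    (hv : Measurable v) {p q : ℝ} (hp : R < p) (hpq : p ≤ q) : ContinuousOn u' (Icc p q) := by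
  have h1 := ((h.integrable_source hv hp hpq).absolutelyContinuousOnInterval_intervalIntegral
    (c := p) (by simp)).continuousOn
  rw [uIcc_of_le hpq] at h1
  refine (h1.const_add (u' p)).congr fun r hr => ?_
  have := h.equation p r hp hr.1
  linarith

/-- As `v` is merely integrable, `u'` is only absolutely continuous. The integration by parts is
performed for the primitive `H` of the source term, which equals `u' - u' p`. -/
theorem IsScatteringSolution.integral_by_parts (h : IsScatteringSolution v R u u')
    (hv : Measurable v) {p q : ℝ} (hp : R < p) (hpq : p ≤ q) {g g' : ℝ → ℝ}
    (hg : ∀ r ∈ Icc p q, HasDerivAt g (g' r) r) (hg' : ContinuousOn g' (Icc p q)) :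
    ∫ r in p..q, g r * ((1 / 2) * (v r).toReal * u r)
      = g q * u' q - g p * u' p - ∫ r in p..q, g' r * u' r := by
  set H : ℝ → ℝ := fun r => ∫ t in p..r, (1 / 2) * (v t).toReal * u t with hH
  have hint := h.integrable_source hv hp hpq
  have acH : AbsolutelyContinuousOnInterval H p q :=
    hint.absolutelyContinuousOnInterval_intervalIntegral (by simp)
  obtain ⟨C, hC⟩ := isCompact_Icc.exists_bound_of_continuousOn hg'
  have acg : AbsolutelyContinuousOnInterval g p q := by
    have : LipschitzOnWith C.toNNReal g (uIcc p q) := by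
      rw [uIcc_of_le hpq]
      refine (convex_Icc p q).lipschitzOnWith_of_nnnorm_hasDerivWithin_le
        (fun r hr => (hg r hr).hasDerivWithinAt) fun r hr => ?_
      rw [← norm_toNNReal]
      exact Real.toNNReal_le_toNNReal (hC r hr)
    exact this.absolutelyContinuousOnInterval
  have e1 := acg.integral_mul_deriv_eq_deriv_mul acH
  have e2 : ∫ r in p..q, g r * deriv H r = ∫ r in p..q, g r * ((1 / 2) * (v r).toReal * u r) := by
    refine intervalIntegral.integral_congr_ae ?_
    filter_upwards [hint.ae_hasDerivAt_integral] with r hr hr'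
    rw [(hr (uIoc_subset_uIcc hr') p (by simp)).deriv]
  have e3 : ∫ r in p..q, deriv g r * H r = ∫ r in p..q, (g' r * u' r - u' p * g' r) := by
    refine intervalIntegral.integral_congr fun r hr => ?_
    rw [uIcc_of_le hpq] at hr
    have hHr : H r = u' r - u' p := (h.equation p r hp hr.1).symm
    rw [(hg r hr).deriv, hHr]
    ring
  have ic := h.continuousOn_deriv hv hp hpq
  have i1 : IntervalIntegrable (fun r => g' r * u' r) volume p q :=
    ContinuousOn.intervalIntegrable_of_Icc hpq (hg'.mul ic)
  have i2 : IntervalIntegrable g' volume p q := ContinuousOn.intervalIntegrable_of_Icc hpq hg'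
  have e4 : ∫ r in p..q, g' r = g q - g p :=
    intervalIntegral.integral_eq_sub_of_hasDerivAt (fun r hr => by
      rw [uIcc_of_le hpq] at hr; exact hg r hr) i2
  rw [intervalIntegral.integral_sub i1 (i2.const_mul _), intervalIntegral.integral_const_mul, e4]
    at e3
  have e5 : H p = 0 := by simp [hH]
  have e6 : H q = u' q - u' p := (h.equation p q hp hpq).symm
  rw [e2, e3, e5, e6] at e1
  rw [e1]
  ring

theorem IsScatteringSolution.u_core (h : IsScatteringSolution v R u u') : u R = 0 :=
  h.eq_zero R ⟨h.core_nonneg, le_rfl⟩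

theorem IsScatteringSolution.exists_slope (h : IsScatteringSolution v R u u') {s t : ℝ}
    (hs : R ≤ s) (hst : s < t) : ∃ c ∈ Ioo s t, u' c = (u t - u s) / (t - s) := by
  refine exists_hasDerivAt_eq_slope u u' hst ?_ fun r hr => h.hasDerivAt r (hs.trans_lt hr.1)
  exact h.continuousOn.mono fun r hr => h.core_nonneg.trans (hs.trans hr.1)

theorem IsScatteringSolution.sub_le (h : IsScatteringSolution v R u u') {s t : ℝ}
    (hs : R ≤ s) (hst : s ≤ t) (ht : R < t) : u t - u s ≤ (t - s) * u' t := by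
  rcases hst.eq_or_lt with rfl | hst
  · simp
  obtain ⟨c, hc, e⟩ := h.exists_slope hs hst
  have h1 := h.monotone (hs.trans_lt hc.1) hc.2.le
  rw [e, div_le_iff₀ (sub_pos.2 hst)] at h1
  linarith

/-- The tangent at `r` lies below the convex graph, and `u` rises from `0` at `R` to a positive
value. -/
theorem IsScatteringSolution.deriv_pos (h : IsScatteringSolution v R u u') {r : ℝ} (hr : R < r) :
    0 < u' r := by
  have h1 := h.sub_le le_rfl hr.le hr
  rw [h.u_core, sub_zero] at h1
  have h2 := h.pos r hr
  have h3 : 0 < r - R := sub_pos.2 hr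
  by_contra hn
  push Not at hn
  nlinarith

theorem IsScatteringSolution.lt (h : IsScatteringSolution v R u u') {s t : ℝ}
    (hs : R ≤ s) (hst : s < t) : u s < u t := by
  obtain ⟨c, hc, e⟩ := h.exists_slope hs hst
  have h1 := h.deriv_pos (hs.trans_lt hc.1)
  rw [e, div_pos_iff_of_pos_right (sub_pos.2 hst)] at h1
  linarith

/-- The quantity `r - u/u'` is the point where the tangent at `r` meets the axis, and for a convex
increasing function it moves to the right. Its limit is `a`, so every tangent meets the axis at or
before `a`. -/
theorem IsScatteringSolution.radius_mono (h : IsScatteringSolution v R u u') {s t : ℝ}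
    (hs : R < s) (hst : s ≤ t) : s - u s / u' s ≤ t - u t / u' t := by
  have ht := hs.trans_le hst
  have p1 := h.deriv_pos hs
  have p2 := h.deriv_pos ht
  have h1 := h.sub_le hs.le hst ht
  have h2 : u t / u' t ≤ (t - s) + u s / u' t := by
    rw [div_le_iff₀ p2, add_mul, div_mul_cancel₀ _ p2.ne']
    linarith
  have h3 : u s / u' t ≤ u s / u' s :=
    div_le_div_of_nonneg_left (h.pos s hs).le p1 (h.monotone hs hst)
  linarith

theorem IsScatteringSolution.radius_le (h : IsScatteringSolution v R u u')
    (ha : Tendsto (fun r => r - u r / u' r) atTop (𝓝 a)) {r : ℝ} (hr : R < r) :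
    r - u r / u' r ≤ a :=
  ge_of_tendsto ha ((eventually_ge_atTop r).mono fun _ ht => h.radius_mono hr ht)

theorem IsScatteringSolution.core_le (h : IsScatteringSolution v R u u')
    (ha : Tendsto (fun r => r - u r / u' r) atTop (𝓝 a)) : R ≤ a := by
  have hr : R < R + 1 := by linarith
  have h1 := h.radius_le ha hr
  have h2 := h.sub_le le_rfl hr.le hr
  rw [h.u_core, sub_zero] at h2
  have h3 : u (R + 1) / u' (R + 1) ≤ (R + 1) - R := by
    rw [div_le_iff₀ (h.deriv_pos hr)]; exact h2
  linarith

theorem IsScatteringLength.nonneg (h : IsScatteringLength v a) : 0 ≤ a := by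
  obtain ⟨R, u, u', h, ha⟩ := h
  exact h.core_nonneg.trans (h.core_le ha)

/-- The contribution of the interaction outside of a ball. -/
theorem IsScatteringSolution.integral_tail_le (h : IsScatteringSolution v R u u')
    (hv : Measurable v) (ha : Tendsto (fun r => r - u r / u' r) atTop (𝓝 a)) {B T : ℝ}
    (hB : a < B) (hBT : B ≤ T) :
    ∫ r in B..T, (1 / 2) * (v r).toReal * r ^ 2
      ≤ a + B - B ^ 2 * u' B / u B + a ^ 2 / (B - a) := by
  have hRa := h.core_le ha
  have hR0 := h.core_nonneg
  have hRB : R < B := hRa.trans_lt hB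
  have upos : ∀ r ∈ Icc B T, 0 < u r := fun r hr => h.pos r (hRB.trans_le hr.1)
  have cu := h.continuousOn_u (q := T) hRB
  have cu' := h.continuousOn_deriv hv hRB hBT
  have ne : ∀ r ∈ Icc B T, u r ≠ 0 := fun r hr => (upos r hr).ne'
  have hd : ∀ r ∈ Icc B T, HasDerivAt (fun r => r ^ 2 / u r)
      ((2 * r * u r - r ^ 2 * u' r) / u r ^ 2) r := fun r hr => by
    refine ((hasDerivAt_pow 2 r).div (h.hasDerivAt r (hRB.trans_le hr.1)) (ne r hr)).congr_deriv ?_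
    simp
  -- The multiplier `r²/u` cancels the `u` of the source term and leaves the wanted integral of `v
  -- r²/2`.
  have key := h.integral_by_parts hv hRB hBT hd (by
    refine ContinuousOn.div ?_ (cu.pow 2) fun r hr => pow_ne_zero 2 (ne r hr)
    fun_prop)
  have e1 : ∫ r in B..T, r ^ 2 / u r * ((1 / 2) * (v r).toReal * u r)
      = ∫ r in B..T, (1 / 2) * (v r).toReal * r ^ 2 := by
    refine intervalIntegral.integral_congr fun r hr => ?_
    rw [uIcc_of_le hBT] at hr
    have := ne r hr
    field_simp
  rw [e1] at key
  have rle : ∀ r ∈ Icc B T, (r - a) * u' r ≤ u r := fun r hr => by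
    have h1 := h.radius_le ha (hRB.trans_le hr.1)
    have h2 := h.deriv_pos (hRB.trans_le hr.1)
    rw [sub_le_iff_le_add, ← sub_le_iff_le_add', le_div_iff₀ h2] at h1
    exact h1
  have uge : ∀ r ∈ Icc B T, u r ≤ r * u' r := fun r hr => by
    have h1 := h.sub_le le_rfl (hRB.trans_le hr.1).le (hRB.trans_le hr.1)
    rw [h.u_core, sub_zero] at h1
    have h2 := h.deriv_pos (hRB.trans_le hr.1)
    nlinarith
  -- The integrand on the right is `1 - ((r u' - u)/u)²`, and `(r - a) u' ≤ u` gives `0 ≤ r u' - u ≤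
  -- a u' ≤ a u/(r - a)`.
  have hlow : ∫ r in B..T, (1 - a ^ 2 / (r - a) ^ 2)
      ≤ ∫ r in B..T, (2 * r * u r - r ^ 2 * u' r) / u r ^ 2 * u' r := by
    refine intervalIntegral.integral_mono_on hBT ?_ ?_ fun r hr => ?_
    · refine ContinuousOn.intervalIntegrable_of_Icc hBT ?_
      refine continuousOn_const.sub (ContinuousOn.div continuousOn_const (by fun_prop) fun r hr => ?_)
      have : 0 < r - a := by linarith [hr.1]
      positivity
    · refine ContinuousOn.intervalIntegrable_of_Icc hBT ?_
      refine (ContinuousOn.div ?_ (cu.pow 2) fun r hr => pow_ne_zero 2 (ne r hr)).mul cu'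
      fun_prop
    · have p1 := upos r hr
      have p2 : 0 < r - a := by linarith [hr.1]
      have e2 : (2 * r * u r - r ^ 2 * u' r) / u r ^ 2 * u' r
          = 1 - ((r * u' r - u r) / u r) ^ 2 := by
        field_simp
        ring
      rw [e2, ← div_pow]
      have h0 : 0 ≤ (r * u' r - u r) / u r := div_nonneg (by linarith [uge r hr]) p1.le
      have h1 : (r * u' r - u r) / u r ≤ a / (r - a) := by
        rw [div_le_div_iff₀ p1 p2]
        have := rle r hr
        nlinarith [hr.1]
      have := pow_le_pow_left₀ h0 h1 2
      linarith
  have hval : ∫ r in B..T, (1 - a ^ 2 / (r - a) ^ 2)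
      = (T + a ^ 2 / (T - a)) - (B + a ^ 2 / (B - a)) := by
    refine intervalIntegral.integral_eq_sub_of_hasDerivAt (f := fun r => r + a ^ 2 / (r - a))
      (fun r hr => ?_) ?_
    · rw [uIcc_of_le hBT] at hr
      have p2 : r - a ≠ 0 := by
        have := hr.1
        intro h0
        linarith
      have h1 := (hasDerivAt_id r).add (((hasDerivAt_const r (a ^ 2)).div
        ((hasDerivAt_id r).sub_const a) p2))
      refine h1.congr_deriv ?_
      simp
      ring
    · refine ContinuousOn.intervalIntegrable_of_Icc hBT ?_
      refine continuousOn_const.sub (ContinuousOn.div continuousOn_const (by fun_prop) fun r hr => ?_)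
      have : 0 < r - a := by linarith [hr.1]
      positivity
  have hT : T ∈ Icc B T := ⟨hBT, le_rfl⟩
  have pT : 0 < T - a := by linarith
  -- The boundary term at `T` is at most `T + a + a²/(T - a)`; its growing part cancels against the
  -- integral just computed, so the bound does not depend on `T`.
  have h1 : T ^ 2 / u T * u' T ≤ T ^ 2 / (T - a) := by
    rw [div_mul_eq_mul_div, div_le_div_iff₀ (upos T hT) pT]
    have := rle T hT
    nlinarith [sq_nonneg T]
  have h2 : T ^ 2 / (T - a) = T + a + a ^ 2 / (T - a) := by
    field_simp
    ring
  have h3 : B ^ 2 / u B * u' B = B ^ 2 * u' B / u B := by ring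
  rw [key, h3]
  linarith

end Scattering

/-! ### Radial pair factors -/

section Radial

variable {s B : ℝ} {f φ : ℝ → ℝ}

/-- The radial function with profile `f` between the radii `s` and `B`. -/
noncomputable def radial (s B : ℝ) (f : ℝ → ℝ) (y : E3) : ℝ := f (max s (min ‖y‖ B))

theorem clamp_mem (hsB : s ≤ B) (r : ℝ) : max s (min r B) ∈ Icc s B :=
  ⟨le_max_left _ _, max_le hsB (min_le_right _ _)⟩

theorem measurable_indicator_Icc {g : ℝ → ℝ} (hg : ContinuousOn g (Icc s B)) :
    Measurable ((Icc s B).indicator g) := by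
  rw [← piecewise_eq_indicator]
  exact hg.measurable_piecewise continuousOn_const measurableSet_Icc

theorem monotoneOn_profile (hf : ∀ r ∈ Icc s B, HasDerivAt f (φ r) r)
    (hφ : ∀ r ∈ Icc s B, 0 ≤ φ r) : MonotoneOn f (Icc s B) :=
  monotoneOn_of_hasDerivWithinAt_nonneg (f' := φ) (convex_Icc _ _)
    (fun r hr => (hf r hr).continuousAt.continuousWithinAt)
    (fun r hr => (hf r (interior_subset hr)).hasDerivWithinAt)
    fun r hr => hφ r (interior_subset hr)

theorem isPairFactor_radial (hsB : s ≤ B) (hf : ∀ r ∈ Icc s B, HasDerivAt f (φ r) r)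
    (hφc : ContinuousOn φ (Icc s B)) (hφ : ∀ r ∈ Icc s B, 0 ≤ φ r) (h0 : f s = 0)
    (h1 : f B = 1) : IsPairFactor (radial s B f) := by
  have hm := monotoneOn_profile hf hφ
  refine ⟨fun y => ?_, fun y => ?_, fun y => by simp [radial], ?_⟩
  · rw [← h0]
    exact hm ⟨le_rfl, hsB⟩ (clamp_mem hsB _) (clamp_mem hsB _).1
  · rw [← h1]
    exact hm (clamp_mem hsB _) ⟨hsB, le_rfl⟩ (clamp_mem hsB _).2
  · obtain ⟨C, hC⟩ := isCompact_Icc.exists_bound_of_continuousOn hφc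
    have hL : LipschitzOnWith C.toNNReal f (Icc s B) := by
      refine (convex_Icc s B).lipschitzOnWith_of_nnnorm_hasDerivWithin_le
        (fun r hr => (hf r hr).hasDerivWithinAt) fun r hr => ?_
      rw [← norm_toNNReal]
      exact Real.toNNReal_le_toNNReal (hC r hr)
    have hcl : LipschitzWith 1 fun y : E3 => max s (min ‖y‖ B) :=
      ((lipschitzWith_one_norm (E := E3)).min_const B).const_max s
    refine ⟨C.toNNReal, ?_⟩
    have := hL.comp (hcl.lipschitzOnWith (s := univ)) fun y _ => clamp_mem hsB _
    rw [lipschitzOnWith_univ, mul_one] at this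
    exact this

/-- Off the two null spheres of radii `s` and `B`, the function is locally constant or locally `f
‖y‖`, and the norm is `1`-Lipschitz. -/
theorem gradNorm_radial_le (hs : 0 < s) (hf : ∀ r ∈ Icc s B, HasDerivAt f (φ r) r)
    (hφ : ∀ r ∈ Icc s B, 0 ≤ φ r) :
    ∀ᵐ y : E3, gradNorm (radial s B f) y ≤ (Icc s B).indicator φ ‖y‖ := by
  have n1 : ∀ᵐ y : E3, ‖y‖ ≠ s := by
    rw [ae_iff]
    convert Measure.addHaar_sphere (volume : Measure E3) 0 s using 2
    ext y; simp
  have n2 : ∀ᵐ y : E3, ‖y‖ ≠ B := by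
    rw [ae_iff]
    convert Measure.addHaar_sphere (volume : Measure E3) 0 B using 2
    ext y; simp
  filter_upwards [n1, n2] with y y1 y2
  have hconst : ∀ c : ℝ, radial s B f =ᶠ[𝓝 y] (fun _ => c) → gradNorm (radial s B f) y = 0 := by
    intro c hc
    rw [gradNorm, hc.fderiv_eq]
    simp
  have h0 : ∀ r, 0 ≤ (Icc s B).indicator φ r := fun r => indicator_nonneg hφ r
  rcases lt_or_gt_of_ne y1 with y1 | y1
  · rw [hconst (f s)]
    · exact h0 _
    · filter_upwards [(isOpen_lt continuous_norm continuous_const).mem_nhds y1] with z hz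
      replace hz : ‖z‖ < s := hz
      rw [radial, max_eq_left ((min_le_left _ _).trans hz.le)]
  rcases lt_or_gt_of_ne y2 with y2 | y2
  · have hy0 : y ≠ 0 := by
      rintro rfl
      simp at y1
      linarith
    have e : radial s B f =ᶠ[𝓝 y] f ∘ fun z => ‖z‖ := by
      filter_upwards [(isOpen_lt continuous_norm continuous_const).mem_nhds y2,
        (isOpen_lt continuous_const continuous_norm).mem_nhds y1] with z hz hz'
      replace hz : ‖z‖ < B := hz
      replace hz' : s < ‖z‖ := hz'
      rw [radial, min_eq_left hz.le, max_eq_right hz'.le]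
      rfl
    have hmem : ‖y‖ ∈ Icc s B := ⟨y1.le, y2.le⟩
    have hn : DifferentiableAt ℝ (fun z : E3 => ‖z‖) y := (contDiffAt_norm ℝ hy0).differentiableAt
      (n := 1) (by norm_num)
    have hd := (hf _ hmem).comp_hasFDerivAt y hn.hasFDerivAt
    rw [gradNorm, e.fderiv_eq, hd.fderiv, norm_smul, indicator_of_mem hmem, Real.norm_of_nonneg
      (hφ _ hmem)]
    have := norm_fderiv_le_of_lipschitz ℝ (lipschitzWith_one_norm (E := E3)) (x₀ := y)
    exact mul_le_of_le_one_right (hφ _ hmem) (by simpa using this)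
  · rw [hconst (f (max s B))]
    · exact h0 _
    · filter_upwards [(isOpen_lt continuous_const continuous_norm).mem_nhds y2] with z hz
      replace hz : B < ‖z‖ := hz
      rw [radial, min_eq_right hz.le]

theorem ofReal_intervalIntegral {p q : ℝ} (hpq : p ≤ q) {g : ℝ → ℝ}
    (hg : IntervalIntegrable g volume p q) (h0 : ∀ r ∈ Icc p q, 0 ≤ g r) :
    ENNReal.ofReal (∫ r in p..q, g r) = ∫⁻ r in Icc p q, ENNReal.ofReal (g r) := by
  rw [intervalIntegral.integral_of_le hpq, ← integral_Icc_eq_integral_Ioc,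
    ofReal_integral_eq_lintegral_ofReal]
  · exact (intervalIntegrable_iff_integrableOn_Icc_of_le hpq).1 hg
  · exact (ae_restrict_iff' measurableSet_Icc).2 (.of_forall h0)

theorem lintegral_norm_indicator (hs : 0 < s) (hsB : s ≤ B) {g : ℝ → ℝ}
    (hg : ContinuousOn g (Icc s B)) (h0 : ∀ r ∈ Icc s B, 0 ≤ g r) :
    ∫⁻ y : E3, ENNReal.ofReal ((Icc s B).indicator g ‖y‖)
      = ENNReal.ofReal (4 * Real.pi * ∫ r in s..B, r ^ 2 * g r) := by
  have hm := (measurable_indicator_Icc hg).ennreal_ofReal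
  rw [lintegral_fun_norm hm, ENNReal.ofReal_mul (p := 4 * Real.pi) (by positivity), ofReal_intervalIntegral hsB
    (ContinuousOn.intervalIntegrable_of_Icc hsB (by fun_prop))
    fun r hr => mul_nonneg (sq_nonneg r) (h0 r hr)]
  congr 1
  rw [← lintegral_indicator measurableSet_Ioi, ← lintegral_indicator measurableSet_Icc]
  congr 1
  ext r
  by_cases hr : r ∈ Icc s B
  · have : r ∈ Ioi (0 : ℝ) := hs.trans_le hr.1
    rw [indicator_of_mem hr, indicator_of_mem this, indicator_of_mem hr,
      ENNReal.ofReal_mul (sq_nonneg _)]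
  · have : (Icc s B).indicator g r = 0 := indicator_of_notMem hr _
    rw [indicator_of_notMem hr, indicator_apply, this]
    simp

end Radial

/-! ### The pair factor of the scattering solution -/

section Scattering

variable {v : ℝ → ℝ≥0∞} {R a : ℝ} {u u' : ℝ → ℝ}

theorem IsScatteringSolution.le_sub (h : IsScatteringSolution v R u u') {s t : ℝ}
    (hs : R < s) (hst : s ≤ t) : (t - s) * u' s ≤ u t - u s := by
  rcases hst.eq_or_lt with rfl | hst
  · simp
  obtain ⟨c, hc, e⟩ := h.exists_slope hs.le hst
  have h1 := h.monotone hs hc.1.le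
  rw [e, le_div_iff₀ (sub_pos.2 hst)] at h1
  linarith

theorem IsScatteringSolution.le_mul_deriv (h : IsScatteringSolution v R u u') {r : ℝ}
    (hr : R < r) : u r ≤ r * u' r := by
  have h1 := h.sub_le le_rfl hr.le hr
  rw [h.u_core, sub_zero] at h1
  nlinarith [h.deriv_pos hr, h.core_nonneg]

theorem IsScatteringSolution.sub_mul_deriv_le (h : IsScatteringSolution v R u u')
    (ha : Tendsto (fun r => r - u r / u' r) atTop (𝓝 a)) {r : ℝ} (hr : R < r) :
    (r - a) * u' r ≤ u r := by
  have h1 := h.radius_le ha hr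
  rw [sub_le_iff_le_add, ← sub_le_iff_le_add', le_div_iff₀ (h.deriv_pos hr)] at h1
  exact h1

theorem IsScatteringSolution.lintegral_mul (h : IsScatteringSolution v R u u')
    (hv : Measurable v) {p q : ℝ} (hp : R < p) (hpq : p ≤ q) {g : ℝ → ℝ}
    (hg : ContinuousOn g (Icc p q)) (h0 : ∀ r ∈ Icc p q, 0 ≤ g r) :
    ∫⁻ r in Icc p q, v r * ENNReal.ofReal (g r)
      = ENNReal.ofReal (∫ r in p..q, (v r).toReal * g r) := by
  rw [ofReal_intervalIntegral hpq (h.intervalIntegrable hv hp hpq hg)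
    fun r hr => mul_nonneg ENNReal.toReal_nonneg (h0 r hr)]
  have hfin : ∀ᵐ r ∂(volume.restrict (Icc p q)), v r < ⊤ := by
    refine ae_lt_top hv ?_
    have hle : ∫⁻ r in Icc p q, v r ≤ ∫⁻ r in Ioo ((R + p) / 2) (q + 1), v r :=
      lintegral_mono_set fun r hr => ⟨by linarith [hr.1], by linarith [hr.2]⟩
    exact (hle.trans_lt (h.locallyIntegrable _ _ (by linarith) (by linarith))).ne
  refine lintegral_congr_ae ?_
  filter_upwards [hfin] with r hr
  rw [ENNReal.ofReal_mul ENNReal.toReal_nonneg, ENNReal.ofReal_toReal hr.ne]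

theorem IsScatteringSolution.lintegral_tail_le (h : IsScatteringSolution v R u u')
    (hv : Measurable v) (ha : Tendsto (fun r => r - u r / u' r) atTop (𝓝 a)) {B : ℝ}
    (hB : a < B) :
    ∫⁻ r in Ioi B, v r * ENNReal.ofReal (r ^ 2)
      ≤ ENNReal.ofReal (2 * (a + B - B ^ 2 * u' B / u B + a ^ 2 / (B - a))) := by
  have hRB : R < B := (h.core_le ha).trans_lt hB
  have hU : Ioi B ⊆ ⋃ n : ℕ, Icc B (B + n) := fun r hr => by
    obtain ⟨n, hn⟩ := exists_nat_ge (r - B)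
    exact mem_iUnion.2 ⟨n, (show B < r from hr).le, by linarith⟩
  have hmono : Monotone fun n : ℕ => Icc B (B + (n : ℝ)) := fun m n hmn =>
    Icc_subset_Icc_right (by
      have : (m : ℝ) ≤ n := by exact_mod_cast hmn
      linarith)
  refine (lintegral_mono_set hU).trans ?_
  rw [setLIntegral_iUnion_of_directed _ hmono.directed_le]
  refine iSup_le fun n => ?_
  have hn : B ≤ B + (n : ℝ) := by linarith [n.cast_nonneg (α := ℝ)]
  rw [h.lintegral_mul hv hRB hn (by fun_prop) fun r _ => sq_nonneg r]
  refine ENNReal.ofReal_le_ofReal ?_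
  have := h.integral_tail_le hv ha hB hn
  have e : ∫ r in B..(B + n), (1 / 2) * (v r).toReal * r ^ 2
      = (1 / 2) * ∫ r in B..(B + n), (v r).toReal * r ^ 2 := by
    rw [← intervalIntegral.integral_const_mul]
    simp only [mul_assoc]
  linarith

theorem IsScatteringSolution.tail_nonneg (h : IsScatteringSolution v R u u')
    (hv : Measurable v) (ha : Tendsto (fun r => r - u r / u' r) atTop (𝓝 a)) {B : ℝ}
    (hB : a < B) : 0 ≤ a + B - B ^ 2 * u' B / u B + a ^ 2 / (B - a) := by
  simpa using h.integral_tail_le hv ha hB le_rfl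

/-- At the core radius both inequalities hold strictly with `u s` replaced by `u R = 0`: the first
because `a < a'`, the second because `t B/(B - t)` increases with `t`. By continuity they persist
for `s` slightly above `R`. Starting the pair factor at such an `s` keeps it away from the core and
from the origin, where `v` need not be integrable and `1/r` is singular. -/
theorem IsScatteringSolution.exists_cutoff (h : IsScatteringSolution v R u u')
    (ha : Tendsto (fun r => r - u r / u' r) atTop (𝓝 a)) {a' B : ℝ} (h1 : a < a') (h2 : a' < B) :
    ∃ s, R < s ∧ s < a' ∧ (B - a') * u' B ≤ u B - u s ∧
      B ^ 2 * u' B * u s / ((u B - u s) * u B) ≤ a' * B / (B - a') - a * B / (B - a) := by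
  have hR0 := h.core_nonneg
  have hRa := h.core_le ha
  have hRB : R < B := by linarith
  have hB0 : 0 < B := by linarith
  have ut : Tendsto u (𝓝[>] R) (𝓝 0) := by
    have := (h.continuousOn R hR0).mono (s := Ioi R) fun r hr =>
      hR0.trans (show R < r from hr).le
    rw [← h.u_core]
    exact this
  have uB := h.pos B hRB
  have UB := h.deriv_pos hRB
  have l1 : (B - a') * u' B < u B - 0 := by
    have := h.sub_mul_deriv_le ha hRB
    nlinarith
  have l2 : B ^ 2 * u' B * 0 / ((u B - 0) * u B) < a' * B / (B - a') - a * B / (B - a) := by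
    rw [mul_zero, zero_div, sub_pos, div_lt_div_iff₀ (by linarith) (by linarith)]
    nlinarith [mul_pos hB0 hB0]
  have t1 : ∀ᶠ s in 𝓝[>] R, (B - a') * u' B < u B - u s :=
    (ut.const_sub (u B)).eventually_const_lt l1
  have t2 : ∀ᶠ s in 𝓝[>] R, B ^ 2 * u' B * u s / ((u B - u s) * u B)
      < a' * B / (B - a') - a * B / (B - a) := by
    refine Tendsto.eventually_lt_const l2 ?_
    refine (ut.const_mul _).div ((ut.const_sub (u B)).mul_const _) ?_
    rw [sub_zero]
    positivity
  have t3 : ∀ᶠ s in 𝓝[>] R, R < s := eventually_mem_nhdsWithin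
  have t4 : ∀ᶠ s in 𝓝[>] R, s < a' :=
    mem_nhdsWithin_of_mem_nhds (Iio_mem_nhds (by linarith))
  obtain ⟨s, s1, s2, s3, s4⟩ := (t1.and (t2.and (t3.and t4))).exists
  exact ⟨s, s3, s4, s1.le, s2.le⟩

/-- The normalized scattering solution, shifted to vanish at `s`. -/
noncomputable def profile (u : ℝ → ℝ) (s B r : ℝ) : ℝ := B / (u B - u s) * ((u r - u s) / r)

/-- The derivative of `profile u s B`. -/
noncomputable def profileDeriv (u u' : ℝ → ℝ) (s B r : ℝ) : ℝ :=
  B / (u B - u s) * ((u' r * r - (u r - u s)) / r ^ 2)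

variable {s B : ℝ}

theorem IsScatteringSolution.hasDerivAt_profile (h : IsScatteringSolution v R u u') (hs : R < s)
    {r : ℝ} (hr : s ≤ r) : HasDerivAt (profile u s B) (profileDeriv u u' s B r) r := by
  have hr0 : r ≠ 0 := (h.core_nonneg.trans_lt (hs.trans_le hr)).ne'
  have h1 := (((h.hasDerivAt r (hs.trans_le hr)).sub_const (u s)).div (hasDerivAt_id r)
    hr0).const_mul (B / (u B - u s))
  refine h1.congr_deriv ?_
  simp [profileDeriv]

theorem IsScatteringSolution.continuousOn_profileDeriv (h : IsScatteringSolution v R u u')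
    (hv : Measurable v) (hs : R < s) (hsB : s ≤ B) :
    ContinuousOn (profileDeriv u u' s B) (Icc s B) := by
  have c1 := h.continuousOn_deriv hv hs hsB
  have c2 := h.continuousOn_u (q := B) hs
  refine continuousOn_const.mul (ContinuousOn.div (by fun_prop) (by fun_prop) fun r hr => ?_)
  have : 0 < r := h.core_nonneg.trans_lt (hs.trans_le hr.1)
  positivity

theorem IsScatteringSolution.profileDeriv_nonneg (h : IsScatteringSolution v R u u')
    (hs : R < s) (hsB : s < B) {r : ℝ} (hr : s ≤ r) : 0 ≤ profileDeriv u u' s B r := by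
  have h0 := h.core_nonneg
  have h1 := h.lt hs.le hsB
  have h2 := h.le_mul_deriv (hs.trans_le hr)
  have h3 := h.pos s hs
  have h4 : 0 ≤ B / (u B - u s) := div_nonneg (by linarith) (by linarith)
  exact mul_nonneg h4 (div_nonneg (by linarith) (sq_nonneg r))

/-- Up to a constant the left side is `r u' - (u - u s)`, which increases with `r` by convexity; its
value at `B` is estimated by `hstar`. -/
theorem IsScatteringSolution.sq_mul_profileDeriv_le (h : IsScatteringSolution v R u u')
    (hs : R < s) (hsB : s < B) {a' : ℝ} (ha' : a' < B)
    (hstar : (B - a') * u' B ≤ u B - u s) {r : ℝ} (hr : r ∈ Icc s B) :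
    r ^ 2 * profileDeriv u u' s B r ≤ a' * B / (B - a') := by
  have h0 := h.core_nonneg
  have hr0 : 0 < r := by linarith [hr.1]
  have hB0 : 0 < B := by linarith
  have h1 : 0 < u B - u s := by linarith [h.lt hs.le hsB]
  have h2 : u' r * r - (u r - u s) ≤ u' B * B - (u B - u s) := by
    have e1 := h.sub_le (hs.le.trans hr.1) hr.2 (hs.trans hsB)
    have e2 := h.monotone (hs.trans_le hr.1) hr.2
    nlinarith
  have e : r ^ 2 * profileDeriv u u' s B r = B * (u' r * r - (u r - u s)) / (u B - u s) := by
    rw [profileDeriv]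
    field_simp
  rw [e, div_le_div_iff₀ h1 (by linarith)]
  have h3 : (B - a') * (u' B * B - (u B - u s)) ≤ a' * (u B - u s) := by nlinarith
  have h4 : 0 < B - a' := by linarith
  nlinarith [mul_le_mul_of_nonneg_left h2 (mul_pos hB0 h4).le, mul_le_mul_of_nonneg_left h3 hB0.le]

/-- Comparison with a hard core of radius `a'`: the convex function `u - u s` lies above its tangent
at `B`, whose slope is, by `hstar`, at most that of the line from `a'` on the axis to the same
endpoint. -/
theorem IsScatteringSolution.le_profile (h : IsScatteringSolution v R u u')
    (hs : R < s) (hsB : s < B) {a' : ℝ} (ha' : a' < B)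
    (hstar : (B - a') * u' B ≤ u B - u s) {r : ℝ} (hr : r ∈ Icc s B) :
    B / (B - a') * (r - a') ≤ r * profile u s B r := by
  have h0 := h.core_nonneg
  have hr0 : 0 < r := by linarith [hr.1]
  have hB0 : 0 < B := by linarith
  have h1 : 0 < u B - u s := by linarith [h.lt hs.le hsB]
  have e : r * profile u s B r = B * (u r - u s) / (u B - u s) := by
    rw [profile]
    field_simp
  have h4 : 0 < B - a' := by linarith
  rw [e, div_mul_eq_mul_div, div_le_div_iff₀ h4 h1]
  have e1 := h.sub_le (hs.le.trans hr.1) hr.2 (hs.trans hsB)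
  have e2 : (u B - u s) * (r - a') ≤ (u r - u s) * (B - a') := by
    have : (B - r) * ((B - a') * u' B) ≤ (B - r) * (u B - u s) :=
      mul_le_mul_of_nonneg_left hstar (by linarith [hr.2])
    nlinarith
  nlinarith [mul_le_mul_of_nonneg_left e2 hB0.le]

end Scattering

/-! ### The integrals of the scattering pair factor -/

section Scattering

variable {v : ℝ → ℝ≥0∞} {R a : ℝ} {u u' : ℝ → ℝ} {s B : ℝ}

theorem IsScatteringSolution.sub_mul_nonneg (h : IsScatteringSolution v R u u') (hs : R < s)
    {r : ℝ} (hr : s ≤ r) : 0 ≤ (u r - u s) * u r := by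
  have h1 := h.le_sub hs hr
  have h2 : 0 ≤ (r - s) * u' s := mul_nonneg (by linarith) (h.deriv_pos hs).le
  exact mul_nonneg (by linarith) (h.pos r (hs.trans_le hr)).le

theorem IsScatteringSolution.isPairFactor_profile (h : IsScatteringSolution v R u u')
    (hv : Measurable v) (hs : R < s) (hsB : s < B) :
    IsPairFactor (radial s B (profile u s B)) := by
  have h0 := h.core_nonneg
  have h1 : 0 < u B - u s := by linarith [h.lt hs.le hsB]
  refine isPairFactor_radial hsB.le (fun r hr => h.hasDerivAt_profile hs hr.1)
    (h.continuousOn_profileDeriv hv hs hsB.le) (fun r hr => h.profileDeriv_nonneg hs hsB hr.1) ?_ ?_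
  · simp [profile]
  · have : B ≠ 0 := by linarith
    rw [profile]
    field_simp

/-- Expanding the square gives `u'²` minus the exact derivative of `(u - u s)²/r`. This vanishes at
`s`, and its value at `B` accounts for the term `-B`. -/
theorem IsScatteringSolution.integral_sq_profileDeriv (h : IsScatteringSolution v R u u')
    (hv : Measurable v) (hs : R < s) (hsB : s < B) :
    ∫ r in s..B, r ^ 2 * profileDeriv u u' s B r ^ 2
      = (B / (u B - u s)) ^ 2 * (∫ r in s..B, u' r * u' r) - B := by
  have h0 := h.core_nonneg
  have h1 : 0 < u B - u s := by linarith [h.lt hs.le hsB]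
  have hB0 : 0 < B := by linarith
  have c1 := h.continuousOn_deriv hv hs hsB.le
  have c2 := h.continuousOn_u (q := B) hs
  have r0 : ∀ r ∈ Icc s B, r ≠ 0 := fun r hr => by
    have := hr.1
    intro h
    linarith
  have hd : ∀ r ∈ Icc s B, HasDerivAt (fun r => (u r - u s) ^ 2 / r)
      ((2 * (u r - u s) * u' r * r - (u r - u s) ^ 2) / r ^ 2) r := fun r hr => by
    refine ((((h.hasDerivAt r (hs.trans_le hr.1)).sub_const (u s)).pow 2).div (hasDerivAt_id r)
      (r0 r hr)).congr_deriv ?_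
    simp
  have cd : ContinuousOn (fun r => (2 * (u r - u s) * u' r * r - (u r - u s) ^ 2) / r ^ 2)
      (Icc s B) := ContinuousOn.div (by fun_prop) (by fun_prop) fun r hr => pow_ne_zero 2 (r0 r hr)
  have i2 := ContinuousOn.intervalIntegrable_of_Icc (μ := volume) hsB.le cd
  have i1 : IntervalIntegrable (fun r => u' r * u' r) volume s B :=
    ContinuousOn.intervalIntegrable_of_Icc hsB.le (by fun_prop)
  have e1 := intervalIntegral.integral_eq_sub_of_hasDerivAt (fun r hr => by
    rw [uIcc_of_le hsB.le] at hr; exact hd r hr) i2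
  have e2 : ∫ r in s..B, r ^ 2 * profileDeriv u u' s B r ^ 2
      = ∫ r in s..B, (B / (u B - u s)) ^ 2 * (u' r * u' r
        - (2 * (u r - u s) * u' r * r - (u r - u s) ^ 2) / r ^ 2) := by
    refine intervalIntegral.integral_congr fun r hr => ?_
    rw [uIcc_of_le hsB.le] at hr
    have := r0 r hr
    simp only [profileDeriv]
    field_simp
    ring
  rw [e2, intervalIntegral.integral_const_mul, intervalIntegral.integral_sub i1 i2, e1]
  field_simp
  ring

/-- The scattering equation tested with `u - u s`, which has no boundary term at `s`. The integral
of `u'²` will cancel the one in the kinetic energy. -/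
theorem IsScatteringSolution.integral_source (h : IsScatteringSolution v R u u')
    (hv : Measurable v) (hs : R < s) (hsB : s ≤ B) :
    ∫ r in s..B, (v r).toReal * ((u r - u s) * u r)
      = 2 * ((u B - u s) * u' B - ∫ r in s..B, u' r * u' r) := by
  have h1 := h.integral_by_parts hv hs hsB (g := fun r => u r - u s) (g' := u')
    (fun r hr => (h.hasDerivAt r (hs.trans_le hr.1)).sub_const _) (h.continuousOn_deriv hv hs hsB)
  have e : ∫ r in s..B, (v r).toReal * ((u r - u s) * u r)
      = 2 * ∫ r in s..B, (u r - u s) * ((1 / 2) * (v r).toReal * u r) := by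
    rw [← intervalIntegral.integral_const_mul]
    congr 1
    ext r
    ring
  rw [e, h1]
  ring

/-- Below `s` the pair factor vanishes, so infinite values of `v` do no harm since `⊤ * 0 = 0`. On
`[s, B]` the inequality `(u - u s)² ≤ (u - u s) u` produces the form to which the scattering
equation applies. Beyond `B` the factor is `1` and the tail estimate takes over. -/
theorem IsScatteringSolution.lintegral_potential (h : IsScatteringSolution v R u u')
    (hv : Measurable v) (ha : Tendsto (fun r => r - u r / u' r) atTop (𝓝 a))
    (hs : R < s) (hsB : s < B) (haB : a < B) :
    ∫⁻ y : E3, v ‖y‖ * ENNReal.ofReal (radial s B (profile u s B) y ^ 2)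
      ≤ ENNReal.ofReal (4 * Real.pi * ((B / (u B - u s)) ^ 2
          * (∫ r in s..B, (v r).toReal * ((u r - u s) * u r))
          + 2 * (a + B - B ^ 2 * u' B / u B + a ^ 2 / (B - a)))) := by
  have h0 := h.core_nonneg
  have h1 : 0 < u B - u s := by linarith [h.lt hs.le hsB]
  have hB0 : 0 < B := by linarith
  have c2 := h.continuousOn_u (q := B) hs
  have cf : Continuous fun r : ℝ => profile u s B (max s (min r B)) := by
    have : ContinuousOn (profile u s B) (Icc s B) := fun r hr =>
      (h.hasDerivAt_profile hs hr.1).continuousAt.continuousWithinAt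
    exact this.comp_continuous (by fun_prop) fun r => clamp_mem hsB.le r
  have hm : Measurable fun r : ℝ =>
      v r * ENNReal.ofReal (profile u s B (max s (min r B)) ^ 2) :=
    hv.mul (cf.measurable.pow_const 2).ennreal_ofReal
  have hpos : ∀ r ∈ Icc s B, 0 ≤ (u r - u s) * u r := fun r hr => h.sub_mul_nonneg hs hr.1
  have hX : ∫⁻ r in Icc s B, v r * ENNReal.ofReal ((B / (u B - u s)) ^ 2 * ((u r - u s) * u r))
      = ENNReal.ofReal ((B / (u B - u s)) ^ 2
        * ∫ r in s..B, (v r).toReal * ((u r - u s) * u r)) := by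
    rw [h.lintegral_mul hv hs hsB.le (by fun_prop)
      fun r hr => mul_nonneg (sq_nonneg _) (hpos r hr), ← intervalIntegral.integral_const_mul]
    congr 2
    ext r
    ring
  have hI : 0 ≤ ∫ r in s..B, (v r).toReal * ((u r - u s) * u r) :=
    intervalIntegral.integral_nonneg hsB.le fun r hr =>
      mul_nonneg ENNReal.toReal_nonneg (hpos r hr)
  have htail := h.tail_nonneg hv ha haB
  unfold radial
  rw [lintegral_fun_norm hm, ENNReal.ofReal_mul (p := 4 * Real.pi) (by positivity),
    ENNReal.ofReal_add (by positivity) (by linarith)]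
  gcongr
  have hsub : Ioi (0 : ℝ) ⊆ (Iio s ∪ Icc s B) ∪ Ioi B := fun r hr => by
    rcases lt_or_ge r s with h1 | h1
    · exact Or.inl (Or.inl h1)
    rcases le_or_gt r B with h2 | h2
    · exact Or.inl (Or.inr ⟨h1, h2⟩)
    · exact Or.inr h2
  refine (lintegral_mono_set hsub).trans ((lintegral_union_le _ _ _).trans ?_)
  refine add_le_add ((lintegral_union_le _ _ _).trans ?_) ?_
  · have z : ∫⁻ r in Iio s, ENNReal.ofReal (r ^ 2)
        * (v r * ENNReal.ofReal (profile u s B (max s (min r B)) ^ 2)) = 0 := by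
      rw [setLIntegral_congr_fun measurableSet_Iio (g := fun _ => 0), lintegral_zero]
      intro r hr
      have : max s (min r B) = s := max_eq_left ((min_le_left _ _).trans (show r < s from hr).le)
      simp only [this, profile]
      simp
    rw [z, zero_add, ← hX]
    refine setLIntegral_mono' measurableSet_Icc fun r hr => ?_
    have : max s (min r B) = r := by rw [min_eq_left hr.2, max_eq_right hr.1]
    rw [this, mul_left_comm]
    gcongr
    rw [← ENNReal.ofReal_mul (sq_nonneg _)]
    refine ENNReal.ofReal_le_ofReal ?_
    have hr0 : 0 < r := by linarith [hr.1]
    have e : r ^ 2 * profile u s B r ^ 2 = (B / (u B - u s)) ^ 2 * (u r - u s) ^ 2 := by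
      rw [profile]
      field_simp
    rw [e]
    gcongr
    have := hpos r hr
    have p1 := h.pos s hs
    have p2 := h.pos r (hs.trans_le hr.1)
    have p3 : 0 ≤ u r - u s := by
      by_contra hn
      push Not at hn
      nlinarith
    nlinarith
  · refine le_trans ?_ (h.lintegral_tail_le hv ha haB)
    refine setLIntegral_mono' measurableSet_Ioi fun r hr => ?_
    have : max s (min r B) = B := by
      rw [min_eq_right (show B < r from hr).le, max_eq_right hsB.le]
    have e : profile u s B B = 1 := by
      rw [profile]
      field_simp
    rw [this, e, mul_comm]
    simp

/-- The defect is at most `1` inside radius `a'`, and between `a'` and `B` it is at most that of the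
hard-core profile of radius `a'`. The two radial integrals add up to `B³/3 - B² (B - a')/3 = B²
a'/3`. -/
theorem IsScatteringSolution.lintegral_defect (h : IsScatteringSolution v R u u')
    (hs : R < s) (hsB : s < B) {a' : ℝ} (hsa : s ≤ a') (ha' : a' < B)
    (hstar : (B - a') * u' B ≤ u B - u s) :
    ∫⁻ y : E3, ENNReal.ofReal (1 - radial s B (profile u s B) y ^ 2)
      ≤ ENNReal.ofReal (4 * Real.pi * (B ^ 2 * a' / 3)) := by
  have h0 := h.core_nonneg
  have h1 : 0 < u B - u s := by linarith [h.lt hs.le hsB]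
  have hB0 : 0 < B := by linarith
  have hBa : 0 < B - a' := by linarith
  have ha0 : 0 < a' := by linarith
  have cf : Continuous fun r : ℝ => profile u s B (max s (min r B)) := by
    have : ContinuousOn (profile u s B) (Icc s B) := fun r hr =>
      (h.hasDerivAt_profile hs hr.1).continuousAt.continuousWithinAt
    exact this.comp_continuous (by fun_prop) fun r => clamp_mem hsB.le r
  have hm : Measurable fun r : ℝ =>
      ENNReal.ofReal (1 - profile u s B (max s (min r B)) ^ 2) :=
    ((cf.measurable.pow_const 2).const_sub 1).ennreal_ofReal
  unfold radial
  rw [lintegral_fun_norm hm, ENNReal.ofReal_mul (p := 4 * Real.pi) (by positivity)]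
  gcongr
  have e1 : ∫ r in (0 : ℝ)..a', r ^ 2 = a' ^ 3 / 3 := by
    rw [integral_pow]
    norm_num
  have e2 : ∫ r in a'..B, (r ^ 2 - (B / (B - a') * (r - a')) ^ 2)
      = B ^ 3 / 3 - a' ^ 3 / 3 - (B / (B - a')) ^ 2 * ((B - a') ^ 3 / 3) := by
    have i1 : IntervalIntegrable (fun r : ℝ => r ^ 2) volume a' B :=
      (by fun_prop : Continuous fun r : ℝ => r ^ 2).intervalIntegrable _ _
    have i2 : IntervalIntegrable (fun r : ℝ => (B / (B - a') * (r - a')) ^ 2) volume a' B :=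
      (by fun_prop : Continuous fun r : ℝ => (B / (B - a') * (r - a')) ^ 2).intervalIntegrable _ _
    rw [intervalIntegral.integral_sub i1 i2, integral_pow]
    simp_rw [mul_pow]
    rw [intervalIntegral.integral_const_mul,
      intervalIntegral.integral_comp_sub_right (fun r => r ^ 2) a', integral_pow]
    norm_num
    ring
  have p1 : 0 ≤ a' ^ 3 / 3 := by positivity
  have hpoly : ∀ r ∈ Icc a' B, 0 ≤ r ^ 2 - (B / (B - a') * (r - a')) ^ 2 := fun r hr => by
    have hr1 := hr.1
    have hr2 := hr.2
    have k1 : B / (B - a') * (r - a') ≤ r := by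
      rw [div_mul_eq_mul_div, div_le_iff₀ hBa]
      nlinarith
    have k2 : 0 ≤ B / (B - a') * (r - a') := mul_nonneg (by positivity) (by linarith)
    linarith [pow_le_pow_left₀ k2 k1 2]
  have p2 : 0 ≤ ∫ r in a'..B, (r ^ 2 - (B / (B - a') * (r - a')) ^ 2) :=
    intervalIntegral.integral_nonneg ha'.le hpoly
  have eJ : B ^ 2 * a' / 3
      = (∫ r in (0 : ℝ)..a', r ^ 2) + ∫ r in a'..B, (r ^ 2 - (B / (B - a') * (r - a')) ^ 2) := by
    rw [e1, e2]
    field_simp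
    ring
  rw [eJ, ENNReal.ofReal_add (e1 ▸ p1) p2,
    ofReal_intervalIntegral ha0.le ((by fun_prop : Continuous fun r : ℝ =>
      r ^ 2).intervalIntegrable _ _) fun r _ => sq_nonneg r,
    ofReal_intervalIntegral ha'.le ((by fun_prop : Continuous fun r : ℝ =>
      r ^ 2 - (B / (B - a') * (r - a')) ^ 2).intervalIntegrable _ _) hpoly]
  have hsub : Ioi (0 : ℝ) ⊆ (Icc 0 a' ∪ Icc a' B) ∪ Ioi B := fun r hr => by
    rcases le_or_gt r a' with h1 | h1
    · exact Or.inl (Or.inl ⟨(show 0 < r from hr).le, h1⟩)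
    rcases le_or_gt r B with h2 | h2
    · exact Or.inl (Or.inr ⟨h1.le, h2⟩)
    · exact Or.inr h2
  refine (lintegral_mono_set hsub).trans ((lintegral_union_le _ _ _).trans ?_)
  have z : ∫⁻ r in Ioi B, ENNReal.ofReal (r ^ 2)
      * ENNReal.ofReal (1 - profile u s B (max s (min r B)) ^ 2) = 0 := by
    rw [setLIntegral_congr_fun measurableSet_Ioi (g := fun _ => 0), lintegral_zero]
    intro r hr
    have : max s (min r B) = B := by
      rw [min_eq_right (show B < r from hr).le, max_eq_right hsB.le]
    have e : profile u s B B = 1 := by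
      rw [profile]
      field_simp
    simp [this, e]
  rw [z, add_zero]
  refine (lintegral_union_le _ _ _).trans (add_le_add ?_ ?_)
  · refine lintegral_mono fun r => mul_le_of_le_one_right' ?_
    rw [ENNReal.ofReal_le_one]
    linarith [sq_nonneg (profile u s B (max s (min r B)))]
  · refine setLIntegral_mono' measurableSet_Icc fun r hr => ?_
    have hr' : r ∈ Icc s B := ⟨hsa.trans hr.1, hr.2⟩
    have : max s (min r B) = r := by rw [min_eq_left hr'.2, max_eq_right hr'.1]
    rw [this, ← ENNReal.ofReal_mul (sq_nonneg _)]
    refine ENNReal.ofReal_le_ofReal ?_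
    have k1 := h.le_profile hs hsB ha' hstar hr'
    have k2 : 0 ≤ B / (B - a') * (r - a') := mul_nonneg (by positivity) (by linarith [hr.1])
    have := pow_le_pow_left₀ k2 k1 2
    rw [mul_pow r] at this
    linarith

/-- The pair factors that are used for the upper bound. -/
theorem IsScatteringLength.exists_pairBounds (h : IsScatteringLength v a) (hv : Measurable v)
    {a' : ℝ} (h1 : a < a') (h2 : a' < B) :
    ∃ ζ I Iv, PairBounds v ζ I Iv (4 * Real.pi * (B ^ 2 * a' / 3))
        (4 * Real.pi * (a' * B / (B - a') * B)) ∧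
      I + Iv / 2 ≤ 4 * Real.pi * (a' * B / (B - a')) := by
  have ha0 := h.nonneg
  obtain ⟨R, u, u', h, ha⟩ := h
  have h0 := h.core_nonneg
  have hRa := h.core_le ha
  obtain ⟨s, s1, s2, s3, s4⟩ := h.exists_cutoff ha h1 h2
  have hsB : s < B := by linarith
  have hs0 : 0 < s := by linarith
  have hB0 : 0 < B := by linarith
  have hBa : 0 < B - a' := by linarith
  have ha'0 : 0 < a' := by linarith
  have haB : a < B := by linarith
  have w0 : 0 < u B - u s := by linarith [h.lt s1.le hsB]
  have htail := h.tail_nonneg hv ha haB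
  have cφ := h.continuousOn_profileDeriv hv s1 hsB.le
  have φ0 : ∀ r ∈ Icc s B, 0 ≤ profileDeriv u u' s B r :=
    fun r hr => h.profileDeriv_nonneg s1 hsB hr.1
  have hpos : ∀ r ∈ Icc s B, 0 ≤ (u r - u s) * u r := fun r hr => h.sub_mul_nonneg s1 hr.1
  have hI : 0 ≤ ∫ r in s..B, (v r).toReal * ((u r - u s) * u r) :=
    intervalIntegral.integral_nonneg hsB.le fun r hr =>
      mul_nonneg ENNReal.toReal_nonneg (hpos r hr)
  have hgrad := gradNorm_radial_le hs0 (fun r hr => h.hasDerivAt_profile s1 (B := B) hr.1) φ0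
  refine ⟨radial s B (profile u s B), 4 * Real.pi * ∫ r in s..B, r ^ 2 * profileDeriv u u' s B r ^ 2,
    4 * Real.pi * ((B / (u B - u s)) ^ 2
          * (∫ r in s..B, (v r).toReal * ((u r - u s) * u r))
          + 2 * (a + B - B ^ 2 * u' B / u B + a ^ 2 / (B - a))),
    ⟨h.isPairFactor_profile hv s1 hsB, ?_, ?_, by positivity, by positivity, ?_,
      h.lintegral_potential hv ha s1 hsB haB, h.lintegral_defect s1 hsB s2.le h2 s3, ?_⟩, ?_⟩
  · refine mul_nonneg (by positivity) (intervalIntegral.integral_nonneg hsB.le fun r _ => ?_)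
    positivity
  · have : 0 ≤ (B / (u B - u s)) ^ 2
          * (∫ r in s..B, (v r).toReal * ((u r - u s) * u r)) := by positivity
    exact mul_nonneg (by positivity) (by linarith)
  · rw [← lintegral_norm_indicator hs0 hsB.le (g := fun r => profileDeriv u u' s B r ^ 2)
      (cφ.pow 2) fun r _ => sq_nonneg _]
    refine lintegral_mono_ae ?_
    filter_upwards [hgrad] with y hy
    refine ENNReal.ofReal_le_ofReal ?_
    by_cases hr : ‖y‖ ∈ Icc s B
    · rw [indicator_of_mem hr] at hy ⊢
      exact pow_le_pow_left₀ (norm_nonneg _) hy 2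
    · rw [indicator_of_notMem hr] at hy ⊢
      have : gradNorm (radial s B (profile u s B)) y = 0 := le_antisymm hy (norm_nonneg _)
      simp [this]
  -- The integrand is bounded by a constant on an interval of length at most `B`.
  · have hle : ∫ r in s..B, r ^ 2 * profileDeriv u u' s B r ≤ a' * B / (B - a') * B := by
      have i1 : IntervalIntegrable (fun r => r ^ 2 * profileDeriv u u' s B r) volume s B :=
        ContinuousOn.intervalIntegrable_of_Icc hsB.le (by fun_prop)
      have := intervalIntegral.integral_mono_on hsB.le i1 intervalIntegrable_const
        fun r hr => h.sq_mul_profileDeriv_le s1 hsB h2 s3 hr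
      rw [intervalIntegral.integral_const, smul_eq_mul] at this
      refine this.trans ?_
      rw [mul_comm]
      gcongr
      linarith
    refine le_trans ?_ (ENNReal.ofReal_le_ofReal (mul_le_mul_of_nonneg_left hle (by positivity)))
    rw [← lintegral_norm_indicator hs0 hsB.le cφ φ0]
    exact lintegral_mono_ae (hgrad.mono fun y hy => ENNReal.ofReal_le_ofReal hy)
  · rw [h.integral_sq_profileDeriv hv s1 hsB, h.integral_source hv s1 hsB.le]
    have uB := h.pos B (by linarith)
    -- When the kinetic energy and half of the potential energy are added, the integrals of `u'²`
    -- cancel, and so do the terms `-B` and `+B`. What remains is `a B/(B - a)` plus the effect of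
    -- the shift by `u s`, which the choice of `s` bounds by the difference to `a' B/(B - a')`.
    have key : B ^ 2 * u' B / (u B - u s) + a - B ^ 2 * u' B / u B + a ^ 2 / (B - a)
        ≤ a' * B / (B - a') := by
      have e1 : B ^ 2 * u' B * u s / ((u B - u s) * u B)
          = B ^ 2 * u' B / (u B - u s) - B ^ 2 * u' B / u B := by
        field_simp
        ring
      have e2 : a * B / (B - a) = a + a ^ 2 / (B - a) := by
        have : B - a ≠ 0 := by linarith
        field_simp
        ring
      linarith
    have e3 : (B / (u B - u s)) ^ 2 * ((u B - u s) * u' B) = B ^ 2 * u' B / (u B - u s) := by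
      field_simp
    have := mul_le_mul_of_nonneg_left key (by positivity : 0 ≤ 4 * Real.pi)
    nlinarith [Real.pi_pos]

end Scattering

/-! ### The upper bound in terms of the scattering length -/

/-- The pair factors are available only for radii `r > a`, but the bound is continuous in `r`, so
`r` may decrease to `a`. The hypothesis `hMB` ensures `M J < 1`, because `M J` is `M` times the
volume of the ball of radius `B`, times `r/B`. -/
theorem qmEnergy_le_of_range {N : ℕ} {V : E3 → ℝ} {v : ℝ → ℝ≥0∞} {a : ℝ} {Φ : E3 → ℝ}
    {D : Fin 3 → E3 → ℝ} {M B : ℝ} (hV : IsTrap V) (hN : 0 < N) (hv : Measurable v)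
    (ha : IsScatteringLength v a) (h : GPData V N a Φ D) (hM : ∀ᵐ y, Φ y ^ 2 ≤ M) (hM0 : 0 ≤ M)
    (haB : a < B) (hMB : M * (4 * Real.pi * (B ^ 3 / 3)) ≤ 1) :
    qmEnergy N V v ≤ ENNReal.ofReal (totalMu V a Φ D
      - 8 * Real.pi * a * ((∫ x, Φ x ^ 4) - N * (M * (M * (4 * Real.pi * (B ^ 2 * a / 3)))))
      + (∫ x, Φ x ^ 4) * (4 * Real.pi * (a * B / (B - a)))
        / (1 - M * (4 * Real.pi * (B ^ 2 * a / 3))) ^ 2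
      + N * (M * (4 * Real.pi * (a * B / (B - a) * B))) ^ 2
        / (1 - M * (4 * Real.pi * (B ^ 2 * a / 3))) ^ 3) := by
  have ha0 := ha.nonneg
  have hB0 : 0 < B := by linarith
  have hlt : ∀ r, 0 ≤ r → r < B → M * (4 * Real.pi * (B ^ 2 * r / 3)) < 1 := fun r hr hrB => by
    have e : M * (4 * Real.pi * (B ^ 2 * r / 3)) = M * (4 * Real.pi * (B ^ 3 / 3)) * (r / B) := by
      field_simp
    have h1 : r / B < 1 := (div_lt_one hB0).2 hrB
    have h2 : 0 ≤ r / B := by positivity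
    rw [e]
    nlinarith
  have hbound : ∀ r ∈ Ioo a B, qmEnergy N V v ≤ ENNReal.ofReal (totalMu V a Φ D
      - 8 * Real.pi * a * ((∫ x, Φ x ^ 4) - N * (M * (M * (4 * Real.pi * (B ^ 2 * r / 3)))))
      + (∫ x, Φ x ^ 4) * (4 * Real.pi * (r * B / (B - r)))
        / (1 - M * (4 * Real.pi * (B ^ 2 * r / 3))) ^ 2
      + N * (M * (4 * Real.pi * (r * B / (B - r) * B))) ^ 2
        / (1 - M * (4 * Real.pi * (B ^ 2 * r / 3))) ^ 3) := fun r hr => by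
    obtain ⟨ζ, I, Iv, hζ, hI⟩ := ha.exists_pairBounds hv hr.1 hr.2
    have hθ := hlt r (ha0.trans hr.1.le) hr.2
    refine (qmEnergy_le_of_pairBounds hV hN ha0 h hv hM hM0 hζ hθ).trans
      (ENNReal.ofReal_le_ofReal ?_)
    have : 0 < 1 - M * (4 * Real.pi * (B ^ 2 * r / 3)) := by linarith
    gcongr
  have hev : ∀ᶠ r in 𝓝[>] a, r ∈ Ioo a B := Ioo_mem_nhdsGT haB
  have hne : B - a ≠ 0 := by linarith
  have hθa : (1 - M * (4 * Real.pi * (B ^ 2 * a / 3))) ≠ 0 := by linarith [hlt a ha0 haB]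
  refine ge_of_tendsto ?_ (hev.mono hbound)
  refine (ENNReal.continuous_ofReal.tendsto _).comp (tendsto_nhdsWithin_of_tendsto_nhds
    (ContinuousAt.tendsto ?_))
  fun_prop (disch := first | exact hne | exact pow_ne_zero _ hθa)

/-- The error of the trial state, for the two choices of the range of the pair factor. -/
theorem trial_error_le {c h β : ℝ} (hc : 0 < c) (h0 : 0 ≤ h) (h1 : h < 1)
    (hβ : β = if h ≤ 1 / 3 then 1 / 2 else 1) :
    2 * (β ^ 2 * h) / c + 1 / ((1 - h / β) * (1 - β ^ 2 * h) ^ 2)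
        + 3 / c * (β ^ 2 * h) / ((1 - β ^ 2 * h) ^ 3 * (1 - h / β) ^ 2)
      ≤ (1 + 2 / c * h - 2 / c * h ^ 2 + 1 / (2 * c) * h ^ 3) / (1 - h) ^ 8 := by
  -- The numerator is `1 + (2h/c)(1 - h/2)²`, so the comparison splits into the part free of `1/c`
  -- and the part proportional to `h/c`.
  have e : (1 + 2 / c * h - 2 / c * h ^ 2 + 1 / (2 * c) * h ^ 3) / (1 - h) ^ 8
      = 1 / (1 - h) ^ 8 + h / c * (2 * (1 - h / 2) ^ 2 / (1 - h) ^ 8) := by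
    field_simp
    ring
  have p : 0 < 1 - h := by linarith
  have hhc : 0 ≤ h / c := by positivity
  rw [e]
  -- For small `h` the left side has `5 β² h/c` as leading part proportional to `1/c`, against `2
  -- h/c` on the right: `β = 1` fails, while `β = 1/2` gives `5/4`. The latter needs `h < 1/2` and
  -- is therefore used only up to `1/3`.
  split_ifs at hβ with h3
  · subst hβ
    have e2 : 2 * ((1 / 2 : ℝ) ^ 2 * h) / c + 1 / ((1 - h / (1 / 2)) * (1 - (1 / 2) ^ 2 * h) ^ 2)
        + 3 / c * ((1 / 2) ^ 2 * h) / ((1 - (1 / 2) ^ 2 * h) ^ 3 * (1 - h / (1 / 2)) ^ 2)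
        = 1 / ((1 - 2 * h) * (1 - h / 4) ^ 2)
          + h / c * (1 / 2 + 3 / 4 / ((1 - h / 4) ^ 3 * (1 - 2 * h) ^ 2)) := by
      have k1 : 1 - h / (1 / 2) = 1 - 2 * h := by ring
      have k2 : 1 - (1 / 2 : ℝ) ^ 2 * h = 1 - h / 4 := by ring
      rw [k1, k2]
      have : 1 - 2 * h ≠ 0 := by linarith
      have : 1 - h / 4 ≠ 0 := by linarith
      field_simp
      ring
    rw [e2]
    -- Equivalent to `3h - h² ≤ 1` for positive `h`, which holds up to `h = 1/3`.
    have q1 : (1 - h) ^ 3 ≤ 1 - 2 * h := by nlinarith [mul_nonneg h0 h0]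
    have q2 : 1 - h ≤ 1 - h / 4 := by linarith
    have q3 : 1 - h ≤ (1 - h / 2) ^ 2 := by nlinarith
    have q4 : 1 - h ≤ (1 - h / 4) ^ 3 := by nlinarith [mul_nonneg h0 h0]
    have r2 : 0 < 1 - 2 * h := by linarith
    have r4 : 0 < 1 - h / 4 := by linarith
    have hp8 : (1 - h) ^ 8 ≤ 1 - h := by
      simpa using pow_le_pow_of_le_one p.le (by linarith) (by norm_num : 1 ≤ 8)
    have hp5 : (1 - h) ^ 8 ≤ (1 - h) ^ 5 :=
      pow_le_pow_of_le_one p.le (by linarith) (by norm_num)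
    refine add_le_add ?_ (mul_le_mul_of_nonneg_left ?_ hhc)
    · refine one_div_le_one_div_of_le (by positivity) (hp5.trans ?_)
      calc (1 - h) ^ 5 = (1 - h) ^ 3 * (1 - h) ^ 2 := by ring
        _ ≤ _ := by gcongr
    · have s1 : 1 / 2 ≤ (1 / 2) * (1 - h / 2) ^ 2 / (1 - h) ^ 8 := by
        rw [le_div_iff₀ (by positivity)]
        linarith
      have s2 : 3 / 4 / ((1 - h / 4) ^ 3 * (1 - 2 * h) ^ 2)
          ≤ (3 / 2) * (1 - h / 2) ^ 2 / (1 - h) ^ 8 := by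
        rw [div_le_div_iff₀ (by positivity) (by positivity)]
        have k1 : (1 - h) ^ 6 ≤ (1 - 2 * h) ^ 2 := by
          calc (1 - h) ^ 6 = ((1 - h) ^ 3) ^ 2 := by ring
            _ ≤ _ := by gcongr
        have k2 : (1 - h) ^ 2 ≤ (1 - h / 2) ^ 2 * (1 - h / 4) ^ 3 := by
          rw [sq (1 - h)]
          gcongr
        have k3 : (1 - h) ^ 2 * (1 - h) ^ 6
            ≤ (1 - h / 2) ^ 2 * (1 - h / 4) ^ 3 * (1 - 2 * h) ^ 2 := by gcongr
        have k4 : 0 ≤ (1 - h / 2) ^ 2 * (1 - h / 4) ^ 3 * (1 - 2 * h) ^ 2 := by positivity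
        nlinarith
      calc _ ≤ _ := add_le_add s1 s2
        _ = _ := by ring
  · subst hβ
    push Not at h3
    have e2 : 2 * ((1 : ℝ) ^ 2 * h) / c + 1 / ((1 - h / 1) * (1 - 1 ^ 2 * h) ^ 2)
        + 3 / c * (1 ^ 2 * h) / ((1 - 1 ^ 2 * h) ^ 3 * (1 - h / 1) ^ 2)
        = 1 / (1 - h) ^ 3 + h / c * ((2 * (1 - h) ^ 8 + 3 * (1 - h) ^ 3) / (1 - h) ^ 8) := by
      rw [div_one, one_pow, one_mul]
      field_simp
      ring
    rw [e2]
    refine add_le_add (one_div_le_one_div_of_le (by positivity)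
      (pow_le_pow_of_le_one p.le (by linarith) (by norm_num))) (mul_le_mul_of_nonneg_left ?_ hhc)
    gcongr
    -- In terms of `x = 1 - h < 2/3` the claim is `2 x⁸ + 3 x³ ≤ (1 + x)²/2`, and linear bounds for
    -- the powers suffice.
    obtain ⟨x, rfl⟩ : ∃ x, h = 1 - x := ⟨1 - h, by ring⟩
    have x1 : 0 < x := by linarith
    have x2 : x < 2 / 3 := by linarith
    have x3 : x ^ 3 ≤ (4 / 9) * x := by nlinarith
    have x8 : x ^ 8 ≤ x ^ 3 := pow_le_pow_of_le_one x1.le (by linarith) (by norm_num)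
    have x6 : x ^ 8 ≤ (1 / 10) * x := by
      have : x ^ 6 ≤ (2 / 3) ^ 6 := by gcongr
      nlinarith [pow_pos x1 6]
    have : 1 - (1 - x) = x := by ring
    rw [this]
    nlinarith

/-! ### The parameters of the density and the explicit upper bound -/

theorem maxDensity_congr {Φ Φ' : E3 → ℝ} (h : Φ' =ᵐ[volume] Φ) :
    maxDensity Φ' = maxDensity Φ := by
  rw [maxDensity, maxDensity, eLpNorm_congr_ae (g := fun x => Φ x ^ 2)
    (h.mono fun x hx => by simp only [hx])]

theorem integral_pow_four_congr {Φ Φ' : E3 → ℝ} (h : Φ' =ᵐ[volume] Φ) :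
    ∫ x, Φ' x ^ 4 = ∫ x, Φ x ^ 4 :=
  integral_congr_ae (h.mono fun x hx => by simp only [hx])

theorem meanDensity_congr {N : ℕ} {Φ Φ' : E3 → ℝ} (h : Φ' =ᵐ[volume] Φ) :
    meanDensity N Φ' = meanDensity N Φ := by
  rw [meanDensity, meanDensity, integral_pow_four_congr h]

theorem cParam_congr {N : ℕ} {Φ Φ' : E3 → ℝ} (h : Φ' =ᵐ[volume] Φ) :
    cParam N Φ' = cParam N Φ := by
  rw [cParam, cParam, meanDensity_congr h, maxDensity_congr h]

theorem bParam_congr {N : ℕ} {Φ Φ' : E3 → ℝ} (h : Φ' =ᵐ[volume] Φ) :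
    bParam N Φ' = bParam N Φ := by
  rw [bParam, bParam, meanDensity_congr h, cParam_congr h]

theorem meanDensity_nonneg (N : ℕ) (Φ : E3 → ℝ) : 0 ≤ meanDensity N Φ := by
  have : 0 ≤ ∫ x, Φ x ^ 4 := integral_nonneg fun x => by positivity
  rw [meanDensity]
  positivity

theorem maxDensity_nonneg (Φ : E3 → ℝ) : 0 ≤ maxDensity Φ := ENNReal.toReal_nonneg

theorem sq_le_maxDensity {Φ : E3 → ℝ} (h : maxDensity Φ ≠ 0) :
    ∀ᵐ x, Φ x ^ 2 ≤ maxDensity Φ := by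
  have hfin : eLpNorm (fun x => Φ x ^ 2) ⊤ volume ≠ ⊤ := fun h' => h (by rw [maxDensity, h']; rfl)
  filter_upwards [ae_le_eLpNormEssSup (f := fun x => Φ x ^ 2) (μ := volume)] with x hx
  rw [← eLpNorm_exponent_top] at hx
  have := ENNReal.toReal_mono hfin hx
  simpa [maxDensity] using this

/-- The mean density cancels in the definition of `b`, leaving `(4π/3) ‖ρ‖_∞ b³ = 1`. -/
theorem bParam_pow_three {N : ℕ} {Φ : E3 → ℝ} (h1 : 0 < meanDensity N Φ) :
    bParam N Φ ^ 3 = 3 / (4 * Real.pi * maxDensity Φ) := by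
  have h2 := maxDensity_nonneg Φ
  rw [bParam, cParam, ← Real.rpow_natCast, ← Real.rpow_mul (by positivity)]
  norm_num
  field_simp

/-- By the conventions for division by zero and for `ENNReal.toReal ⊤`, a vanishing mean density and
a vanishing or infinite supremum all lead to `b = 0`. Thus `a < b` with `a ≥ 0` already guarantees
that the density is nondegenerate and bounded. -/
theorem meanDensity_pos_of_lt_bParam {N : ℕ} {Φ : E3 → ℝ} (h : 0 < bParam N Φ) :
    0 < meanDensity N Φ ∧ 0 < maxDensity Φ := by
  constructor
  · refine lt_of_le_of_ne (meanDensity_nonneg N Φ) fun h' => h.ne' ?_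
    rw [bParam, ← h']
    norm_num
  · refine lt_of_le_of_ne (maxDensity_nonneg Φ) fun h' => h.ne' ?_
    rw [bParam, cParam, ← h']
    norm_num

/-- The range is `β b`. Since `totalMu` minus `8πa ∫ Φ⁴` is the quadratic energy, all errors are
carried by the interaction term; the denominator under the quadratic energy is only a weakening. -/
theorem qmEnergy_le_of_lt_bParam {N : ℕ} {V : E3 → ℝ} {v : ℝ → ℝ≥0∞} {a : ℝ} {Φ : E3 → ℝ}
    {D : Fin 3 → E3 → ℝ} (hV : IsTrap V) (hN : 0 < N) (hv : Measurable v)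
    (ha : IsScatteringLength v a) (h : GPData V N a Φ D) (hab : a < bParam N Φ) :
    qmEnergy N V v ≤ ENNReal.ofReal
      (quadEnergy V Φ D / (1 - a / bParam N Φ) ^ 3
        + 4 * Real.pi * a * (∫ x, Φ x ^ 4)
          * ((1 + 2 / cParam N Φ * (a / bParam N Φ) - 2 / cParam N Φ * (a / bParam N Φ) ^ 2
              + 1 / (2 * cParam N Φ) * (a / bParam N Φ) ^ 3) / (1 - a / bParam N Φ) ^ 8)) := by
  have ha0 := ha.nonneg
  have hb0 : 0 < bParam N Φ := by linarith
  obtain ⟨hm, hM0⟩ := meanDensity_pos_of_lt_bParam hb0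
  have hM := sq_le_maxDensity hM0.ne'
  have hb3 := bParam_pow_three hm
  have hc : 0 < cParam N Φ := div_pos hm hM0
  have hN' : (0 : ℝ) < N := by exact_mod_cast hN
  have hD : ∫ x, Φ x ^ 4 = cParam N Φ * maxDensity Φ * N := by
    rw [cParam, meanDensity]
    field_simp
  set b := bParam N Φ with hb
  set M := maxDensity Φ with hMdef
  set c := cParam N Φ with hcdef
  have h1 : a / b < 1 := (div_lt_one hb0).2 hab
  have h0 : 0 ≤ a / b := by positivity
  have hMb : M = 3 / (4 * Real.pi * b ^ 3) := by
    rw [hb3]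
    field_simp
  obtain ⟨β, hβ⟩ : ∃ β : ℝ, β = if a / b ≤ 1 / 3 then 1 / 2 else 1 := ⟨_, rfl⟩
  have hβ1 : 0 < β ∧ β ≤ 1 ∧ a / b < β := by
    rw [hβ]
    split_ifs with h3
    · norm_num
      linarith
    · norm_num
      linarith
  obtain ⟨β0, β1, hhβ⟩ := hβ1
  have key := qmEnergy_le_of_range (B := β * b) hV hN hv ha h hM hM0.le
    (by rwa [div_lt_iff₀ hb0] at hhβ) (by
      have : M * (4 * Real.pi * ((β * b) ^ 3 / 3)) = β ^ 3 := by
        rw [hMb]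
        field_simp
      rw [this]
      exact pow_le_one₀ β0.le β1)
  refine key.trans (ENNReal.ofReal_le_ofReal ?_)
  have hq := quadEnergy_nonneg hV (Φ := Φ) (D := D)
  have hq' : quadEnergy V Φ D ≤ quadEnergy V Φ D / (1 - a / b) ^ 3 :=
    le_div_self hq (pow_pos (by linarith) 3) (pow_le_one₀ (by linarith) (by linarith))
  have herr := trial_error_le hc h0 h1 hβ
  have hD0 : 0 ≤ ∫ x, Φ x ^ 4 := integral_nonneg fun x => by positivity
  have hmul := mul_le_mul_of_nonneg_left herr (by positivity : 0 ≤ 4 * Real.pi * a * ∫ x, Φ x ^ 4)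
  -- With `(4π/3) M b³ = 1` and `∫ Φ⁴ = c M N`, the general bound becomes exactly the quadratic
  -- energy plus `4πa ∫ Φ⁴` times the left side of `trial_error_le`.
  refine le_trans (le_of_eq ?_) (add_le_add hq' hmul)
  have e1 : M * (4 * Real.pi * ((β * b) ^ 2 * a / 3)) = β ^ 2 * (a / b) := by
    rw [hMb]
    field_simp
  have k1 : 1 - a / b / β ≠ 0 := by
    have : a / b / β < 1 := (div_lt_one β0).2 hhβ
    linarith
  have k2 : 1 - β ^ 2 * (a / b) ≠ 0 := by
    have : β ^ 2 * (a / b) < 1 := by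
      have : β ^ 2 ≤ 1 := pow_le_one₀ β0.le β1
      nlinarith
    linarith
  have e2 : a * (β * b) / (β * b - a) = a / (1 - a / b / β) := by
    have : β * b - a ≠ 0 := by
      have := (div_lt_iff₀ hb0).1 hhβ
      linarith
    have : β * b * (1 - a / b / β) = β * b - a := by field_simp
    rw [← this]
    field_simp
  have e3 : N * (M * (4 * Real.pi * (a / (1 - a / b / β) * (β * b)))) ^ 2
      = 4 * Real.pi * a * (∫ x, Φ x ^ 4) * (3 / c * (β ^ 2 * (a / b)) / (1 - a / b / β) ^ 2) := by
    rw [hD]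
    have : b * M * Real.pi * 4 * b ^ 2 = 3 := by
      rw [hMb]
      field_simp
    have e : (M * (4 * Real.pi * (a / (1 - a / b / β) * (β * b)))) ^ 2
      = M * (4 * Real.pi * a) * (b * M * Real.pi * 4 * b ^ 2) * (β ^ 2 * (a / b))
        / (1 - a / b / β) ^ 2 := by
      field_simp
    rw [e, this]
    field_simp
  rw [e1, e2, e3, totalMu]
  have e4 : 8 * Real.pi * a * (N * (M * (β ^ 2 * (a / b))))
      = 4 * Real.pi * a * (∫ x, Φ x ^ 4) * (2 * (β ^ 2 * (a / b)) / c) := by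
    rw [hD]
    field_simp
    ring
  have e5 : 8 * Real.pi * a * ((∫ x, Φ x ^ 4) - N * (M * (β ^ 2 * (a / b))))
      = 8 * Real.pi * a * (∫ x, Φ x ^ 4)
        - 4 * Real.pi * a * (∫ x, Φ x ^ 4) * (2 * (β ^ 2 * (a / b)) / c) := by
    rw [← e4]
    ring
  rw [e5]
  field_simp
  ring

/-! ### The relative error -/

theorem one_div_one_sub_pow_eight_le {h : ℝ} (h0 : 0 ≤ h) (h1 : h ≤ 1 / 2) :
    1 / (1 - h) ^ 8 ≤ 1 + 510 * h := by
  have p : 0 < 1 - h := by linarith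
  -- Three successive squarings turn `1 + 2h` into `1 + 6h`, `1 + 30h` and `1 + 510h`, each time
  -- with `h² ≤ h/2`.
  have e1 : 1 / (1 - h) ≤ 1 + 2 * h := by
    rw [div_le_iff₀ p]
    nlinarith
  have e2 : (1 + 2 * h) ^ 2 ≤ 1 + 6 * h := by nlinarith
  have e4 : (1 + 6 * h) ^ 2 ≤ 1 + 30 * h := by nlinarith
  have e8 : (1 + 30 * h) ^ 2 ≤ 1 + 510 * h := by nlinarith
  calc 1 / (1 - h) ^ 8 = (((1 / (1 - h)) ^ 2) ^ 2) ^ 2 := by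
        rw [← pow_mul, ← pow_mul, one_div_pow]
    _ ≤ (((1 + 2 * h) ^ 2) ^ 2) ^ 2 := by gcongr
    _ ≤ ((1 + 6 * h) ^ 2) ^ 2 := by gcongr
    _ ≤ (1 + 30 * h) ^ 2 := by gcongr
    _ ≤ _ := e8

theorem energy_bound_le {c c₀ h q d : ℝ} (hc₀ : 0 < c₀) (hc : c₀ ≤ c) (h0 : 0 ≤ h)
    (h1 : h ≤ 1 / 2) (hq : 0 ≤ q) (hd : 0 ≤ d) :
    q / (1 - h) ^ 3 + d * ((1 + 2 / c * h - 2 / c * h ^ 2 + 1 / (2 * c) * h ^ 3) / (1 - h) ^ 8)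
      ≤ (q + d) * (1 + (510 + 512 / c₀) * h) := by
  have hc' : 0 < c := by linarith
  have p : 0 < 1 - h := by linarith
  have e8 := one_div_one_sub_pow_eight_le h0 h1
  have e3 : 1 / (1 - h) ^ 3 ≤ 1 + 510 * h :=
    (one_div_le_one_div_of_le (by positivity)
      (pow_le_pow_of_le_one p.le (by linarith) (by norm_num))).trans e8
  have hs : 1 + 2 / c * h - 2 / c * h ^ 2 + 1 / (2 * c) * h ^ 3 ≤ 1 + 2 / c₀ * h := by
    have k1 : 1 + 2 / c * h - 2 / c * h ^ 2 + 1 / (2 * c) * h ^ 3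
        = 1 + 2 / c * (h * (1 - h / 2) ^ 2) := by
      field_simp
      ring
    have k2 : h * (1 - h / 2) ^ 2 ≤ h := by
      have : (1 - h / 2) ^ 2 ≤ 1 := pow_le_one₀ (by linarith) (by linarith)
      nlinarith
    rw [k1]
    gcongr
  have f1 : q / (1 - h) ^ 3 ≤ q * (1 + (510 + 512 / c₀) * h) := by
    rw [div_eq_mul_one_div]
    refine mul_le_mul_of_nonneg_left (e3.trans ?_) hq
    have : 0 ≤ 512 / c₀ * h := by positivity
    linarith
  have f2 : (1 + 2 / c * h - 2 / c * h ^ 2 + 1 / (2 * c) * h ^ 3) / (1 - h) ^ 8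
      ≤ 1 + (510 + 512 / c₀) * h := by
    rw [div_eq_mul_one_div]
    have g1 : (1 + 2 / c * h - 2 / c * h ^ 2 + 1 / (2 * c) * h ^ 3) * (1 / (1 - h) ^ 8)
        ≤ (1 + 2 / c₀ * h) * (1 + 510 * h) :=
      mul_le_mul hs e8 (by positivity) (by positivity)
    refine g1.trans ?_
    have g2 : 0 ≤ 1 / c₀ := by positivity
    have g3 : (1 + 2 / c₀ * h) * (1 + 510 * h) = 1 + 510 * h + 1 / c₀ * (2 * h + 1020 * h ^ 2) := by
      ring
    -- From `h ≤ 1/2`: `2 + 1020/2 = 512`.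
    have g4 : 2 * h + 1020 * h ^ 2 ≤ 512 * h := by nlinarith
    have g5 : 1 + (510 + 512 / c₀) * h = 1 + 510 * h + 1 / c₀ * (512 * h) := by ring
    rw [g3, g5]
    gcongr
  nlinarith [mul_le_mul_of_nonneg_left f2 hd]

/-- The relative error of the upper bound, in terms of a lower bound for `c`. -/
theorem qmEnergy_le_gpEnergy_mul {c₀ : ℝ} (hc₀ : 0 < c₀) : ∃ C δ : ℝ, 0 < C ∧ 0 < δ ∧
    ∀ (N : ℕ) (V : E3 → ℝ) (v : ℝ → ℝ≥0∞) (a : ℝ) (Φ : E3 → ℝ),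
      0 < N → IsTrap V → Measurable v → IsScatteringLength v a → IsGPMinimizer V N a Φ →
      c₀ ≤ cParam N Φ → a * meanDensity N Φ ^ (1 / 3 : ℝ) ≤ δ →
      qmEnergy N V v ≤ gpEnergy V N a
        * ENNReal.ofReal (1 + C * (a * meanDensity N Φ ^ (1 / 3 : ℝ))) := by
  -- Since `b ρ̄^{1/3} = (3c/4π)^{1/3} ≥ κ`, one has `a/b ≤ a ρ̄^{1/3}/κ`; the choice `δ = κ/2` then
  -- enforces `a/b ≤ 1/2`.
  set κ : ℝ := (3 * c₀ / (4 * Real.pi)) ^ (1 / 3 : ℝ) with hκ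
  have κ0 : 0 < κ := by positivity
  refine ⟨(510 + 512 / c₀) / κ, κ / 2, by positivity, by positivity, ?_⟩
  intro N V v a Φ hN hV hv ha hΦ hc hδ
  have ha0 := ha.nonneg
  obtain ⟨Φ', D, h, hae, -, hE⟩ := exists_gpData hV hN ha0 hΦ
  rw [← meanDensity_congr hae] at hδ ⊢
  rw [← cParam_congr hae] at hc
  have hcp : 0 < cParam N Φ' := by linarith
  have hm : 0 < meanDensity N Φ' := by
    refine lt_of_le_of_ne (meanDensity_nonneg N Φ') fun h' => hcp.ne' ?_
    rw [cParam, ← h', zero_div]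
  set m := meanDensity N Φ' with hmdef
  have hb : κ / m ^ (1 / 3 : ℝ) ≤ bParam N Φ' := by
    rw [bParam, hκ, ← Real.div_rpow (by positivity) hm.le]
    refine Real.rpow_le_rpow (by positivity) ?_ (by norm_num)
    rw [← hmdef, div_div]
    gcongr
  have hb0 : 0 < bParam N Φ' := lt_of_lt_of_le (by positivity) hb
  have hh : a / bParam N Φ' ≤ a * m ^ (1 / 3 : ℝ) / κ := by
    calc a / bParam N Φ' ≤ a / (κ / m ^ (1 / 3 : ℝ)) := by gcongr
      _ = _ := by field_simp
  have hh2 : a / bParam N Φ' ≤ 1 / 2 := by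
    refine hh.trans ?_
    rw [div_le_iff₀ κ0]
    linarith
  have hab : a < bParam N Φ' := by
    rw [div_le_iff₀ hb0] at hh2
    linarith
  have hh0 : 0 ≤ a / bParam N Φ' := by positivity
  have hq := quadEnergy_nonneg hV (Φ := Φ') (D := D)
  have hd : 0 ≤ 4 * Real.pi * a * ∫ x, Φ' x ^ 4 :=
    mul_nonneg (by positivity) (integral_nonneg fun x => by positivity)
  rw [hE, ← ENNReal.ofReal_mul (by positivity)]
  refine (qmEnergy_le_of_lt_bParam hV hN hv ha h hab).trans (ENNReal.ofReal_le_ofReal ?_)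
  refine (energy_bound_le hc₀ hc hh0 hh2 hq hd).trans (mul_le_mul_of_nonneg_left ?_ (by positivity))
  have := mul_le_mul_of_nonneg_left hh (by positivity : 0 ≤ 510 + 512 / c₀)
  calc 1 + (510 + 512 / c₀) * (a / bParam N Φ')
      ≤ 1 + (510 + 512 / c₀) * (a * m ^ (1 / 3 : ℝ) / κ) := by linarith
    _ = _ := by ring

/-! ### Lipschitz functions of compact support in the form domain -/

theorem integrable_of_bounded_support {f : E3 → ℝ} (hf : AEStronglyMeasurable f volume) {C r : ℝ}
    (hC : ∀ x, |f x| ≤ C) {x₀ : E3} (hr : ∀ x, x ∉ Metric.closedBall x₀ r → f x = 0) :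
    Integrable f := by
  rw [← integrableOn_iff_integrable_of_support_subset (s := Metric.closedBall x₀ r)
    fun x hx => by by_contra h; exact hx (hr x h)]
  exact Measure.integrableOn_of_bounded measure_closedBall_lt_top.ne hf (M := C)
    (.of_forall fun x => hC x)

theorem realWeakDeriv_of_lipschitz {f : E3 → ℝ} {C : NNReal} (hf : LipschitzWith C f) (w : E3) :
    RealWeakDeriv f (fun x => lineDeriv ℝ f x w) w := by
  have hm : Measurable (fun x => lineDeriv ℝ f x w) := measurable_lineDeriv hf.continuous
  refine ⟨hf.continuous.locallyIntegrable, ?_, fun φ h1 h2 => ?_⟩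
  · refine (locallyIntegrable_const (C * ‖w‖ : ℝ)).mono hm.aestronglyMeasurable
      (.of_forall fun x => ?_)
    rw [Real.norm_eq_abs, Real.norm_of_nonneg (by positivity)]
    exact abs_lineDeriv_le hf x w
  · obtain ⟨B, hB⟩ := h1.lipschitzWith_of_hasCompactSupport h2 (by simp)
    have e := hf.integral_lineDeriv_mul_eq (μ := volume) hB h2 w
    have hd : ∀ x, lineDeriv ℝ φ x (-w) = - fderiv ℝ φ x w := fun x => by
      rw [(h1.differentiable (by simp)).differentiableAt.lineDeriv_eq_fderiv, map_neg]
    simp_rw [hd, neg_mul, integral_neg] at e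
    simp_rw [mul_comm (φ _)]
    linarith

theorem formDomain_of_lipschitz {V : E3 → ℝ} (hV : IsTrap V) {f : E3 → ℝ} {C : NNReal}
    (hf : LipschitzWith C f) {x₀ : E3} {r : ℝ} (hr : ∀ x, x ∉ Metric.closedBall x₀ r → f x = 0) :
    FormDomain V f (fun k x => lineDeriv ℝ f x (dir k)) := by
  have hs : tsupport f ⊆ Metric.closedBall x₀ r :=
    closure_minimal (fun x hx => by by_contra h; exact hx (hr x h)) Metric.isClosed_closedBall
  have hc : HasCompactSupport f := (isCompact_closedBall x₀ r).of_isClosed_subset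
    (isClosed_tsupport f) hs
  obtain ⟨B, hB⟩ := hf.continuous.bounded_above_of_compact_support hc
  simp only [Real.norm_eq_abs] at hB
  have B0 : 0 ≤ B := (abs_nonneg _).trans (hB x₀)
  have hpow : ∀ n, n ≠ 0 → Integrable fun x => f x ^ n := fun n hn => by
    refine integrable_of_bounded_support (hf.continuous.pow n).aestronglyMeasurable (C := B ^ n)
      (fun x => ?_) (x₀ := x₀) (r := r) fun x hx => ?_
    · rw [abs_pow]
      exact pow_le_pow_left₀ (abs_nonneg _) (hB x) n
    · rw [hr x hx, zero_pow hn]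
  refine ⟨fun k => realWeakDeriv_of_lipschitz hf _, fun k => ?_, ?_, hpow 2 (by norm_num),
    hpow 4 (by norm_num)⟩
  · refine integrable_of_bounded_support
      ((measurable_lineDeriv hf.continuous).pow_const 2).aestronglyMeasurable
      (C := (C * ‖dir k‖) ^ 2) (fun x => ?_) (x₀ := x₀) (r := r) fun x hx => ?_
    · rw [abs_pow]
      exact pow_le_pow_left₀ (abs_nonneg _) (abs_lineDeriv_le hf x _) 2
    · have : x ∉ tsupport (fun y => lineDeriv ℝ f y (dir k)) :=
        fun h => hx (hs (tsupport_lineDeriv_subset f _ h))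
      rw [image_eq_zero_of_notMem_tsupport this]
      norm_num
  · obtain ⟨M, hM⟩ := hV.locallyBounded (‖x₀‖ + r)
    refine integrable_of_bounded_support
      (hV.measurable.mul (hf.continuous.measurable.pow_const 2)).aestronglyMeasurable
      (C := |M| * B ^ 2) (fun x => ?_) (x₀ := x₀) (r := r) fun x hx => ?_
    · by_cases hx : x ∈ Metric.closedBall x₀ r
      · have h1 : ‖x‖ ≤ ‖x₀‖ + r := by
          have := norm_le_norm_add_norm_sub' x x₀
          rw [Metric.mem_closedBall, dist_eq_norm] at hx
          linarith
        have h2 := hM x h1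
        rw [abs_mul, abs_pow, abs_of_nonneg (hV.nonneg x)]
        exact mul_le_mul (h2.trans (le_abs_self M)) (pow_le_pow_left₀ (abs_nonneg _) (hB x) 2)
          (by positivity) (abs_nonneg _)
      · rw [hr x hx]
        simp only [ne_eq, OfNat.ofNat_ne_zero, not_false_eq_true, zero_pow, mul_zero, abs_zero]
        positivity
    · rw [hr x hx]
      ring

/-- The Gross-Pitaevskii energy per particle is bounded if `N a` is bounded. -/
theorem exists_energy_bound {V : E3 → ℝ} (hV : IsTrap V) (A : ℝ) (hA : 0 < A) : ∃ E₁ : ℝ, 0 < E₁ ∧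
    ∀ (N : ℕ) (a : ℝ) (Φ : E3 → ℝ) (D : Fin 3 → E3 → ℝ), 0 < N → 0 ≤ a → GPData V N a Φ D →
      N * a ≤ A → quadEnergy V Φ D + 4 * Real.pi * a * ∫ x, Φ x ^ 4 ≤ N * E₁ := by
  -- A fixed tent function serves as comparison for all `N`: scaled to the norm of the constraint,
  -- its quadratic energy is proportional to `N` and its quartic energy to `N² a ≤ N A`.
  set f : E3 → ℝ := fun x => max (1 - ‖x‖) 0 with hf
  have hL : LipschitzWith 1 f := by
    have h1 : LipschitzWith 1 fun x : E3 => 1 - ‖x‖ := by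
      refine LipschitzWith.of_dist_le_mul fun x y => ?_
      rw [dist_sub_left, NNReal.coe_one, one_mul]
      exact dist_norm_norm_le x y
    exact h1.max_const 0
  have hs : ∀ x, x ∉ Metric.closedBall (0 : E3) 1 → f x = 0 := fun x hx => by
    rw [mem_closedBall_zero_iff, not_le] at hx
    exact max_eq_right (by linarith)
  have hF := formDomain_of_lipschitz hV hL hs
  have hpos : 0 < ∫ x, f x ^ 2 := by
    rw [integral_pos_iff_support_of_nonneg (fun x => sq_nonneg _) hF.int2]
    refine lt_of_lt_of_le (Metric.measure_ball_pos volume (0 : E3) one_pos) (measure_mono ?_)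
    intro x hx
    rw [mem_ball_zero_iff] at hx
    have : 0 < f x := lt_max_of_lt_left (by linarith)
    exact (pow_pos this 2).ne'
  set m := ∫ x, f x ^ 2
  set Q := quadEnergy V f (fun k x => lineDeriv ℝ f x (dir k))
  set F := ∫ x, f x ^ 4 with hFdef
  have hQ : 0 ≤ Q := quadEnergy_nonneg hV
  have hF0 : 0 ≤ F := integral_nonneg fun x => by positivity
  refine ⟨Q / m + 4 * Real.pi * A * F / m ^ 2 + 1, by positivity, ?_⟩
  intro N a Φ D hN ha h hNa
  have key := h.minimal f _ hF hpos
  have hN' : (0 : ℝ) < N := by exact_mod_cast hN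
  rw [← le_div_iff₀ (by positivity)] at key
  refine key.trans ?_
  have e : (N * m * Q + N ^ 2 * (4 * Real.pi * a * F)) / m ^ 2
      = N * (Q / m + 4 * Real.pi * (N * a) * F / m ^ 2) := by
    field_simp
  rw [e]
  have h1 : 4 * Real.pi * (N * a) * F / m ^ 2 ≤ 4 * Real.pi * A * F / m ^ 2 := by gcongr
  exact mul_le_mul_of_nonneg_left (by linarith) hN'.le

/-! ### Radial functions -/

theorem hasFDerivAt_comp_norm {f : ℝ → ℝ} {f' : ℝ} {y : E3} (hy : y ≠ 0)
    (hf : HasDerivAt f f' ‖y‖) :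
    HasFDerivAt (fun z : E3 => f ‖z‖) ((f' / ‖y‖) • innerSL ℝ y) y := by
  have hy' : ‖y‖ ≠ 0 := norm_ne_zero_iff.2 hy
  have h1 := (hasStrictFDerivAt_norm_sq y).hasFDerivAt.sqrt (by positivity)
  have h2 : (fun z : E3 => √(‖z‖ ^ 2)) = fun z => ‖z‖ := by
    ext z
    rw [Real.sqrt_sq (norm_nonneg z)]
  rw [h2, Real.sqrt_sq (norm_nonneg y)] at h1
  refine (hf.comp_hasFDerivAt y h1).congr_fderiv ?_
  rw [smul_smul, ← Nat.cast_smul_eq_nsmul ℝ, smul_smul]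
  congr 1
  field_simp
  norm_num

theorem ae_norm_ne (r : ℝ) : ∀ᵐ y : E3, ‖y‖ ≠ r := by
  rw [ae_iff]
  convert Measure.addHaar_sphere (volume : Measure E3) 0 r using 2
  ext y
  simp

theorem lineDeriv_comp_sub (f : E3 → ℝ) (x y w : E3) :
    lineDeriv ℝ (fun z => f (z - x)) y w = lineDeriv ℝ f (y - x) w := by
  simp only [lineDeriv, add_sub_right_comm]

/-! ### A truncated Newton potential -/

/-- The field of the difference of uniform charges on the balls of radius `ε` and `1`, divided by
the radius. -/
noncomputable def newtonField (ε r : ℝ) : ℝ := 1 / max r ε ^ 3 - 1 / max r 1 ^ 3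

/-- The potential of `newtonField`. -/
noncomputable def newtonPotential (ε r : ℝ) : ℝ := ∫ t in r..1, t * newtonField ε t

variable {ε : ℝ}

theorem lipschitzWith_one_div_max_pow (hε : 0 < ε) :
    ∃ C : NNReal, LipschitzWith C fun r : ℝ => 1 / max r ε ^ 3 := by
  have h1 : LipschitzOnWith (3 / ε ^ 4).toNNReal (fun r : ℝ => 1 / r ^ 3) (Ici ε) := by
    refine (convex_Ici ε).lipschitzOnWith_of_nnnorm_hasDerivWithin_le (f' := fun r => -3 / r ^ 4)
      (fun r hr => ?_) fun r hr => ?_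
    · have hr0 : 0 < r := hε.trans_le hr
      refine HasDerivAt.hasDerivWithinAt ?_
      simp only [one_div]
      refine ((hasDerivAt_pow 3 r).inv (by positivity)).congr_deriv ?_
      push_cast
      field_simp
    · have hr0 : ε ≤ r := hr
      rw [← norm_toNNReal]
      refine Real.toNNReal_le_toNNReal ?_
      rw [Real.norm_eq_abs, abs_div, abs_neg, abs_of_pos (by norm_num : (0 : ℝ) < 3),
        abs_of_nonneg (by positivity)]
      gcongr
  have h2 : LipschitzWith 1 fun r : ℝ => max r ε := LipschitzWith.id.max_const ε
  have := h1.comp (h2.lipschitzOnWith (s := univ)) fun r _ => le_max_right r ε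
  rw [lipschitzOnWith_univ, mul_one] at this
  exact ⟨_, this⟩

theorem exists_lipschitz_newtonField (hε : 0 < ε) :
    ∃ C : NNReal, LipschitzWith C (newtonField ε) := by
  obtain ⟨C, hC⟩ := lipschitzWith_one_div_max_pow hε
  obtain ⟨C', hC'⟩ := lipschitzWith_one_div_max_pow one_pos
  exact ⟨C + C', hC.sub hC'⟩

theorem newtonField_nonneg (hε : 0 < ε) (h1 : ε ≤ 1) (r : ℝ) : 0 ≤ newtonField ε r := by
  rw [newtonField, sub_nonneg]
  have : 0 < max r ε := lt_max_of_lt_right hε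
  gcongr

theorem newtonField_eq_zero (h1 : ε ≤ 1) {r : ℝ} (hr : 1 ≤ r) : newtonField ε r = 0 := by
  rw [newtonField, max_eq_left hr, max_eq_left (h1.trans hr), sub_self]

theorem newtonField_le (hε : 0 < ε) (r : ℝ) : newtonField ε r ≤ 1 / ε ^ 3 := by
  have h1 : 1 / max r ε ^ 3 ≤ 1 / ε ^ 3 := by
    gcongr
    exact le_max_right _ _
  have h2 : 0 ≤ 1 / max r 1 ^ 3 := by
    have : 0 < max r 1 := lt_max_of_lt_right one_pos
    positivity
  rw [newtonField]
  linarith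

theorem newtonField_le_one_div {r : ℝ} (hr : 0 < r) : newtonField ε r ≤ 1 / r ^ 3 := by
  have h1 : 1 / max r ε ^ 3 ≤ 1 / r ^ 3 := by
    gcongr
    exact le_max_left _ _
  have h2 : 0 ≤ 1 / max r 1 ^ 3 := by
    have : 0 < max r 1 := lt_max_of_lt_right one_pos
    positivity
  rw [newtonField]
  linarith

theorem continuous_newtonField (hε : 0 < ε) : Continuous (newtonField ε) := by
  obtain ⟨C, hC⟩ := exists_lipschitz_newtonField hε
  exact hC.continuous

theorem hasDerivAt_newtonPotential (hε : 0 < ε) (r : ℝ) :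
    HasDerivAt (newtonPotential ε) (-(r * newtonField ε r)) r := by
  have hc : Continuous fun t => t * newtonField ε t := continuous_id.mul (continuous_newtonField hε)
  exact intervalIntegral.integral_hasDerivAt_left (hc.intervalIntegrable _ _)
    hc.stronglyMeasurable.stronglyMeasurableAtFilter hc.continuousAt

theorem newtonPotential_eq_zero (h1 : ε ≤ 1) {r : ℝ} (hr : 1 ≤ r) : newtonPotential ε r = 0 := by
  rw [newtonPotential, intervalIntegral.integral_congr (g := fun _ => 0)]
  · simp
  · intro t ht
    rw [uIcc_of_ge hr] at ht
    simp only [newtonField_eq_zero h1 ht.1, mul_zero]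

theorem newtonPotential_nonneg (hε : 0 < ε) (h1 : ε ≤ 1) {r : ℝ} (hr : 0 ≤ r) :
    0 ≤ newtonPotential ε r := by
  rcases le_total r 1 with h | h
  · exact intervalIntegral.integral_nonneg h fun t ht =>
      mul_nonneg (hr.trans ht.1) (newtonField_nonneg hε h1 t)
  · rw [newtonPotential_eq_zero h1 h]

theorem newtonPotential_le (hε : 0 < ε) {r : ℝ} (hr : 0 < r) (hr1 : r ≤ 1) :
    newtonPotential ε r ≤ 1 / r := by
  have hc : Continuous fun t => t * newtonField ε t := continuous_id.mul (continuous_newtonField hε)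
  have ne : ∀ t ∈ Icc r 1, t ≠ 0 := fun t ht => (hr.trans_le ht.1).ne'
  have hi : IntervalIntegrable (fun t : ℝ => 1 / t ^ 2) volume r 1 :=
    ContinuousOn.intervalIntegrable_of_Icc hr1
      (ContinuousOn.div (by fun_prop) (by fun_prop) fun t ht => pow_ne_zero 2 (ne t ht))
  have e : ∫ t in r..1, 1 / t ^ 2 = -(1 / 1) - -(1 / r) := by
    refine intervalIntegral.integral_eq_sub_of_hasDerivAt (f := fun t => -(1 / t))
      (fun t ht => ?_) hi
    rw [uIcc_of_le hr1] at ht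
    simp only [one_div]
    refine (hasDerivAt_inv (ne t ht)).neg.congr_deriv ?_
    simp
  have hle : newtonPotential ε r ≤ ∫ t in r..1, 1 / t ^ 2 := by
    refine intervalIntegral.integral_mono_on hr1 (hc.intervalIntegrable _ _) hi fun t ht => ?_
    have ht0 := hr.trans_le ht.1
    calc t * newtonField ε t ≤ t * (1 / t ^ 3) :=
          mul_le_mul_of_nonneg_left (newtonField_le_one_div ht0) ht0.le
      _ = 1 / t ^ 2 := by field_simp
  rw [e] at hle
  linarith

theorem exists_lipschitz_newtonPotential (hε : 0 < ε) (h1 : ε ≤ 1) :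
    ∃ C : NNReal, LipschitzWith C fun y : E3 => newtonPotential ε ‖y‖ := by
  have hL : LipschitzOnWith (1 / ε ^ 3).toNNReal (newtonPotential ε) (Ici 0) := by
    refine (convex_Ici 0).lipschitzOnWith_of_nnnorm_hasDerivWithin_le
      (fun r hr => (hasDerivAt_newtonPotential hε r).hasDerivWithinAt) fun r hr => ?_
    rw [← norm_toNNReal]
    refine Real.toNNReal_le_toNNReal ?_
    have hr0 : 0 ≤ r := hr
    have hn := newtonField_nonneg hε h1 r
    rw [norm_neg, Real.norm_of_nonneg (mul_nonneg hr0 hn)]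
    rcases le_total r 1 with h | h
    · nlinarith [newtonField_le hε r]
    · rw [newtonField_eq_zero h1 h, mul_zero]
      positivity
  have := hL.comp ((lipschitzWith_one_norm (E := E3)).lipschitzOnWith (s := univ))
    fun y _ => norm_nonneg y
  rw [lipschitzOnWith_univ, mul_one] at this
  exact ⟨_, this⟩

theorem lineDeriv_newtonPotential (hε : 0 < ε) {y : E3} (hy : y ≠ 0) (k : Fin 3) :
    lineDeriv ℝ (fun z : E3 => newtonPotential ε ‖z‖) y (dir k) = -(newtonField ε ‖y‖ * y k) := by
  have h := hasFDerivAt_comp_norm hy (hasDerivAt_newtonPotential hε ‖y‖)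
  rw [h.differentiableAt.lineDeriv_eq_fderiv, h.fderiv]
  have : ‖y‖ ≠ 0 := norm_ne_zero_iff.2 hy
  simp [dir, EuclideanSpace.inner_single_right]
  field_simp

theorem exists_lipschitz_newtonField_mul (hε : 0 < ε) (h1 : ε ≤ 1) (k : Fin 3) :
    ∃ C : NNReal, LipschitzWith C fun y : E3 => newtonField ε ‖y‖ * y k := by
  obtain ⟨C, hC⟩ := exists_lipschitz_newtonField hε
  have l1 : LipschitzWith C fun y : E3 => newtonField ε ‖y‖ := by
    have := hC.comp (lipschitzWith_one_norm (E := E3))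
    rwa [mul_one] at this
  have l0 : LipschitzWith 1 fun y : E3 => y k := by
    refine LipschitzWith.of_dist_le_mul fun x y => ?_
    rw [NNReal.coe_one, one_mul, dist_eq_norm, dist_eq_norm]
    exact PiLp.norm_apply_le (x - y) k
  have l2 : LipschitzWith 1 fun y : E3 => max (-1) (min (y k) 1) := (l0.min_const 1).const_max (-1)
  have hB1 : ∀ y : E3, |newtonField ε ‖y‖| ≤ 1 / ε ^ 3 := fun y => by
    rw [abs_of_nonneg (newtonField_nonneg hε h1 _)]
    exact newtonField_le hε _
  have hB2 : ∀ y : E3, |max (-1) (min (y k) 1)| ≤ 1 := fun y => by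
    rw [abs_le]
    exact ⟨le_max_left _ _, max_le (by norm_num) (min_le_right _ _)⟩
  -- Clipping the coordinate changes nothing because the field vanishes outside the unit ball; it
  -- makes the second factor bounded, as the product rule for Lipschitz functions requires.
  have e : (fun y : E3 => newtonField ε ‖y‖ * y k)
      = fun y : E3 => newtonField ε ‖y‖ * max (-1) (min (y k) 1) := by
    ext y
    rcases le_total ‖y‖ 1 with h | h
    · have := abs_le.1 ((PiLp.norm_apply_le y k).trans h)
      rw [min_eq_left this.2, max_eq_right this.1]
    · rw [newtonField_eq_zero h1 h, zero_mul, zero_mul]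
  rw [e]
  exact ⟨_, lipschitzWith_mul l1 l2 hB1 hB2⟩

theorem hasDerivAt_newtonField_inner (h1 : ε ≤ 1) {r : ℝ} (hr : r < ε) :
    HasDerivAt (newtonField ε) 0 r := by
  refine (hasDerivAt_const r (1 / ε ^ 3 - 1 / 1 ^ 3)).congr_of_eventuallyEq ?_
  filter_upwards [Iio_mem_nhds hr] with t ht
  have ht' : t < ε := ht
  rw [newtonField, max_eq_right ht'.le, max_eq_right (ht'.le.trans h1)]

theorem hasDerivAt_newtonField_middle (hε : 0 < ε) {r : ℝ} (hr : ε < r) (hr1 : r < 1) :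
    HasDerivAt (newtonField ε) (-3 / r ^ 4) r := by
  have hr0 : 0 < r := hε.trans hr
  have h : HasDerivAt (fun t : ℝ => 1 / t ^ 3 - 1 / 1 ^ 3) (-3 / r ^ 4) r := by
    simp only [one_div]
    refine (((hasDerivAt_pow 3 r).inv (by positivity)).sub_const _).congr_deriv ?_
    push_cast
    field_simp
  refine h.congr_of_eventuallyEq ?_
  filter_upwards [Ioo_mem_nhds hr hr1] with t ht
  rw [newtonField, max_eq_left ht.1.le, max_eq_right ht.2.le]

theorem hasDerivAt_newtonField_outer (h1 : ε ≤ 1) {r : ℝ} (hr : 1 < r) :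
    HasDerivAt (newtonField ε) 0 r := by
  refine (hasDerivAt_const r (0 : ℝ)).congr_of_eventuallyEq ?_
  filter_upwards [Ioi_mem_nhds hr] with t ht
  exact newtonField_eq_zero h1 (show 1 < t from ht).le

/-- The divergence of `g(‖y‖) y` is `‖y‖ g' + 3 g`. On the middle region, where `g' = -3/r⁴`, the
Coulomb part `1/r³` drops out. -/
theorem sum_lineDeriv_newtonField {g' : ℝ} {y : E3} (hy : y ≠ 0)
    (hg : HasDerivAt (newtonField ε) g' ‖y‖) :
    ∑ k, lineDeriv ℝ (fun z : E3 => newtonField ε ‖z‖ * z k) y (dir k)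
      = g' * ‖y‖ + 3 * newtonField ε ‖y‖ := by
  have h := hasFDerivAt_comp_norm hy hg
  have hk : ∀ k : Fin 3, lineDeriv ℝ (fun z : E3 => newtonField ε ‖z‖ * z k) y (dir k)
      = g' / ‖y‖ * y k ^ 2 + newtonField ε ‖y‖ := fun k => by
    have h2 : HasFDerivAt (fun z : E3 => z k) (EuclideanSpace.proj k : E3 →L[ℝ] ℝ) y :=
      (EuclideanSpace.proj k : E3 →L[ℝ] ℝ).hasFDerivAt
    have h3 : HasFDerivAt (fun z : E3 => newtonField ε ‖z‖ * z k) _ y := h.mul h2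
    rw [h3.differentiableAt.lineDeriv_eq_fderiv, h3.fderiv]
    simp [dir, EuclideanSpace.inner_single_right]
    ring
  simp_rw [hk]
  rw [Finset.sum_add_distrib, ← Finset.mul_sum]
  have e : ∑ k, y k ^ 2 = ‖y‖ ^ 2 := by
    rw [EuclideanSpace.norm_sq_eq]
    simp
  have : ‖y‖ ≠ 0 := norm_ne_zero_iff.2 hy
  rw [e]
  simp
  field_simp

/-- The charge density of the field. -/
theorem ae_sum_lineDeriv_newtonField (hε : 0 < ε) (h1 : ε < 1) :
    ∀ᵐ y : E3, ∑ k, lineDeriv ℝ (fun z : E3 => newtonField ε ‖z‖ * z k) y (dir k)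
      = (Metric.closedBall (0 : E3) ε).indicator (fun _ => 3 / ε ^ 3) y
        - (Metric.closedBall (0 : E3) 1).indicator (fun _ => 3) y := by
  filter_upwards [ae_norm_ne 0, ae_norm_ne ε, ae_norm_ne 1] with y y0 y1 y2
  have hy : y ≠ 0 := norm_ne_zero_iff.1 y0
  have i : ∀ r c : ℝ, (Metric.closedBall (0 : E3) r).indicator (fun _ => c) y
      = if ‖y‖ ≤ r then c else 0 := fun r c => by
    by_cases h : ‖y‖ ≤ r
    · rw [indicator_of_mem (mem_closedBall_zero_iff.2 h), if_pos h]
    · rw [indicator_of_notMem (fun h' => h (mem_closedBall_zero_iff.1 h')), if_neg h]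
  rw [i, i]
  rcases lt_or_gt_of_ne y1 with y1 | y1
  · rw [sum_lineDeriv_newtonField hy (hasDerivAt_newtonField_inner h1.le y1), if_pos y1.le,
      if_pos (y1.le.trans h1.le), newtonField, max_eq_right y1.le, max_eq_right (y1.le.trans h1.le)]
    ring
  rcases lt_or_gt_of_ne y2 with y2 | y2
  · rw [sum_lineDeriv_newtonField hy (hasDerivAt_newtonField_middle hε y1 y2), if_neg y1.not_ge,
      if_pos y2.le, newtonField, max_eq_left y1.le, max_eq_right y2.le]
    field_simp
    ring
  · rw [sum_lineDeriv_newtonField hy (hasDerivAt_newtonField_outer h1.le y2), if_neg y1.not_ge,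
      if_neg y2.not_ge, newtonField_eq_zero h1.le y2.le]
    ring

/-- The bound `1/r` on the unit ball is uniform in `ε`, and the weight `r²` of polar coordinates
compensates its square. -/
theorem lintegral_sq_newtonPotential_le (hε : 0 < ε) (h1 : ε ≤ 1) :
    ∫⁻ y : E3, ENNReal.ofReal (newtonPotential ε ‖y‖ ^ 2) ≤ ENNReal.ofReal (4 * Real.pi) := by
  set g : ℝ → ℝ≥0∞ := (Ioc 0 1).indicator fun r => ENNReal.ofReal (1 / r ^ 2) with hg
  have hm : Measurable g := by
    refine Measurable.indicator ?_ measurableSet_Ioc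
    fun_prop
  have hle : ∫⁻ y : E3, ENNReal.ofReal (newtonPotential ε ‖y‖ ^ 2) ≤ ∫⁻ y : E3, g ‖y‖ := by
    refine lintegral_mono_ae ?_
    filter_upwards [ae_norm_ne 0] with y hy
    have hy' : 0 < ‖y‖ := lt_of_le_of_ne (norm_nonneg y) (Ne.symm hy)
    rcases le_or_gt ‖y‖ 1 with h | h
    · rw [hg, indicator_of_mem (show ‖y‖ ∈ Ioc (0 : ℝ) 1 from ⟨hy', h⟩)]
      refine ENNReal.ofReal_le_ofReal ?_
      have := pow_le_pow_left₀ (newtonPotential_nonneg hε h1 hy'.le)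
        (newtonPotential_le hε hy' h) 2
      rwa [one_div_pow] at this
    · rw [newtonPotential_eq_zero h1 h.le]
      simp
  refine hle.trans ?_
  rw [lintegral_fun_norm hm]
  refine mul_le_of_le_one_right' ?_
  calc ∫⁻ r in Ioi (0 : ℝ), ENNReal.ofReal (r ^ 2) * g r
      ≤ ∫⁻ r in Ioi (0 : ℝ), (Ioc (0 : ℝ) 1).indicator (fun _ => 1) r := by
        refine setLIntegral_mono' measurableSet_Ioi fun r hr => ?_
        have hr0 : 0 < r := hr
        by_cases h : r ∈ Ioc (0 : ℝ) 1
        · rw [hg, indicator_of_mem h, indicator_of_mem h, ← ENNReal.ofReal_mul (by positivity),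
            mul_one_div_cancel (by positivity)]
          simp
        · rw [hg, indicator_of_notMem h, mul_zero]
          exact zero_le
    _ ≤ ∫⁻ r, (Ioc (0 : ℝ) 1).indicator (fun _ => 1) r := setLIntegral_le_lintegral _ _
    _ = 1 := by
        rw [lintegral_indicator measurableSet_Ioc]
        simp

/-! ### The minimizer is bounded -/

section Bound

variable {N : ℕ} {V : E3 → ℝ} {a ε : ℝ} {Φ : E3 → ℝ} {D : Fin 3 → E3 → ℝ}

/-- Young's inequality with weight `√N`, the `L²` norm of `Φ`, so that the dependence on `N` is
optimal. -/
theorem GPData.integral_mul_le (h : GPData V N a Φ D) (hN : 0 < N) {g : E3 → ℝ}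
    (hg : Measurable g) (hg2 : Integrable fun x => g x ^ 2) :
    Integrable (fun x => Φ x * g x) ∧
      ∫ x, Φ x * g x ≤ √N * ((1 + ∫ x, g x ^ 2) / 2) := by
  have hi := integrable_mul_of_sq h.measurable.aestronglyMeasurable hg.aestronglyMeasurable
    h.int2 hg2
  refine ⟨hi, ?_⟩
  have hN' : (0 : ℝ) < N := by exact_mod_cast hN
  set s := √(N : ℝ) with hs
  have s0 : 0 < s := Real.sqrt_pos.2 hN'
  have ss : s ^ 2 = N := Real.sq_sqrt hN'.le
  have h1 : ∫ x, Φ x * g x ≤ ∫ x, ((1 / (2 * s)) * Φ x ^ 2 + (s / 2) * g x ^ 2) := by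
    refine integral_mono hi ((h.int2.const_mul _).add (hg2.const_mul _)) fun x => ?_
    have e : (1 / (2 * s)) * Φ x ^ 2 + (s / 2) * g x ^ 2 - Φ x * g x
        = (1 / (2 * s)) * (Φ x - s * g x) ^ 2 := by
      field_simp
      ring
    have : 0 ≤ (1 / (2 * s)) * (Φ x - s * g x) ^ 2 := by positivity
    show Φ x * g x ≤ _
    linarith
  refine h1.trans (le_of_eq ?_)
  rw [integral_add (h.int2.const_mul _) (hg2.const_mul _), integral_const_mul, integral_const_mul,
    h.normalized, ← ss]
  field_simp

/-- The mean value inequality from the Euler-Lagrange equation. -/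
theorem GPData.integral_closedBall_le (hV : IsTrap V) (hN : 0 < N) (ha : 0 ≤ a)
    (h : GPData V N a Φ D) (hε : 0 < ε) (h1 : ε < 1) (x : E3) :
    N * (3 / ε ^ 3 * ∫ y in Metric.closedBall x ε, Φ y)
      ≤ N * (3 * ∫ y in Metric.closedBall x 1, Φ y)
        + totalMu V a Φ D * ∫ y, Φ y * newtonPotential ε ‖y - x‖ := by
  obtain ⟨C, hC⟩ := exists_lipschitz_newtonPotential hε h1.le
  have hshift : LipschitzWith 1 fun y : E3 => y - x := by
    refine LipschitzWith.of_dist_le_mul fun y z => ?_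
    rw [dist_sub_right, NNReal.coe_one, one_mul]
  set η : E3 → ℝ := fun y => newtonPotential ε ‖y - x‖ with hη
  have hηL : LipschitzWith C η := by
    have := hC.comp hshift
    rwa [mul_one] at this
  have hηs : ∀ y, y ∉ Metric.closedBall x 1 → η y = 0 := fun y hy => by
    rw [Metric.mem_closedBall, dist_eq_norm, not_le] at hy
    exact newtonPotential_eq_zero h1.le hy.le
  have hF := formDomain_of_lipschitz hV hηL hηs
  have hη0 : ∀ y, 0 ≤ η y := fun y => newtonPotential_nonneg hε h1.le (norm_nonneg _)
  -- The test function `η` satisfies `-Δη = (3/ε³) 1_{B_ε} - 3 · 1_{B_1}`, the balls being centred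
  -- at `x`. The trap and interaction terms are nonnegative and will be dropped.
  have key := h.euler_lagrange hV hN hF
  have hquart : 0 ≤ 8 * Real.pi * a * ∫ y, Φ y ^ 3 * η y :=
    mul_nonneg (by positivity) (integral_nonneg fun y =>
      mul_nonneg (pow_nonneg (h.nonneg y) 3) (hη0 y))
  have hpot : 0 ≤ ∫ y, V y * (Φ y * η y) := integral_nonneg fun y =>
    mul_nonneg (hV.nonneg y) (mul_nonneg (h.nonneg y) (hη0 y))
  set ψ : Fin 3 → E3 → ℝ := fun k y => newtonField ε ‖y - x‖ * (y - x) k with hψ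
  have hψL : ∀ k, ∃ C : NNReal, LipschitzWith C (ψ k) := fun k => by
    obtain ⟨C, hC⟩ := exists_lipschitz_newtonField_mul hε h1.le k
    have := hC.comp hshift
    exact ⟨_, this⟩
  have hψs : ∀ k y, y ∉ Metric.closedBall x 1 → ψ k y = 0 := fun k y hy => by
    rw [Metric.mem_closedBall, dist_eq_norm, not_le] at hy
    simp only [hψ, newtonField_eq_zero h1.le hy.le, zero_mul]
  have hψc : ∀ k, HasCompactSupport (ψ k) := fun k =>
    (isCompact_closedBall x 1).of_isClosed_subset (isClosed_tsupport _)
      (closure_minimal (fun y hy => by by_contra h; exact hy (hψs k y h))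
        Metric.isClosed_closedBall)
  have htrans := (measurePreserving_sub_right (volume : Measure E3) x).quasiMeasurePreserving
  have hgrad : ∀ᵐ y, ∀ k, lineDeriv ℝ η y (dir k) = -ψ k y := by
    filter_upwards [htrans.ae (ae_norm_ne 0)] with y hy k
    rw [hη, lineDeriv_comp_sub (fun z => newtonPotential ε ‖z‖),
      lineDeriv_newtonPotential hε (norm_ne_zero_iff.1 hy)]
  have hψi : ∀ k, Integrable fun y => D k y * ψ k y := fun k => by
    obtain ⟨C, hC⟩ := hψL k
    have := integrable_mul_of_hasCompactSupport hC.continuous (hψc k) (h.weak k).2.1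
    simpa only [smul_eq_mul, mul_comm] using this
  have hdi : ∀ k, Integrable fun y => lineDeriv ℝ (ψ k) y (dir k) * Φ y := fun k => by
    obtain ⟨C, hC⟩ := hψL k
    have h2 := (formDomain_of_lipschitz hV hC (hψs k)).intD k
    exact integrable_mul_of_sq (measurable_lineDeriv hC.continuous).aestronglyMeasurable
      h.measurable.aestronglyMeasurable h2 h.int2
  -- The gradient of `η` is `-ψ`, and `ψ` is Lipschitz with compact support, so the derivative may
  -- be moved from `Φ` to `ψ`.
  have e1 : ∫ y, ∑ k, D k y * lineDeriv ℝ η y (dir k)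
      = ∫ y, (∑ k, lineDeriv ℝ (ψ k) y (dir k)) * Φ y := by
    have s1 : ∫ y, ∑ k, D k y * lineDeriv ℝ η y (dir k) = ∫ y, ∑ k, -(D k y * ψ k y) := by
      refine integral_congr_ae ?_
      filter_upwards [hgrad] with y hy
      simp only [hy, mul_neg]
    have hψn : ∀ k, Integrable fun y => -(D k y * ψ k y) := fun k => (hψi k).neg
    rw [s1, integral_finsetSum _ fun k _ => hψn k]
    simp_rw [Finset.sum_mul]
    rw [integral_finsetSum _ fun k _ => hdi k]
    refine Finset.sum_congr rfl fun k _ => ?_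
    obtain ⟨C, hC⟩ := hψL k
    rw [(h.weak k).integral_lineDeriv_mul hC (hψc k), integral_neg]
    simp only [mul_comm]
  have hI : ∀ r, IntegrableOn Φ (Metric.closedBall x r) := fun r =>
    (h.weak 0).1.integrableOn_isCompact (isCompact_closedBall x r)
  have e2 : ∫ y, (∑ k, lineDeriv ℝ (ψ k) y (dir k)) * Φ y
      = 3 / ε ^ 3 * (∫ y in Metric.closedBall x ε, Φ y)
        - 3 * ∫ y in Metric.closedBall x 1, Φ y := by
    have s1 : ∫ y, (∑ k, lineDeriv ℝ (ψ k) y (dir k)) * Φ y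
        = ∫ y, (3 / ε ^ 3 * (Metric.closedBall x ε).indicator Φ y
          - 3 * (Metric.closedBall x 1).indicator Φ y) := by
      refine integral_congr_ae ?_
      filter_upwards [htrans.ae (ae_sum_lineDeriv_newtonField hε h1)] with y hy
      have s2 : ∀ k, lineDeriv ℝ (ψ k) y (dir k)
          = lineDeriv ℝ (fun z : E3 => newtonField ε ‖z‖ * z k) (y - x) (dir k) := fun k =>
        lineDeriv_comp_sub (fun z : E3 => newtonField ε ‖z‖ * z k) x y (dir k)
      have s3 : ∀ r c : ℝ, (Metric.closedBall (0 : E3) r).indicator (fun _ => c) (y - x) * Φ y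
          = c * (Metric.closedBall x r).indicator Φ y := fun r c => by
        by_cases hr : y ∈ Metric.closedBall x r
        · have hr' : y - x ∈ Metric.closedBall (0 : E3) r := by
            rwa [mem_closedBall_zero_iff, ← dist_eq_norm]
          rw [indicator_of_mem hr, indicator_of_mem hr']
        · have hr' : y - x ∉ Metric.closedBall (0 : E3) r := by
            rwa [mem_closedBall_zero_iff, ← dist_eq_norm]
          rw [indicator_of_notMem hr, indicator_of_notMem hr', zero_mul, mul_zero]
      simp only [s2]
      rw [hy, sub_mul, s3, s3]
    rw [s1, integral_sub (((hI ε).integrable_indicator measurableSet_closedBall).const_mul _)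
      (((hI 1).integrable_indicator measurableSet_closedBall).const_mul _), integral_const_mul,
      integral_const_mul, integral_indicator measurableSet_closedBall,
      integral_indicator measurableSet_closedBall]
  rw [quadForm, e1, e2] at key
  have hN' : (0 : ℝ) < N := by exact_mod_cast hN
  nlinarith [mul_nonneg hN'.le (add_nonneg hpot hquart)]

/-- The mean value inequality bounds the averages of `Φ` over all balls of radius `ε < 1` by a
constant independent of `ε`, and Lebesgue differentiation turns this into a bound almost everywhere.
The numbers `9` and `7` generously exceed `(3 + 4π)/(8π)` and `(1 + 4π)/(8π)`. -/
theorem GPData.ae_le (hV : IsTrap V) (hN : 0 < N) (ha : 0 ≤ a) (h : GPData V N a Φ D) {μ : ℝ}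
    (hμ : totalMu V a Φ D ≤ N * μ) :
    ∀ᵐ x, Φ x ≤ (9 + 7 * μ) * √N := by
  have hN' : (0 : ℝ) < N := by exact_mod_cast hN
  have hμ0 : 0 ≤ μ := by
    have := (totalMu_nonneg hV ha).trans hμ
    exact nonneg_of_mul_nonneg_right this hN'
  have hpi := Real.pi_pos
  have hpi4 := Real.pi_lt_four
  have hpi3 := Real.pi_gt_three
  have avg : ∀ ε, 0 < ε → ε < 1 → ∀ x, ⨍ y in Metric.closedBall x ε, Φ y ≤ (9 + 7 * μ) * √N := by
    intro ε hε h1 x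
    have key := h.integral_closedBall_le hV hN ha hε h1 x
    have vol : ∀ r : ℝ, 0 ≤ r →
        volume.real (Metric.closedBall x r) = r ^ 3 * (Real.pi * 4 / 3) := fun r hr => by
      rw [measureReal_def, EuclideanSpace.volume_closedBall_fin_three, ← ENNReal.ofReal_pow hr,
        ← ENNReal.ofReal_mul (by positivity), ENNReal.toReal_ofReal (by positivity)]
    obtain ⟨C, hC⟩ := exists_lipschitz_newtonPotential hε h1.le
    have hcη : Continuous fun y : E3 => newtonPotential ε ‖y - x‖ :=
      hC.continuous.comp (continuous_id.sub continuous_const)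
    have hη2 : ∫⁻ y : E3, ENNReal.ofReal (newtonPotential ε ‖y - x‖ ^ 2)
        ≤ ENNReal.ofReal (4 * Real.pi) := by
      rw [lintegral_sub_right_eq_self (fun y : E3 => ENNReal.ofReal (newtonPotential ε ‖y‖ ^ 2))]
      exact lintegral_sq_newtonPotential_le hε h1.le
    have hηi : Integrable fun y : E3 => newtonPotential ε ‖y - x‖ ^ 2 :=
      integrable_of_lintegral_ofReal (hcη.pow 2).aestronglyMeasurable (fun y => sq_nonneg _)
        (hη2.trans_lt ENNReal.ofReal_lt_top)
    have hη4 : ∫ y : E3, newtonPotential ε ‖y - x‖ ^ 2 ≤ 4 * Real.pi := by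
      rw [← ofReal_integral_eq_lintegral_ofReal hηi (.of_forall fun y => sq_nonneg _)] at hη2
      exact (ENNReal.ofReal_le_ofReal_iff (by positivity)).1 hη2
    have b1 := (h.integral_mul_le hN hcη.measurable hηi).2
    have b2 : ∫ y in Metric.closedBall x 1, Φ y ≤ √N * ((1 + Real.pi * 4 / 3) / 2) := by
      set χ : E3 → ℝ := (Metric.closedBall x 1).indicator fun _ => 1 with hχ
      have χ2 : ∀ y, χ y ^ 2 = χ y := fun y => by
        by_cases hy : y ∈ Metric.closedBall x 1
        · rw [hχ, indicator_of_mem hy, one_pow]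
        · rw [hχ, indicator_of_notMem hy]; norm_num
      have χi : Integrable χ := (integrable_indicator_iff measurableSet_closedBall).2
        (integrableOn_const measure_closedBall_lt_top.ne)
      have χm : Measurable χ := measurable_const.indicator measurableSet_closedBall
      have := (h.integral_mul_le hN χm (by simpa only [χ2] using χi)).2
      simp only [χ2] at this
      have e1 : ∫ y, χ y = Real.pi * 4 / 3 := by
        rw [hχ, integral_indicator measurableSet_closedBall, setIntegral_const, vol 1 zero_le_one]
        simp
      have e2 : ∫ y, Φ y * χ y = ∫ y in Metric.closedBall x 1, Φ y := by
        rw [← integral_indicator measurableSet_closedBall]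
        congr 1
        ext y
        by_cases hy : y ∈ Metric.closedBall x 1
        · rw [hχ, indicator_of_mem hy, indicator_of_mem hy, mul_one]
        · rw [hχ, indicator_of_notMem hy, indicator_of_notMem hy, mul_zero]
      rwa [e1, e2] at this
    have s0 : 0 ≤ √(N : ℝ) := Real.sqrt_nonneg _
    have b3 : ∫ y, Φ y * newtonPotential ε ‖y - x‖ ≤ √N * ((1 + 4 * Real.pi) / 2) := by
      refine b1.trans (mul_le_mul_of_nonneg_left ?_ s0)
      linarith
    have b4 : totalMu V a Φ D * ∫ y, Φ y * newtonPotential ε ‖y - x‖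
        ≤ N * (μ * (√N * ((1 + 4 * Real.pi) / 2))) := by
      rw [← mul_assoc]
      exact mul_le_mul hμ b3 (integral_nonneg fun y => mul_nonneg (h.nonneg y)
        (newtonPotential_nonneg hε h1.le (norm_nonneg _))) (by positivity)
    have b5 : 3 / ε ^ 3 * ∫ y in Metric.closedBall x ε, Φ y
        ≤ 3 * (√N * ((1 + Real.pi * 4 / 3) / 2)) + μ * (√N * ((1 + 4 * Real.pi) / 2)) := by
      have : (N : ℝ) * (3 / ε ^ 3 * ∫ y in Metric.closedBall x ε, Φ y)
        ≤ N * (3 * (√N * ((1 + Real.pi * 4 / 3) / 2)) + μ * (√N * ((1 + 4 * Real.pi) / 2))) := by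
        nlinarith
      exact le_of_mul_le_mul_left this hN'
    rw [setAverage_eq, vol ε hε.le, smul_eq_mul]
    have e : (ε ^ 3 * (Real.pi * 4 / 3))⁻¹ * ∫ y in Metric.closedBall x ε, Φ y
        = (3 / ε ^ 3 * ∫ y in Metric.closedBall x ε, Φ y) / (4 * Real.pi) := by
      field_simp
    rw [e, div_le_iff₀ (by positivity)]
    refine b5.trans ?_
    have f1 : 0 ≤ μ * √N := by positivity
    nlinarith [mul_nonneg s0 hpi.le, mul_nonneg f1 hpi.le, mul_nonneg s0 (sub_nonneg.2 hpi3.le),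
      mul_nonneg f1 (sub_nonneg.2 hpi3.le)]
  filter_upwards [IsUnifLocDoublingMeasure.ae_tendsto_average (μ := volume) (h.weak 0).1 1] with x hx
  have hlim : Tendsto (fun n : ℕ => 1 / ((n : ℝ) + 2)) atTop (𝓝[>] 0) := by
    refine tendsto_nhdsWithin_iff.2 ⟨?_, .of_forall fun n => ?_⟩
    · have := (tendsto_one_div_add_atTop_nhds_zero_nat (𝕜 := ℝ)).comp (tendsto_add_atTop_nat 1)
      refine this.congr fun n => ?_
      simp only [Function.comp]
      push_cast
      ring
    · show (0 : ℝ) < _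
      positivity
  have := hx (fun _ => x) _ hlim (.of_forall fun n => Metric.mem_closedBall_self (by positivity))
  refine le_of_tendsto this (.of_forall fun n => avg _ (by positivity) ?_ x)
  rw [div_lt_one (by positivity)]
  linarith [n.cast_nonneg (α := ℝ)]

end Bound

/-! ### The lower bound for `c` -/

/-- A lower bound for the mean density, from the confinement. -/
theorem exists_meanDensity_ge {V : E3 → ℝ} (hV : IsTrap V) {E₁ : ℝ} (hE : 0 < E₁) :
    ∃ κ : ℝ, 0 < κ ∧ ∀ (N : ℕ) (a : ℝ) (Φ : E3 → ℝ) (D : Fin 3 → E3 → ℝ), 0 < N → 0 ≤ a →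
      GPData V N a Φ D → quadEnergy V Φ D + 4 * Real.pi * a * (∫ x, Φ x ^ 4) ≤ N * E₁ →
      κ * N ≤ meanDensity N Φ := by
  -- Where `V ≥ 2 E₁` at most half of the mass can sit, as the trap energy is at most `N E₁`.
  obtain ⟨R, hR⟩ := hV.tendsto (2 * E₁)
  set B : Set E3 := Metric.closedBall 0 (max R 1) with hB
  have mB : MeasurableSet B := measurableSet_closedBall
  set b := volume.real B with hb
  have b0 : 0 < b := ENNReal.toReal_pos
    (Metric.measure_closedBall_pos volume _ (lt_max_of_lt_right one_pos)).ne'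
    measure_closedBall_lt_top.ne
  refine ⟨1 / (4 * b), by positivity, fun N a Φ D hN ha h hle => ?_⟩
  have hN' : (0 : ℝ) < N := by exact_mod_cast hN
  have h4 : 0 ≤ ∫ x, Φ x ^ 4 := integral_nonneg fun x => by positivity
  have hpot : ∫ x, V x * Φ x ^ 2 ≤ N * E₁ := by
    have h1 : 0 ≤ ∫ x, ∑ k, D k x ^ 2 := integral_nonneg fun x =>
      Finset.sum_nonneg fun k _ => sq_nonneg _
    have h2 : 0 ≤ 4 * Real.pi * a * ∫ x, Φ x ^ 4 := by positivity
    rw [quadEnergy] at hle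
    linarith
  -- On the ball `Φ² ≤ t + Φ⁴/(4t)`. This `t` makes the constant contribute `b t = N/4`, so that
  -- another `N/4` is left to be supplied by `∫ Φ⁴`.
  set t : ℝ := N / (4 * b) with ht
  have t0 : 0 < t := by positivity
  have iB : Integrable (B.indicator fun _ => t) :=
    (integrable_indicator_iff mB).2 (integrableOn_const measure_closedBall_lt_top.ne)
  have iS : Integrable fun x => B.indicator (fun _ => t) x + 1 / (4 * t) * Φ x ^ 4 :=
    iB.add (h.int4.const_mul _)
  have key : ∫ x, Φ x ^ 2 ≤ ∫ x, ((1 / (2 * E₁)) * (V x * Φ x ^ 2)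
      + (B.indicator (fun _ => t) x + 1 / (4 * t) * Φ x ^ 4)) := by
    refine integral_mono h.int2 ((h.intV.const_mul _).add iS) fun x => ?_
    show Φ x ^ 2 ≤ _
    have k1 : 0 ≤ V x * Φ x ^ 2 := mul_nonneg (hV.nonneg x) (sq_nonneg _)
    have k2 : 0 ≤ Φ x ^ 4 := by positivity
    by_cases hx : x ∈ B
    · rw [indicator_of_mem hx]
      have e : t + 1 / (4 * t) * Φ x ^ 4 - Φ x ^ 2 = 1 / (4 * t) * (Φ x ^ 2 - 2 * t) ^ 2 := by
        field_simp
        ring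
      have : 0 ≤ 1 / (4 * t) * (Φ x ^ 2 - 2 * t) ^ 2 := by positivity
      have : 0 ≤ 1 / (2 * E₁) * (V x * Φ x ^ 2) := by positivity
      linarith
    · rw [indicator_of_notMem hx]
      rw [hB, mem_closedBall_zero_iff, not_le] at hx
      have hv := hR x ((le_max_left _ _).trans hx.le)
      have e : Φ x ^ 2 = 1 / (2 * E₁) * (2 * E₁ * Φ x ^ 2) := by field_simp
      have k3 : 1 / (2 * E₁) * (2 * E₁ * Φ x ^ 2) ≤ 1 / (2 * E₁) * (V x * Φ x ^ 2) := by gcongr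
      have : 0 ≤ 1 / (4 * t) * Φ x ^ 4 := by positivity
      linarith
  rw [h.normalized, integral_add (h.intV.const_mul _) iS,
    integral_add iB (h.int4.const_mul _), integral_const_mul, integral_const_mul,
    integral_indicator mB, setIntegral_const, smul_eq_mul] at key
  have k1 : 1 / (2 * E₁) * ∫ x, V x * Φ x ^ 2 ≤ N / 2 := by
    calc 1 / (2 * E₁) * ∫ x, V x * Φ x ^ 2 ≤ 1 / (2 * E₁) * (N * E₁) := by gcongr
      _ = N / 2 := by field_simp
  have k2 : b * t = N / 4 := by
    rw [ht]
    field_simp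
  have k3 : (N : ℝ) / 4 ≤ 1 / (4 * t) * ∫ x, Φ x ^ 4 := by
    rw [← hb, k2] at key
    linarith
  have k4 : 1 / (4 * t) * ∫ x, Φ x ^ 4 = b * meanDensity N Φ := by
    rw [ht, meanDensity]
    field_simp
  rw [k4] at k3
  rw [one_div_mul_eq_div, div_le_iff₀ (by positivity)]
  linarith

/-- The parameter `c` is bounded below for bounded `N a`. -/
theorem exists_cParam_ge {V : E3 → ℝ} (hV : IsTrap V) {A : ℝ} (hA : 0 < A) :
    ∃ c₀ : ℝ, 0 < c₀ ∧ ∀ (N : ℕ) (a : ℝ) (Φ : E3 → ℝ), 0 < N → 0 ≤ a →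
      IsGPMinimizer V N a Φ → N * a ≤ A → c₀ ≤ cParam N Φ := by
  obtain ⟨E₁, hE, hE₁⟩ := exists_energy_bound hV A hA
  obtain ⟨κ, hκ, hm⟩ := exists_meanDensity_ge hV hE
  set L := 9 + 7 * (2 * E₁) with hL
  have L0 : 0 < L := by positivity
  refine ⟨κ / L ^ 2, by positivity, fun N a Φ hN ha hΦ hNa => ?_⟩
  obtain ⟨Φ', D, h, hae, -, -⟩ := exists_gpData hV hN ha hΦ
  rw [← cParam_congr hae]
  have hN' : (0 : ℝ) < N := by exact_mod_cast hN
  have hle := hE₁ N a Φ' D hN ha h hNa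
  have hmean := hm N a Φ' D hN ha h hle
  -- The chemical potential counts the interaction energy twice and is thus at most twice the
  -- energy.
  have hμ : totalMu V a Φ' D ≤ N * (2 * E₁) := by
    have := quadEnergy_nonneg hV (Φ := Φ') (D := D)
    rw [totalMu]
    linarith
  have hsq : ∀ᵐ x, Φ' x ^ 2 ≤ L ^ 2 * N := by
    filter_upwards [h.ae_le hV hN ha hμ] with x hx
    have := pow_le_pow_left₀ (h.nonneg x) hx 2
    rwa [mul_pow, Real.sq_sqrt hN'.le] at this
  have hmax : eLpNorm (fun x => Φ' x ^ 2) ⊤ volume ≤ ENNReal.ofReal (L ^ 2 * N) := by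
    rw [eLpNorm_exponent_top]
    refine eLpNormEssSup_le_of_ae_bound (hsq.mono fun x hx => ?_)
    rwa [Real.norm_of_nonneg (sq_nonneg _)]
  have hM1 : maxDensity Φ' ≤ L ^ 2 * N := by
    have := ENNReal.toReal_mono ENNReal.ofReal_ne_top hmax
    rwa [ENNReal.toReal_ofReal (by positivity)] at this
  -- Needed since the quotient defining `c` would be `0` for a vanishing denominator. With `ρ̄ ≥ κ
  -- N` and `‖ρ‖_∞ ≤ L² N` the particle number then cancels.
  have hM0 : 0 < maxDensity Φ' := by
    refine ENNReal.toReal_pos (fun h0 => ?_) (hmax.trans_lt ENNReal.ofReal_lt_top).ne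
    rw [eLpNorm_eq_zero_iff (h.measurable.pow_const 2).aestronglyMeasurable (by simp)] at h0
    have := h.normalized
    rw [integral_congr_ae h0] at this
    simp at this
    exact hN'.ne this
  rw [cParam, div_le_div_iff₀ (by positivity) hM0]
  calc κ * maxDensity Φ' ≤ κ * (L ^ 2 * N) := by gcongr
    _ = κ * N * L ^ 2 := by ring
    _ ≤ _ := by gcongr

end BoseGas

theorem theorem3p1 :
    -- the upper bound
    (∀ (N : ℕ) (V : BoseGas.E3 → ℝ) (v : ℝ → ℝ≥0∞) (a : ℝ) (Φ : BoseGas.E3 → ℝ),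
      0 < N → BoseGas.IsTrap V → Measurable v → BoseGas.IsScatteringLength v a →
      BoseGas.IsGPMinimizer V N a Φ →
      a < BoseGas.bParam N Φ →
      BoseGas.qmEnergy N V v ≤ ENNReal.ofReal
        (BoseGas.linearEnergy V Φ / (1 - a / BoseGas.bParam N Φ) ^ 3
          + 4 * Real.pi * a * (∫ x, Φ x ^ 4)
            * ((1 + 2 / BoseGas.cParam N Φ * (a / BoseGas.bParam N Φ)
                  - 2 / BoseGas.cParam N Φ * (a / BoseGas.bParam N Φ) ^ 2
                  + 1 / (2 * BoseGas.cParam N Φ) * (a / BoseGas.bParam N Φ) ^ 3)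
                / (1 - a / BoseGas.bParam N Φ) ^ 8)))
    ∧
    -- the relative error is at most a constant times `a ρ̄^{1/3}`; the constants depend only on
    -- a lower bound for `c`
    (∀ c₀ : ℝ, 0 < c₀ → ∃ C δ : ℝ, 0 < C ∧ 0 < δ ∧
      ∀ (N : ℕ) (V : BoseGas.E3 → ℝ) (v : ℝ → ℝ≥0∞) (a : ℝ) (Φ : BoseGas.E3 → ℝ),
        0 < N → BoseGas.IsTrap V → Measurable v → BoseGas.IsScatteringLength v a →
        BoseGas.IsGPMinimizer V N a Φ →
        c₀ ≤ BoseGas.cParam N Φ →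
        a * BoseGas.meanDensity N Φ ^ (1 / 3 : ℝ) ≤ δ →
        BoseGas.qmEnergy N V v ≤ BoseGas.gpEnergy V N a
          * ENNReal.ofReal (1 + C * (a * BoseGas.meanDensity N Φ ^ (1 / 3 : ℝ))))
    ∧
    -- likewise for a given trap and bounded `N a`; the constants depend only on the trap and on
    -- the bound for `N a`
    (∀ V : BoseGas.E3 → ℝ, BoseGas.IsTrap V → ∀ A : ℝ, 0 < A → ∃ C δ : ℝ, 0 < C ∧ 0 < δ ∧
      ∀ (N : ℕ) (v : ℝ → ℝ≥0∞) (a : ℝ) (Φ : BoseGas.E3 → ℝ),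
        0 < N → Measurable v → BoseGas.IsScatteringLength v a →
        BoseGas.IsGPMinimizer V N a Φ →
        N * a ≤ A →
        a * BoseGas.meanDensity N Φ ^ (1 / 3 : ℝ) ≤ δ →
        BoseGas.qmEnergy N V v ≤ BoseGas.gpEnergy V N a
          * ENNReal.ofReal (1 + C * (a * BoseGas.meanDensity N Φ ^ (1 / 3 : ℝ)))) := by
  refine ⟨fun N V v a Φ hN hV hv ha hΦ hab => ?_, fun c₀ hc₀ =>
    BoseGas.qmEnergy_le_gpEnergy_mul hc₀, fun V hV A hA => ?_⟩
  · obtain ⟨Φ', D, h, hae, hlin, -⟩ := BoseGas.exists_gpData hV hN ha.nonneg hΦ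
    rw [← BoseGas.bParam_congr hae] at hab ⊢
    rw [← BoseGas.cParam_congr hae, ← BoseGas.integral_pow_four_congr hae, hlin]
    exact BoseGas.qmEnergy_le_of_lt_bParam hV hN hv ha h hab
  · obtain ⟨c₀, hc₀, hc⟩ := BoseGas.exists_cParam_ge hV hA
    obtain ⟨C, δ, hC, hδ, H⟩ := BoseGas.qmEnergy_le_gpEnergy_mul hc₀
    exact ⟨C, δ, hC, hδ, fun N v a Φ hN hv ha hΦ hNa hle =>
      H N V v a Φ hN hV hv ha hΦ (hc N a Φ hN ha.nonneg hΦ hNa) hle⟩
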